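/- **Setting.** Use coordinates $\tau\in(-1,1)$, $\rho\in(0,\rho_0)$ and points of $\mathbb S^2$ on the cylinder at spatial infinity of Minkowski spacetime. Let $\eth,\bar\eth$ be the Newman–Penrose operators on spin-weighted functions and ${}_sY_{l,m}$ the orthonormal spin-weighted spherical harmonics, with $\eth\,{}_sY_{l,m}=-\sqrt{(l-s)(l+s+1)}\,{}_{s+1}Y_{l,m}$ and $\bar\eth\,{}_sY_{l,m}=\sqrt{(l+s)(l-s+1)}\,{}_{s-1}Y_{l,m}$. The component $\psi_n$ ($n=0,\dots,4$) of a symmetric spinor $\psi_{ABCD}$ in the spin dyad of the F-gauge has spin weight $2-n$. On the slice $\{\tau=0\}$, whose intrinsic metric is, up to sign, $d\rho^2/\rho^2+\sigma_{\mathbb S^2}$, let $D_{AB}$ be the spinorial Levi-Civita derivative, with dyad components $D_{00}=-\eth/\sqrt2$, $D_{01}=\rho\partial_\rho/\sqrt2$, $D_{11}=\bar\eth/\sqrt2$. Put $$(\mathrm d_4\phi)_{CD}=D^{AB}\phi_{ABCD},\quad (\mathrm c_4\phi)_{ABCD}=D_{(A}{}^E\phi_{BCD)E},\quad (\mathrm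 t_2\chi)_{ABCD}=D_{(AB}\chi_{CD)},$$ $$\mathcal G_4=2\,\mathrm t_2\mathrm d_4\mathrm c_4+8\,\mathrm c_4\mathrm c_4\mathrm c_4 .$$ **Hypotheses.** Let $\psi_{ABCD}$ ($C^2$ for $\rho>0$) satisfy the massless spin-2 equation, that is, the evolution equations $$\begin{aligned} (1+\tau)\dot\psi_0-\rho\partial_\rho\psi_0-\eth\psi_1&=-2\psi_0,\\ (1+\tfrac\tau2)\dot\psi_1-\tfrac\rho2\partial_\rho\psi_1-\tfrac14\bar\eth\psi_0-\tfrac34\eth\psi_2&=-\psi_1,\\ \dot\psi_2-\tfrac12\bar\eth\psi_1-\tfrac12\eth\psi_3&=0,\\ (1-\tfrac\tau2)\dot\psi_3+\tfrac\rho2\partial_\rho\psi_3-\tfrac34\bar\eth\psi_2-\tfrac14\eth\psi_4&=\psi_3,\\ (1-\tau)\dot\psi_4+\rho\partial_\rho\psi_4-\bar\eth\psi_3&=2\psi_4, \end{aligned}$$ and the constraints $\tau\dot\psi_n-\rho\partial_\rho\psi_n+\tfrac12\bar\eth\psi_{n-1}-\tfrac12\eth\psi_{n+1}=0$ for $n=1,2,3$;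 or, more generally, let it satisfy the wave equation $\square\psi_{ABCD}=0$, that is, for $n=0,\dots,4$ and with $s=2-n$, $$(1-\tau^2)\ddot\psi_n+2\rho\tau\,\partial_\rho\dot\psi_n-\rho^2\partial_\rho^2\psi_n-\tfrac12(\eth\bar\eth+\bar\eth\eth)\psi_n+2(s-\tau)\dot\psi_n+s^2\psi_n=0,$$ together with the evolution equations on the slice $\tau=0$. Assume $$\psi_n=\sum_{l\ge|2-n|}\sum_{m=-l}^{l}a_{n;l,m}(\tau)\,{}_{2-n}Y_{l,m}+o_1(\rho)\qquad(\rho\to0),$$ where the leading term is $C^1$ and $o_1(\rho)$ denotes a function that is $o(\rho)$ with first derivatives $o(1)$, uniformly on $\mathbb S^2$ and locally uniformly in $\tau\in(-1,1)$. Assume also that $\psi_{ABCD}|_{\tau=0}=(\mathcal G_4\Psi)_{ABCD}$ for a symmetric spinor $\Psi_{ABCD}$ ($C^3$ for $\rho>0$) whose components satisfy $$\Psi_n=\sum_{l\ge|2-n|}\sum_{m=-l}^{l}b_{n;l,m}\,{}_{2-n}Y_{l,m}+o(\rho),$$ uniformly on $\mathbb S^2$, with continuous leading term. For fixed $l,m$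 write $(b_n)_*=b_{n;l,m}$. **Claim.** There are real constants $C_l,D_l$, depending only on $l$, such that for all such $\psi,\Psi$ and all $l\ge0$, $|m|\le l$, the coefficient $a_{2;l,m}$ is regular at $\tau=\pm1$ (it extends smoothly through both endpoints) if and only if - (i) $(b_2)_*=C_l\,(b_4)_*-D_l\,(b_0)_*$ in case $l\ge1$ is even, and - (ii) $(b_1)_*=(b_3)_*$ in case $l$ is odd. If $a_{2;l,m}$ is not regular, then $|a_{2;l,m}(\tau)|\to\infty$ both as $\tau\to1$ and as $\tau\to-1$. -/

import Mathlib

open scoped ContDiff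

noncomputable section

/-! ### Spin-weighted functions on the unit sphere

A point `z = (a, b)` of `ℂ² \ {0}` represents, up to a positive factor, a spin frame on the unit
sphere `𝕊²`; multiplying `z` by `exp (i α)` rotates the frame.  Spin-weighted functions are the
functions on `ℂ² \ {0}` that are invariant under positive rescalings and transform by a phase under
rotations of the frame (equivalently, equivariant functions on `SU(2)`). -/

/-- `f` has spin weight `s`. -/
def HasSpinWeight (s : ℤ) (f : ℂ × ℂ → ℂ) : Prop :=
  ∀ (c : ℂ) (z : ℂ × ℂ), c ≠ 0 → z ≠ 0 → f (c • z) = (c / (‖c‖ : ℂ)) ^ (2 * s) * f z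

/-- The direction `(-b̄, ā)` at `z = (a, b)`. -/
def frameDir (z : ℂ × ℂ) : ℂ × ℂ := (-(starRingEnd ℂ z.2), starRingEnd ℂ z.1)

/-- The operator `ð`, that is `-b ∂/∂ā + a ∂/∂b̄`; it raises the spin weight by one, and
`ð (ₛYₗₘ) = -√((l - s)(l + s + 1)) ₛ₊₁Yₗₘ`. -/
def eth (f : ℂ × ℂ → ℂ) (z : ℂ × ℂ) : ℂ :=
  (1 / 2 : ℂ) * (fderiv ℝ f z (frameDir z) + Complex.I * fderiv ℝ f z (Complex.I • frameDir z))

/-- The operator `ð̄`, that is `-b̄ ∂/∂a + ā ∂/∂b`; it lowers the spin weight by one, and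
`ð̄ (ₛYₗₘ) = √((l + s)(l - s + 1)) ₛ₋₁Yₗₘ`. -/
def ethBar (f : ℂ × ℂ → ℂ) (z : ℂ × ℂ) : ℂ :=
  (1 / 2 : ℂ) * (fderiv ℝ f z (frameDir z) - Complex.I * fderiv ℝ f z (Complex.I • frameDir z))

/-- The spin-weighted spherical harmonic `ₛYₗₘ` (for `|s| ≤ l`, `|m| ≤ l`) at a unit vector
`z = (a, b)`: up to normalisation, the coefficient of `X ^ (l + m)` in
`(a X + b) ^ (l + s) (-b̄ X + ā) ^ (l - s)`. -/
def spinY (s : ℤ) (l : ℕ) (m : ℤ) (z : ℂ × ℂ) : ℂ :=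
  (Real.sqrt ((2 * l + 1) / (4 * Real.pi) *
      (((l + m).toNat.factorial * (l - m).toNat.factorial : ℕ) : ℝ) /
      (((l + s).toNat.factorial * (l - s).toNat.factorial : ℕ) : ℝ)) : ℂ) *
    ((Polynomial.C z.1 * Polynomial.X + Polynomial.C z.2) ^ (l + s).toNat *
      (Polynomial.C (-(starRingEnd ℂ z.2)) * Polynomial.X +
        Polynomial.C (starRingEnd ℂ z.1)) ^ (l - s).toNat).coeff (l + m).toNat

/-- The unit vector over the point of the sphere with spherical coordinates `(θ, φ)`. -/
def sphereFrame (θ φ : ℝ) : ℂ × ℂ :=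
  ((Real.cos (θ / 2) : ℂ) * Complex.exp (Complex.I * (φ / 2)),
    (Real.sin (θ / 2) : ℂ) * Complex.exp (-(Complex.I * (φ / 2))))

/-- The coefficient of `ₛYₗₘ` in the expansion of a function `f` of spin weight `s` in
spin-weighted spherical harmonics: the `L²(𝕊²)` inner product of `f` with `ₛYₗₘ`. -/
def harmonicCoeff (s : ℤ) (l : ℕ) (m : ℤ) (f : ℂ × ℂ → ℂ) : ℂ :=
  ∫ θ in (0 : ℝ)..Real.pi, ∫ φ in (0 : ℝ)..(2 * Real.pi),
    f (sphereFrame θ φ) * starRingEnd ℂ (spinY s l m (sphereFrame θ φ)) * (Real.sin θ : ℂ)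

/-! ### The slice `τ = 0` and the spinor operators on it

The intrinsic metric is the (negative of the) cylinder metric `dρ² / ρ² + σ`.  For the dyad of the
F-gauge its Levi-Civita connection is the one of the unit sphere, which is absorbed in `ð`, `ð̄`. -/

/-- Functions of `ρ` and of the spin frame on the sphere. -/
abbrev SliceField := ℝ → ℂ × ℂ → ℂ

/-- The dyad components `D_{AB}` of the Levi-Civita connection, acting on dyad components of
spinors. -/
def spatialD (A B : Fin 2) (f : SliceField) : SliceField := fun ρ z =>
  if A = 0 ∧ B = 0 then -(eth (f ρ) z) / (Real.sqrt 2 : ℂ)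
  else if A = 1 ∧ B = 1 then ethBar (f ρ) z / (Real.sqrt 2 : ℂ)
  else (ρ : ℂ) * deriv (fun r => f r z) ρ / (Real.sqrt 2 : ℂ)

/-- The components `ε^{AB}`; indices are raised by `ξ^A = ε^{AB} ξ_B`. -/
def epsUp (A B : Fin 2) : ℂ := if A = 0 ∧ B = 1 then 1 else if A = 1 ∧ B = 0 then -1 else 0

/-- Valence-2 and valence-4 spinor fields on the slice, by their dyad components. -/
abbrev Spinor2 := Fin 2 → Fin 2 → SliceField
abbrev Spinor4 := Fin 2 → Fin 2 → Fin 2 → Fin 2 → SliceField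

/-- The divergence `D^{AB} φ_{ABCD}`. -/
def spinorDiv (φ : Spinor4) : Spinor2 := fun C D ρ z =>
  ∑ A, ∑ B, ∑ E, ∑ F, epsUp A E * epsUp B F * spatialD E F (φ A B C D) ρ z

/-- `D_A{}^E φ_{BCDE}`, not yet symmetrised. -/
def spinorRot (φ : Spinor4) : Spinor4 := fun A B C D ρ z =>
  ∑ E, ∑ F, epsUp E F * spatialD A F (φ B C D E) ρ z

/-- The curl `D_{(A}{}^E φ_{BCD)E}` of a symmetric spinor. -/
def spinorCurl (φ : Spinor4) : Spinor4 := fun A B C D ρ z =>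
  (1 / 4 : ℂ) * (spinorRot φ A B C D ρ z + spinorRot φ B A C D ρ z +
    spinorRot φ C A B D ρ z + spinorRot φ D A B C ρ z)

/-- The twistor operator `D_{(AB} χ_{CD)}` on a symmetric spinor. -/
def spinorTwist (χ : Spinor2) : Spinor4 := fun A B C D ρ z =>
  (1 / 6 : ℂ) * (spatialD A B (χ C D) ρ z + spatialD A C (χ B D) ρ z +
    spatialD A D (χ B C) ρ z + spatialD B C (χ A D) ρ z +
    spatialD B D (χ A C) ρ z + spatialD C D (χ A B) ρ z)

/-- The symmetric spinor `Ψ_{ABCD}` with given components `Ψ₀, …, Ψ₄`. -/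
def ofComponents (Ψ : Fin 5 → SliceField) : Spinor4 := fun A B C D =>
  Ψ ⟨A.val + B.val + C.val + D.val, by omega⟩

/-- The components `φ₀, …, φ₄` of a symmetric spinor (`n` of the indices are contracted with
`ι`). -/
def components (φ : Spinor4) : Fin 5 → SliceField :=
  ![φ 0 0 0 0, φ 0 0 0 1, φ 0 0 1 1, φ 0 1 1 1, φ 1 1 1 1]

/-- `𝒢₄ = 2 t₂ d₄ c₄ + 8 c₄ c₄ c₄`. -/
def hertzG (Φ : Spinor4) : Spinor4 := fun A B C D ρ z =>
  2 * spinorTwist (spinorDiv (spinorCurl Φ)) A B C D ρ z +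
    8 * spinorCurl (spinorCurl (spinorCurl Φ)) A B C D ρ z

/-! ### The field equations in the F-gauge -/

/-- Functions of `τ`, `ρ` and of the spin frame on the sphere. -/
abbrev SpacetimeField := ℝ → ℝ → ℂ × ℂ → ℂ

def dTau (f : SpacetimeField) : SpacetimeField := fun τ ρ z => deriv (fun t => f t ρ z) τ
def dRho (f : SpacetimeField) : SpacetimeField := fun τ ρ z => deriv (fun r => f τ r z) ρ
def ethF (f : SpacetimeField) : SpacetimeField := fun τ ρ => eth (f τ ρ)
def ethBarF (f : SpacetimeField) : SpacetimeField := fun τ ρ => ethBar (f τ ρ)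

/-- The spin weight `2 - n` of the component `ψₙ`. -/
def weight (n : Fin 5) : ℤ := 2 - (n.val : ℤ)

/-- The evolution equations of `∇^A_{A'} ψ_{ABCD} = 0` at a point. -/
def EvolutionAt (ψ : Fin 5 → SpacetimeField) (τ ρ : ℝ) (z : ℂ × ℂ) : Prop :=
  ((1 + τ) * dTau (ψ 0) τ ρ z - ρ * dRho (ψ 0) τ ρ z - ethF (ψ 1) τ ρ z = -2 * ψ 0 τ ρ z) ∧
  ((1 + τ / 2) * dTau (ψ 1) τ ρ z - ρ / 2 * dRho (ψ 1) τ ρ z - ethBarF (ψ 0) τ ρ z / 4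
      - 3 * ethF (ψ 2) τ ρ z / 4 = -ψ 1 τ ρ z) ∧
  (dTau (ψ 2) τ ρ z - ethBarF (ψ 1) τ ρ z / 2 - ethF (ψ 3) τ ρ z / 2 = 0) ∧
  ((1 - τ / 2) * dTau (ψ 3) τ ρ z + ρ / 2 * dRho (ψ 3) τ ρ z - 3 * ethBarF (ψ 2) τ ρ z / 4
      - ethF (ψ 4) τ ρ z / 4 = ψ 3 τ ρ z) ∧
  ((1 - τ) * dTau (ψ 4) τ ρ z + ρ * dRho (ψ 4) τ ρ z - ethBarF (ψ 3) τ ρ z = 2 * ψ 4 τ ρ z)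

/-- The constraint equations of `∇^A_{A'} ψ_{ABCD} = 0` at a point. -/
def ConstraintAt (ψ : Fin 5 → SpacetimeField) (τ ρ : ℝ) (z : ℂ × ℂ) : Prop :=
  (τ * dTau (ψ 1) τ ρ z - ρ * dRho (ψ 1) τ ρ z + ethBarF (ψ 0) τ ρ z / 2
      - ethF (ψ 2) τ ρ z / 2 = 0) ∧
  (τ * dTau (ψ 2) τ ρ z - ρ * dRho (ψ 2) τ ρ z + ethBarF (ψ 1) τ ρ z / 2
      - ethF (ψ 3) τ ρ z / 2 = 0) ∧
  (τ * dTau (ψ 3) τ ρ z - ρ * dRho (ψ 3) τ ρ z + ethBarF (ψ 2) τ ρ z / 2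
      - ethF (ψ 4) τ ρ z / 2 = 0)

/-- The massless spin-2 equation `∇^A_{A'} ψ_{ABCD} = 0` for `|τ| < 1`, `0 < ρ < ρ₀`. -/
def IsSpin2Field (ρ₀ : ℝ) (ψ : Fin 5 → SpacetimeField) : Prop :=
  ∀ τ ∈ Set.Ioo (-1 : ℝ) 1, ∀ ρ ∈ Set.Ioo 0 ρ₀, ∀ z : ℂ × ℂ, z ≠ 0 →
    EvolutionAt ψ τ ρ z ∧ ConstraintAt ψ τ ρ z

/-- The wave equation `□ ψ_{ABCD} = 0` for `|τ| < 1`, `0 < ρ < ρ₀`. -/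
def IsSpin2Wave (ρ₀ : ℝ) (ψ : Fin 5 → SpacetimeField) : Prop :=
  ∀ n : Fin 5, ∀ τ ∈ Set.Ioo (-1 : ℝ) 1, ∀ ρ ∈ Set.Ioo 0 ρ₀, ∀ z : ℂ × ℂ, z ≠ 0 →
    (1 - τ ^ 2) * dTau (dTau (ψ n)) τ ρ z + 2 * ρ * τ * dRho (dTau (ψ n)) τ ρ z
      - ρ ^ 2 * dRho (dRho (ψ n)) τ ρ z
      - (1 / 2) * (ethF (ethBarF (ψ n)) τ ρ z + ethBarF (ethF (ψ n)) τ ρ z)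
      + 2 * (weight n - τ) * dTau (ψ n) τ ρ z + (weight n) ^ 2 * ψ n τ ρ z = 0

/-- The evolution equations on the initial slice `τ = 0`. -/
def EvolutionOnSlice (ρ₀ : ℝ) (ψ : Fin 5 → SpacetimeField) : Prop :=
  ∀ ρ ∈ Set.Ioo 0 ρ₀, ∀ z : ℂ × ℂ, z ≠ 0 → EvolutionAt ψ 0 ρ z

/-! ### Expansions at `ρ = 0` -/

/-- `R = o₁(ρ)`: `R = o(ρ)` and the first derivatives of `R` are `o(1)` as `ρ → 0`, uniformly on
the sphere and locally uniformly in `τ ∈ (-1, 1)`. -/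
def IsLittleO₁ (ρ₀ : ℝ) (R : SpacetimeField) : Prop :=
  ∀ T < (1 : ℝ), ∀ ε > (0 : ℝ), ∃ δ > (0 : ℝ), ∀ τ ρ : ℝ, ∀ z : ℂ × ℂ,
    |τ| ≤ T → 0 < ρ → ρ < δ → ρ < ρ₀ → z ≠ 0 →
      ‖R τ ρ z‖ ≤ ε * ρ ∧ ‖dTau R τ ρ z‖ ≤ ε ∧ ‖dRho R τ ρ z‖ ≤ ε ∧
        ‖ethF R τ ρ z‖ ≤ ε ∧ ‖ethBarF R τ ρ z‖ ≤ ε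

/-- `R = o(ρ)` as `ρ → 0`, uniformly on the sphere. -/
def IsLittleO₀ (ρ₀ : ℝ) (R : SliceField) : Prop :=
  ∀ ε > (0 : ℝ), ∃ δ > (0 : ℝ), ∀ ρ : ℝ, ∀ z : ℂ × ℂ,
    0 < ρ → ρ < δ → ρ < ρ₀ → z ≠ 0 → ‖R ρ z‖ ≤ ε * ρ

/-- `ψₙ = ψₙ⁽⁰⁾(τ) + o₁(ρ)` with `ψₙ` of class `C²` for `ρ > 0`, `ψₙ⁽⁰⁾` of class `C¹`, both of
spin weight `2 - n`. -/
structure FieldExpansion (ρ₀ : ℝ) (ψ : Fin 5 → SpacetimeField)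
    (ψ0 : Fin 5 → ℝ → ℂ × ℂ → ℂ) : Prop where
  contDiffOn : ∀ n, ContDiffOn ℝ 2 (fun p : ℝ × ℝ × (ℂ × ℂ) => ψ n p.1 p.2.1 p.2.2)
    (Set.Ioo (-1 : ℝ) 1 ×ˢ Set.Ioo 0 ρ₀ ×ˢ {0}ᶜ)
  spinWeight : ∀ n, ∀ τ ∈ Set.Ioo (-1 : ℝ) 1, ∀ ρ ∈ Set.Ioo 0 ρ₀,
    HasSpinWeight (weight n) (ψ n τ ρ)
  contDiffOn_lead : ∀ n, ContDiffOn ℝ 1 (fun p : ℝ × (ℂ × ℂ) => ψ0 n p.1 p.2)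
    (Set.Ioo (-1 : ℝ) 1 ×ˢ {0}ᶜ)
  spinWeight_lead : ∀ n, ∀ τ ∈ Set.Ioo (-1 : ℝ) 1, HasSpinWeight (weight n) (ψ0 n τ)
  remainder : ∀ n, IsLittleO₁ ρ₀ (fun τ ρ z => ψ n τ ρ z - ψ0 n τ z)

/-- `Ψₙ = Ψₙ⁽⁰⁾ + o(ρ)` with `Ψₙ` of class `C³` for `ρ > 0`, `Ψₙ⁽⁰⁾` continuous, both of spin
weight `2 - n`. -/
structure PotentialExpansion (ρ₀ : ℝ) (Ψ : Fin 5 → SliceField)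
    (Ψ0 : Fin 5 → ℂ × ℂ → ℂ) : Prop where
  contDiffOn : ∀ n, ContDiffOn ℝ 3 (fun p : ℝ × (ℂ × ℂ) => Ψ n p.1 p.2)
    (Set.Ioo 0 ρ₀ ×ˢ {0}ᶜ)
  spinWeight : ∀ n, ∀ ρ ∈ Set.Ioo 0 ρ₀, HasSpinWeight (weight n) (Ψ n ρ)
  continuousOn_lead : ∀ n, ContinuousOn (Ψ0 n) {0}ᶜ
  spinWeight_lead : ∀ n, HasSpinWeight (weight n) (Ψ0 n)
  remainder : ∀ n, IsLittleO₀ ρ₀ (fun ρ z => Ψ n ρ z - Ψ0 n z)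

/-! ### Regularity at the critical sets -/

/-- `a : (-1, 1) → ℂ` is regular at `τ = ±1`: it extends smoothly through both endpoints. -/
def RegularAtCriticalSets (a : ℝ → ℂ) : Prop :=
  ∃ f : ℝ → ℂ, ContDiff ℝ ∞ f ∧ ∀ τ ∈ Set.Ioo (-1 : ℝ) 1, a τ = f τ

/-- `a : (-1, 1) → ℂ` diverges both at `τ = 1` and at `τ = -1`. -/
def DivergesAtCriticalSets (a : ℝ → ℂ) : Prop :=
  Filter.Tendsto (fun τ => ‖a τ‖) (nhdsWithin 1 (Set.Iio 1)) Filter.atTop ∧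
    Filter.Tendsto (fun τ => ‖a τ‖) (nhdsWithin (-1) (Set.Ioi (-1))) Filter.atTop

end

/-! Expanding in spin-weighted harmonics turns `ð` and `ð̄` into multiplication by ∓√((l - s)(l + s
+ 1)) (`modeCoeff_eth`, `modeCoeff_ethBar`), because integration by parts on the sphere moves them
onto the harmonics. As ρ → 0 the field equations force the mode a₂ to solve the Legendre equation (1
- τ²)a'' - 2τa' + l(l+1)a = 0 (`legendre_of_spin2Field`, `legendre_of_spin2Wave`).

A solution of the Legendre equation is either a multiple of the Legendre polynomial P, hence smooth
at ±1, or has nonzero Wronskian with P and diverges logarithmically at both ends. By the parity of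
P, the Wronskian at τ = 0 vanishes exactly when a'(0) = 0 (l even) or a(0) = 0 (l odd); this is
`LegendreSystem.regular_iff`.

It remains to express these data through b. The third evolution equation gives a₂'(0) = ½ε₀(a₁ -
a₃)(0) with ε₀ = `ethFactor l 0`. Since ψ(0) = 𝒢₄Ψ and ρ∂_ρ contributes nothing at ρ = 0, the values
aₙ(0) are linear in b, with coefficients cubic in ε₀ and ε₁ = `ethFactor l 1` divided by powers of
√2. Up to nonzero factors for l ≥ 1, a₂(0) is b₁ - b₃ (`limitHertz_middle`) and (a₁ - a₃)(0) is
ε₁(b₀ + b₄) - 6ε₀b₂ (`limitHertz_sub`), so C = ε₁/(6ε₀) and D = -C.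

The expansion of Ψ controls Ψ itself but none of its derivatives, and that of ψ controls only first
derivatives. Limits as ρ → 0 are therefore taken weakly (`WeakLim`): f(ρr) is tested against bumps
in r, and `WeakLim.euler` shows that ρ∂_ρ annihilates weak limits. For the wave equation, a
preliminary integration in τ removes the second τ-derivative and the mixed derivative. -/

noncomputable section

/-! ### Phase weights and the spin frame -/

/-- Equivariance of weight `s` under rotations of the frame. -/
def PhaseWeight (s : ℤ) (f : ℂ × ℂ → ℂ) : Prop :=
  ∀ (c : ℂ) (z : ℂ × ℂ), ‖c‖ = 1 → z ≠ 0 → f (c • z) = c ^ (2 * s) * f z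

theorem HasSpinWeight.phaseWeight {s : ℤ} {f : ℂ × ℂ → ℂ} (h : HasSpinWeight s f) :
    PhaseWeight s f := by
  intro c z hc hz
  have h0 : c ≠ 0 := by
    rintro rfl
    simp at hc
  simpa [hc] using h c z h0 hz

theorem PhaseWeight.neg_apply {s : ℤ} {f : ℂ × ℂ → ℂ} (h : PhaseWeight s f) {z : ℂ × ℂ}
    (hz : z ≠ 0) : f (-z) = f z := by
  have := h (-1) z (by simp) hz
  rw [neg_one_smul, zpow_mul] at this
  simpa using this

/-- Infinitesimal equivariance: differentiate t ↦ f(e^{it} z) at t = 0. This evaluates the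
derivative along the fibre of the frame bundle, which Stokes' theorem below needs. -/
theorem PhaseWeight.fderiv_I_smul {s : ℤ} {f : ℂ × ℂ → ℂ} (h : PhaseWeight s f) {z : ℂ × ℂ}
    (hz : z ≠ 0) (hf : DifferentiableAt ℝ f z) :
    fderiv ℝ f z (Complex.I • z) = 2 * s * Complex.I * f z := by
  have e : HasDerivAt (fun t : ℝ => Complex.exp (t * Complex.I)) Complex.I 0 := by
    have h1 : HasDerivAt (fun t : ℝ => (t : ℂ) * Complex.I) Complex.I 0 := by
      simpa using (Complex.ofRealCLM.hasDerivAt (x := (0 : ℝ))).mul_const Complex.I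
    simpa using h1.cexp
  have h1 : HasDerivAt (fun t : ℝ => f (Complex.exp (t * Complex.I) • z))
      (fderiv ℝ f z (Complex.I • z)) 0 := by
    have hz' : HasFDerivAt f (fderiv ℝ f z) (Complex.exp ((0 : ℝ) * Complex.I) • z) := by
      simpa using hf.hasFDerivAt
    exact hz'.comp_hasDerivAt (0 : ℝ) (e.smul_const z)
  have h2 : HasDerivAt (fun t : ℝ => Complex.exp (t * (2 * s * Complex.I)) * f z)
      (2 * s * Complex.I * f z) 0 := by
    have h3 : HasDerivAt (fun t : ℝ => (t : ℂ) * (2 * s * Complex.I)) (2 * s * Complex.I) 0 := by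
      simpa using (Complex.ofRealCLM.hasDerivAt (x := (0 : ℝ))).mul_const (2 * s * Complex.I)
    simpa using h3.cexp.mul_const (f z)
  refine h1.unique (h2.congr_of_eventuallyEq (Filter.Eventually.of_forall fun t => ?_))
  simp only
  rw [h _ z (Complex.norm_exp_ofReal_mul_I t) hz, ← Complex.exp_int_mul]
  congr 2
  push_cast
  ring

theorem PhaseWeight.mul {s t : ℤ} {f g : ℂ × ℂ → ℂ} (hf : PhaseWeight s f)
    (hg : PhaseWeight t g) : PhaseWeight (s + t) (fun z => f z * g z) := by
  intro c z hc hz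
  have h0 : c ≠ 0 := by
    rintro rfl
    simp at hc
  simp only [hf c z hc hz, hg c z hc hz]
  rw [mul_add, zpow_add₀ h0]
  ring

theorem conj_eq_inv_of_norm_one {c : ℂ} (hc : ‖c‖ = 1) : starRingEnd ℂ c = c⁻¹ := by
  rw [Complex.inv_def, Complex.normSq_eq_norm_sq, hc]
  simp

theorem PhaseWeight.conj {s : ℤ} {f : ℂ × ℂ → ℂ} (hf : PhaseWeight s f) :
    PhaseWeight (-s) (fun z => starRingEnd ℂ (f z)) := by
  intro c z hc hz
  simp only [hf c z hc hz, map_mul, map_zpow₀, conj_eq_inv_of_norm_one hc]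
  rw [inv_zpow', mul_neg]

/-- The common form of `ð` (`κ = i`) and `ð̄` (`κ = -i`). -/
def frameDeriv (κ : ℂ) (f : ℂ × ℂ → ℂ) (z : ℂ × ℂ) : ℂ :=
  (1 / 2 : ℂ) * (fderiv ℝ f z (frameDir z) + κ * fderiv ℝ f z (Complex.I • frameDir z))

theorem eth_eq_frameDeriv : eth = frameDeriv Complex.I := rfl

theorem ethBar_eq_frameDeriv : ethBar = frameDeriv (-Complex.I) := by
  funext f z
  simp [ethBar, frameDeriv, sub_eq_add_neg]

theorem frameDir_smul (c : ℂ) (z : ℂ × ℂ) : frameDir (c • z) = starRingEnd ℂ c • frameDir z := by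
  simp [frameDir]

theorem contDiff_frameDir : ContDiff ℝ ∞ frameDir := by
  have h1 : ContDiff ℝ ∞ (fun z : ℂ × ℂ => starRingEnd ℂ z.1) :=
    Complex.conjCLE.contDiff.comp contDiff_fst
  have h2 : ContDiff ℝ ∞ (fun z : ℂ × ℂ => starRingEnd ℂ z.2) :=
    Complex.conjCLE.contDiff.comp contDiff_snd
  exact h2.neg.prodMk h1

theorem frameDeriv_mul {κ : ℂ} {f g : ℂ × ℂ → ℂ} {z : ℂ × ℂ} (hf : DifferentiableAt ℝ f z)
    (hg : DifferentiableAt ℝ g z) :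
    frameDeriv κ (fun z => f z * g z) z = frameDeriv κ f z * g z + f z * frameDeriv κ g z := by
  simp only [frameDeriv, fderiv_fun_mul hf hg, _root_.add_apply,
    _root_.smul_apply, smul_eq_mul]
  ring

theorem fderiv_conj_apply {f : ℂ × ℂ → ℂ} {z : ℂ × ℂ} (hf : DifferentiableAt ℝ f z)
    (v : ℂ × ℂ) :
    fderiv ℝ (fun z => starRingEnd ℂ (f z)) z v = starRingEnd ℂ (fderiv ℝ f z v) := by
  have h := Complex.conjCLE.hasFDerivAt.comp z hf.hasFDerivAt
  have : (fun z => starRingEnd ℂ (f z)) = Complex.conjCLE ∘ f := by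
    funext z
    simp
  rw [this, h.fderiv]
  simp

theorem frameDeriv_conj {κ : ℂ} {f : ℂ × ℂ → ℂ} {z : ℂ × ℂ} (hf : DifferentiableAt ℝ f z) :
    frameDeriv κ (fun z => starRingEnd ℂ (f z)) z =
      starRingEnd ℂ (frameDeriv (starRingEnd ℂ κ) f z) := by
  simp [frameDeriv, fderiv_conj_apply hf, map_ofNat]

/-- The equivariance identity holds on a neighbourhood of z, so it may be differentiated in z. -/
theorem fderiv_smul_apply {s : ℤ} {f : ℂ × ℂ → ℂ} (h : PhaseWeight s f) {c : ℂ} (hc : ‖c‖ = 1)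
    {z : ℂ × ℂ} (hz : z ≠ 0) (hf : ∀ z ≠ 0, DifferentiableAt ℝ f z) (v : ℂ × ℂ) :
    fderiv ℝ f (c • z) (c • v) = c ^ (2 * s) * fderiv ℝ f z v := by
  have h0 : c ≠ 0 := by
    rintro rfl
    simp at hc
  have hcz : c • z ≠ 0 := smul_ne_zero h0 hz
  have hL : HasFDerivAt (fun z : ℂ × ℂ => c • z)
      (c • ContinuousLinearMap.id ℝ (ℂ × ℂ)) z := (hasFDerivAt_id z).const_smul c
  have h1 := (hf _ hcz).hasFDerivAt.comp z hL
  have h2 : HasFDerivAt (fun z => c ^ (2 * s) * f z) (c ^ (2 * s) • fderiv ℝ f z) z :=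
    (hf z hz).hasFDerivAt.const_mul _
  have h3 := h1.unique (h2.congr_of_eventuallyEq
    (Filter.eventually_of_mem (isOpen_ne.mem_nhds hz) fun y hy => h c y hc hy))
  have := DFunLike.congr_fun h3 v
  simpa using this

theorem PhaseWeight.eth {s : ℤ} {f : ℂ × ℂ → ℂ} (h : PhaseWeight s f)
    (hf : ∀ z ≠ 0, DifferentiableAt ℝ f z) : PhaseWeight (s + 1) (eth f) := by
  intro c z hc hz
  have h0 : c ≠ 0 := by
    rintro rfl
    simp at hc
  have key := fderiv_smul_apply h hc hz hf
  -- The derivative of f is only real-linear. The factor c̄ by which `frameDir` turns is written as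
  -- c · c⁻², and c⁻² is split into real and imaginary parts, so that c is absorbed by
  -- `fderiv_smul_apply` and only real scalars remain.
  have e1 : starRingEnd ℂ c = c * (c⁻¹ ^ 2) := by
    rw [conj_eq_inv_of_norm_one hc]; field_simp
  have e2 : c⁻¹ ^ 2 = ((c⁻¹ ^ 2).re : ℂ) + ((c⁻¹ ^ 2).im : ℂ) * Complex.I :=
    (Complex.re_add_im _).symm
  have e3 : c ^ 2 = ((c⁻¹ ^ 2).re : ℂ) - ((c⁻¹ ^ 2).im : ℂ) * Complex.I := by
    have : c ^ 2 = starRingEnd ℂ (c⁻¹ ^ 2) := by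
      rw [map_pow, map_inv₀, conj_eq_inv_of_norm_one hc, inv_inv]
    rw [this]
    nth_rewrite 1 [e2]
    simp [sub_eq_add_neg]
  set p := (c⁻¹ ^ 2).re
  set q := (c⁻¹ ^ 2).im
  have d1 : frameDir (c • z) = c • (p • frameDir z + q • (Complex.I • frameDir z)) := by
    rw [frameDir_smul, e1, mul_smul, e2]
    congr 1
    simp only [add_smul, mul_smul, Complex.coe_smul]
  have d2 : Complex.I • frameDir (c • z)
      = c • (p • (Complex.I • frameDir z) - q • frameDir z) := by
    rw [d1, smul_comm]
    congr 1
    rw [smul_add, smul_comm Complex.I p, smul_comm Complex.I q, smul_smul Complex.I Complex.I,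
      Complex.I_mul_I, neg_one_smul, smul_neg, sub_eq_add_neg]
  rw [_root_.eth, _root_.eth, d2, d1, key, key, mul_add 2 s 1, mul_one, zpow_add₀ h0]
  simp only [map_add, map_sub, map_smul, Complex.real_smul]
  have : c ^ (2 : ℤ) = c ^ 2 := rfl
  rw [this, e3]
  ring_nf
  rw [Complex.I_sq]
  ring

/-- Conjugation exchanges the two operators and negates the weight, so the statement for `ð` carries
over. -/
theorem PhaseWeight.ethBar {s : ℤ} {f : ℂ × ℂ → ℂ} (h : PhaseWeight s f)
    (hf : ∀ z ≠ 0, DifferentiableAt ℝ f z) : PhaseWeight (s - 1) (ethBar f) := by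
  have h1 := (h.conj.eth (fun z hz => Complex.conjCLE.differentiableAt.comp z (hf z hz))).conj
  have e : -(-s + 1) = s - 1 := by ring
  rw [e] at h1
  intro c z hc hz
  have h0 : c ≠ 0 := by
    rintro rfl
    simp at hc
  have h2 := h1 c z hc hz
  have h3 : ∀ z ≠ 0, starRingEnd ℂ (_root_.eth (fun z => starRingEnd ℂ (f z)) z)
      = _root_.ethBar f z := by
    intro z hz
    rw [eth_eq_frameDeriv, frameDeriv_conj (hf z hz), ethBar_eq_frameDeriv]
    simp
  simpa only [h3 z hz, h3 _ (smul_ne_zero h0 hz)] using h2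

/-! ### Integration over the sphere -/

theorem sphereFrame_norm (θ φ : ℝ) :
    ‖(sphereFrame θ φ).1‖ ^ 2 + ‖(sphereFrame θ φ).2‖ ^ 2 = 1 := by
  have h1 : ‖Complex.exp (Complex.I * ((φ : ℂ) / 2))‖ = 1 := by
    rw [Complex.norm_exp]; simp
  have h2 : ‖Complex.exp (-(Complex.I * ((φ : ℂ) / 2)))‖ = 1 := by
    rw [Complex.norm_exp]; simp
  simp only [sphereFrame, norm_mul, h1, h2, mul_one]
  have e1 : Complex.cos (θ / 2) = ((Real.cos (θ / 2) : ℝ) : ℂ) := by push_cast; rfl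
  have e2 : Complex.sin (θ / 2) = ((Real.sin (θ / 2) : ℝ) : ℂ) := by push_cast; rfl
  rw [Complex.norm_real, Complex.norm_real, Real.norm_eq_abs, Real.norm_eq_abs, sq_abs, sq_abs]
  exact Real.cos_sq_add_sin_sq _

/-- The unit sphere of `ℂ²`, the space of unit spin frames. -/
def unitFrames : Set (ℂ × ℂ) := {z | ‖z.1‖ ^ 2 + ‖z.2‖ ^ 2 = 1}

theorem sphereFrame_mem (θ φ : ℝ) : sphereFrame θ φ ∈ unitFrames := sphereFrame_norm θ φ

theorem unitFrames_ne_zero {z : ℂ × ℂ} (hz : z ∈ unitFrames) : z ≠ 0 := by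
  rintro rfl
  simp [unitFrames] at hz

theorem sphereFrame_ne_zero (θ φ : ℝ) : sphereFrame θ φ ≠ 0 :=
  unitFrames_ne_zero (sphereFrame_mem θ φ)

theorem isCompact_unitFrames : IsCompact unitFrames := by
  refine Metric.isCompact_of_isClosed_isBounded ?_ ?_
  · exact isClosed_eq (by fun_prop) continuous_const
  · refine (Metric.isBounded_closedBall (x := (0 : ℂ × ℂ)) (r := 1)).subset fun z hz => ?_
    simp only [unitFrames, Set.mem_ofPred_eq] at hz
    simp only [mem_closedBall_zero_iff, Prod.norm_def, sup_le_iff]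
    constructor
    · nlinarith [norm_nonneg z.1, sq_nonneg ‖z.2‖]
    · nlinarith [norm_nonneg z.2, sq_nonneg ‖z.1‖]

theorem contDiff_sphereFrame : ContDiff ℝ ∞ (fun p : ℝ × ℝ => sphereFrame p.1 p.2) := by
  unfold sphereFrame
  have hθ : ContDiff ℝ ∞ (fun p : ℝ × ℝ => (p.1 : ℂ)) := Complex.ofRealCLM.contDiff.comp contDiff_fst
  have hφ : ContDiff ℝ ∞ (fun p : ℝ × ℝ => (p.2 : ℂ)) := Complex.ofRealCLM.contDiff.comp contDiff_snd
  have h1 : ContDiff ℝ ∞ (fun p : ℝ × ℝ => ((Real.cos (p.1 / 2) : ℝ) : ℂ)) :=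
    Complex.ofRealCLM.contDiff.comp (Real.contDiff_cos.comp (contDiff_fst.div_const _))
  have h2 : ContDiff ℝ ∞ (fun p : ℝ × ℝ => ((Real.sin (p.1 / 2) : ℝ) : ℂ)) :=
    Complex.ofRealCLM.contDiff.comp (Real.contDiff_sin.comp (contDiff_fst.div_const _))
  have h3 : ContDiff ℝ ∞ (fun p : ℝ × ℝ => Complex.I * ((p.2 : ℂ) / 2)) :=
    contDiff_const.mul (hφ.div_const _)
  exact (h1.mul h3.cexp).prodMk (h2.mul h3.neg.cexp)

theorem continuous_sphereFrame : Continuous (fun p : ℝ × ℝ => sphereFrame p.1 p.2) :=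
  contDiff_sphereFrame.continuous

theorem sphereFrame_periodic (θ : ℝ) :
    sphereFrame θ (2 * Real.pi) = -sphereFrame θ 0 := by
  have e1 : Complex.exp (Complex.I * (((2 * Real.pi : ℝ) : ℂ) / 2)) = -1 := by
    rw [← Complex.exp_pi_mul_I]; congr 1; push_cast; ring
  have e2 : Complex.exp (-(Complex.I * (((2 * Real.pi : ℝ) : ℂ) / 2))) = -1 := by
    rw [Complex.exp_neg, e1]; norm_num
  simp only [sphereFrame, e1, e2]
  simp

theorem hasDerivAt_sphereFrame_theta (θ φ : ℝ) :
    HasDerivAt (fun t => sphereFrame t φ) ((1 / 2 : ℝ) • frameDir (sphereFrame θ φ)) θ := by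
  have hh : HasDerivAt (fun t : ℝ => t / 2) (1 / 2) θ := (hasDerivAt_id θ).div_const 2
  have h1 := (hh.cos.ofReal_comp).mul_const (Complex.exp (Complex.I * ((φ : ℂ) / 2)))
  have h2 := (hh.sin.ofReal_comp).mul_const (Complex.exp (-(Complex.I * ((φ : ℂ) / 2))))
  have h : HasDerivAt (fun t => sphereFrame t φ) _ θ := h1.prodMk h2
  refine h.congr_deriv ?_
  have e1 : starRingEnd ℂ (Complex.exp (Complex.I * ((φ : ℂ) / 2)))
      = Complex.exp (-(Complex.I * ((φ : ℂ) / 2))) := by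
    rw [← Complex.exp_conj]; simp [map_ofNat]
  have e2 : starRingEnd ℂ (Complex.exp (-(Complex.I * ((φ : ℂ) / 2))))
      = Complex.exp (Complex.I * ((φ : ℂ) / 2)) := by
    rw [← Complex.exp_conj]; simp [map_ofNat]
  simp only [frameDir, sphereFrame, map_mul, e1, e2, Complex.conj_ofReal, Prod.smul_mk,
    Prod.mk.injEq, Complex.real_smul]
  constructor <;> push_cast <;> ring

/-- The φ-direction splits into a rotation of the frame, along i z, and a horizontal part, along i
`frameDir`. The cos θ term is the spin connection. -/
theorem hasDerivAt_sphereFrame_phi (θ φ : ℝ) :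
    HasDerivAt (fun t => sphereFrame θ t)
      ((1 / 2 * Real.cos θ : ℝ) • (Complex.I • sphereFrame θ φ)
        - (1 / 2 * Real.sin θ : ℝ) • (Complex.I • frameDir (sphereFrame θ φ))) φ := by
  have h0 : HasDerivAt (fun t : ℝ => Complex.I * ((t : ℂ) / 2)) (Complex.I * (1 / 2)) φ :=
    ((Complex.ofRealCLM.hasDerivAt (x := φ)).div_const 2).const_mul Complex.I
  have h1 := h0.cexp.const_mul ((Real.cos (θ / 2) : ℝ) : ℂ)
  have h2 := h0.neg.cexp.const_mul ((Real.sin (θ / 2) : ℝ) : ℂ)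
  have h : HasDerivAt (fun t => sphereFrame θ t) _ φ := h1.prodMk h2
  refine h.congr_deriv ?_
  have e1 : starRingEnd ℂ (Complex.exp (Complex.I * ((φ : ℂ) / 2)))
      = Complex.exp (-(Complex.I * ((φ : ℂ) / 2))) := by
    rw [← Complex.exp_conj]; simp [map_ofNat]
  have e2 : starRingEnd ℂ (Complex.exp (-(Complex.I * ((φ : ℂ) / 2))))
      = Complex.exp (Complex.I * ((φ : ℂ) / 2)) := by
    rw [← Complex.exp_conj]; simp [map_ofNat]
  have c1 : Real.cos θ = Real.cos (θ / 2) ^ 2 - Real.sin (θ / 2) ^ 2 := by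
    rw [← Real.cos_two_mul']; congr 1; ring
  have c2 : Real.sin θ = 2 * Real.sin (θ / 2) * Real.cos (θ / 2) := by
    rw [← Real.sin_two_mul]; congr 1; ring
  have c3 := Real.cos_sq_add_sin_sq (θ / 2)
  rw [c1, c2]
  simp only [frameDir, sphereFrame]
  set x := Real.cos (θ / 2)
  set y := Real.sin (θ / 2)
  have c4 : (x : ℂ) ^ 2 + (y : ℂ) ^ 2 = 1 := by exact_mod_cast c3
  simp only [map_mul, e1, e2, Complex.conj_ofReal, Prod.smul_mk,
    Complex.real_smul, Prod.mk_sub_mk, Prod.mk.injEq, smul_eq_mul, Pi.neg_apply]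
  push_cast
  constructor
  · linear_combination (-1 / 2 * Complex.I * x * Complex.exp (Complex.I * ((φ : ℂ) / 2))) * c4
  · linear_combination (1 / 2 * Complex.I * y * Complex.exp (-(Complex.I * ((φ : ℂ) / 2)))) * c4

/-- The integral over the sphere of a function of weight zero. -/
def sphereInt (F : ℂ × ℂ → ℂ) : ℂ :=
  ∫ θ in (0 : ℝ)..Real.pi, ∫ φ in (0 : ℝ)..(2 * Real.pi),
    F (sphereFrame θ φ) * (Real.sin θ : ℂ)

/-- Stokes' theorem on the sphere for a frame derivative with values of weight zero. -/
theorem sphereInt_frameDeriv {κ : ℂ} (hκ : κ ^ 2 = -1) {F : ℂ × ℂ → ℂ}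
    (hF : ContDiffOn ℝ 1 F {0}ᶜ) (hper : ∀ z ≠ 0, F (-z) = F z)
    (hI : ∀ z ≠ 0, fderiv ℝ F z (Complex.I • z) = -2 * κ * F z) :
    sphereInt (frameDeriv κ F) = 0 := by
  have hopen : IsOpen ({0}ᶜ : Set (ℂ × ℂ)) := isOpen_compl_singleton
  have hFd : ∀ z ≠ 0, DifferentiableAt ℝ F z := fun z hz =>
    (hF.differentiableOn (by norm_num)).differentiableAt (hopen.mem_nhds hz)
  set G : ℝ × ℝ → ℂ := fun p => F (sphereFrame p.1 p.2) with hG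
  have hGc : ContDiff ℝ 1 G := contDiffOn_univ.1
    (hF.comp (contDiff_sphereFrame.of_le (by exact_mod_cast le_top)).contDiffOn
      (fun p _ => sphereFrame_ne_zero p.1 p.2))
  have hGd : Differentiable ℝ G := hGc.differentiable (by norm_num)
  set f : ℝ × ℝ → ℂ := fun p => ((Real.sin p.1 : ℝ) : ℂ) * G p with hf
  set g : ℝ × ℝ → ℂ := fun p => -κ * G p with hg
  have hsin : ContDiff ℝ 1 (fun p : ℝ × ℝ => ((Real.sin p.1 : ℝ) : ℂ)) :=
    Complex.ofRealCLM.contDiff.comp (Real.contDiff_sin.comp contDiff_fst)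
  have hfc : ContDiff ℝ 1 f := hsin.mul hGc
  have hgc : ContDiff ℝ 1 g := contDiff_const.mul hGc
  have hfd : Differentiable ℝ f := hfc.differentiable (by norm_num)
  have hgd : Differentiable ℝ g := hgc.differentiable (by norm_num)
  -- The frame derivative times the area density is the divergence ∂_θ(sin θ F) + ∂_φ(-κF). The two
  -- cos θ terms cancel by `hI` and κ² = -1.
  have key : ∀ θ φ : ℝ, fderiv ℝ f (θ, φ) (1, 0) + fderiv ℝ g (θ, φ) (0, 1)
      = frameDeriv κ F (sphereFrame θ φ) * (Real.sin θ : ℂ) := by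
    intro θ φ
    have hz := sphereFrame_ne_zero θ φ
    have c1 : HasDerivAt (fun t : ℝ => (t, φ)) ((1, 0) : ℝ × ℝ) θ :=
      (hasDerivAt_id θ).prodMk (hasDerivAt_const θ φ)
    have c2 : HasDerivAt (fun t : ℝ => (θ, t)) ((0, 1) : ℝ × ℝ) φ :=
      (hasDerivAt_const φ θ).prodMk (hasDerivAt_id φ)
    have g1 := (hFd _ hz).hasFDerivAt.comp_hasDerivAt θ (hasDerivAt_sphereFrame_theta θ φ)
    have g2 := (hFd _ hz).hasFDerivAt.comp_hasDerivAt φ (hasDerivAt_sphereFrame_phi θ φ)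
    have f1 : HasDerivAt (fun t => f (t, φ)) _ θ := ((hfd (θ, φ)).hasFDerivAt).comp_hasDerivAt (f := fun t => (t, φ)) θ c1
    have f2 : HasDerivAt (fun t => g (θ, t)) _ φ := ((hgd (θ, φ)).hasFDerivAt).comp_hasDerivAt (f := fun t => (θ, t)) φ c2
    have a1 := f1.unique ((Real.hasDerivAt_sin θ).ofReal_comp.mul g1)
    have a2 := f2.unique (g2.const_mul (-κ))
    rw [a1, a2]
    simp only [frameDeriv, map_sub, map_smul, hI _ hz, Complex.real_smul]
    push_cast
    linear_combination (Complex.cos θ * F (sphereFrame θ φ)) * hκ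
  have hdiv := MeasureTheory.integral2_divergence_prod_of_hasFDerivAt f g (fderiv ℝ f)
    (fderiv ℝ g) 0 0 Real.pi (2 * Real.pi) hfc.continuous.continuousOn hgc.continuous.continuousOn
    (fun x _ => (hfd x).hasFDerivAt) (fun x _ => (hgd x).hasFDerivAt) (by
      refine ContinuousOn.integrableOn_compact (isCompact_uIcc.prod isCompact_uIcc) ?_
      exact (((hfc.continuous_fderiv (by norm_num)).clm_apply continuous_const).add
        ((hgc.continuous_fderiv (by norm_num)).clm_apply continuous_const)).continuousOn)
  simp only [key] at hdiv
  rw [sphereInt, hdiv]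
  -- The half angles make the frame change sign after one turn in φ; F is even, so the φ-boundary
  -- terms cancel. Those in θ vanish with sin θ at the poles.
  have p1 : ∀ θ : ℝ, g (θ, 2 * Real.pi) = g (θ, 0) := by
    intro θ
    simp only [hg, hG, sphereFrame_periodic]
    rw [hper _ (sphereFrame_ne_zero θ 0)]
  have p2 : ∀ φ : ℝ, f (Real.pi, φ) = 0 := by intro φ; simp [hf]
  have p3 : ∀ φ : ℝ, f (0, φ) = 0 := by intro φ; simp [hf]
  simp only [p1, p2, p3]
  simp

theorem sphereInt_eth {F : ℂ × ℂ → ℂ} (hF : ContDiffOn ℝ 1 F {0}ᶜ) (hw : PhaseWeight (-1) F) :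
    sphereInt (eth F) = 0 := by
  rw [eth_eq_frameDeriv]
  refine sphereInt_frameDeriv (by simp) hF (fun z hz => hw.neg_apply hz) fun z hz => ?_
  rw [hw.fderiv_I_smul hz ((hF.differentiableOn (by norm_num)).differentiableAt
    (isOpen_compl_singleton.mem_nhds hz))]
  push_cast; ring

theorem sphereInt_ethBar {F : ℂ × ℂ → ℂ} (hF : ContDiffOn ℝ 1 F {0}ᶜ) (hw : PhaseWeight 1 F) :
    sphereInt (ethBar F) = 0 := by
  rw [ethBar_eq_frameDeriv]
  refine sphereInt_frameDeriv (by simp) hF (fun z hz => hw.neg_apply hz) fun z hz => ?_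
  rw [hw.fderiv_I_smul hz ((hF.differentiableOn (by norm_num)).differentiableAt
    (isOpen_compl_singleton.mem_nhds hz))]
  push_cast; ring

/-! ### Frame derivatives of the spin-weighted harmonics -/

/-- The coefficientwise frame derivative of the polynomial-valued function `p` is `q`. -/
def HasPolyFrameDeriv (κ : ℂ) (p q : ℂ × ℂ → Polynomial ℂ) : Prop :=
  (∀ k, ContDiff ℝ ∞ fun z => (p z).coeff k) ∧
    ∀ k z, frameDeriv κ (fun z => (p z).coeff k) z = (q z).coeff k

theorem frameDeriv_sum {ι : Type*} {κ : ℂ} (s : Finset ι) {f : ι → ℂ × ℂ → ℂ} {z : ℂ × ℂ}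
    (hf : ∀ i ∈ s, DifferentiableAt ℝ (f i) z) :
    frameDeriv κ (fun z => ∑ i ∈ s, f i z) z = ∑ i ∈ s, frameDeriv κ (f i) z := by
  simp only [frameDeriv, fderiv_fun_sum hf, _root_.sum_apply, Finset.mul_sum,
    ← Finset.sum_add_distrib]

theorem frameDeriv_const {κ : ℂ} (c : ℂ) (z : ℂ × ℂ) : frameDeriv κ (fun _ => c) z = 0 := by
  simp [frameDeriv]

theorem frameDeriv_const_mul {κ : ℂ} (c : ℂ) {f : ℂ × ℂ → ℂ} {z : ℂ × ℂ}
    (hf : DifferentiableAt ℝ f z) :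
    frameDeriv κ (fun z => c * f z) z = c * frameDeriv κ f z := by
  rw [frameDeriv_mul (differentiableAt_const c) hf, frameDeriv_const]
  ring

theorem HasPolyFrameDeriv.mul {κ : ℂ} {p q p' q' : ℂ × ℂ → Polynomial ℂ}
    (h : HasPolyFrameDeriv κ p q) (h' : HasPolyFrameDeriv κ p' q') :
    HasPolyFrameDeriv κ (fun z => p z * p' z) (fun z => q z * p' z + p z * q' z) := by
  constructor
  · intro k
    simp only [Polynomial.coeff_mul]
    exact ContDiff.sum fun i _ => (h.1 _).mul (h'.1 _)
  · intro k z
    have hd : ∀ k, DifferentiableAt ℝ (fun z => (p z).coeff k) z := fun k =>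
      ((h.1 k).differentiable (by simp)).differentiableAt
    have hd' : ∀ k, DifferentiableAt ℝ (fun z => (p' z).coeff k) z := fun k =>
      ((h'.1 k).differentiable (by simp)).differentiableAt
    simp only [Polynomial.coeff_mul, Polynomial.coeff_add]
    rw [frameDeriv_sum _ (fun i _ => (hd _).fun_mul (hd' _)), ← Finset.sum_add_distrib]
    refine Finset.sum_congr rfl fun i _ => ?_
    rw [frameDeriv_mul (hd _) (hd' _), h.2, h'.2]

theorem HasPolyFrameDeriv.pow {κ : ℂ} {p q : ℂ × ℂ → Polynomial ℂ}
    (h : HasPolyFrameDeriv κ p q) (n : ℕ) :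
    HasPolyFrameDeriv κ (fun z => p z ^ n) (fun z => (n : Polynomial ℂ) * p z ^ (n - 1) * q z) := by
  induction n with
  | zero =>
    constructor
    · intro k
      simpa using contDiff_const
    · intro k z
      simp [frameDeriv_const]
  | succ n ih =>
    have := ih.mul h
    simp only [pow_succ]
    convert this using 2 with z
    rcases n with _ | n
    · simp
    · simp only [Nat.add_sub_cancel]
      push_cast
      ring

/-- The linear forms `a X + b` and `-b̄ X + ā` attached to the frame `(a, b)`. -/
def frameForm (z : ℂ × ℂ) : Polynomial ℂ :=
  Polynomial.C z.1 * Polynomial.X + Polynomial.C z.2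

def frameFormBar (z : ℂ × ℂ) : Polynomial ℂ :=
  Polynomial.C (-(starRingEnd ℂ z.2)) * Polynomial.X + Polynomial.C (starRingEnd ℂ z.1)

theorem coeff_linear (a b : ℂ) (k : ℕ) :
    (Polynomial.C a * Polynomial.X + Polynomial.C b).coeff k =
      if k = 0 then b else if k = 1 then a else 0 := by
  rcases k with _ | _ | k <;> simp [Polynomial.coeff_X, Polynomial.coeff_C]

theorem hasFDerivAt_fst_frame (z : ℂ × ℂ) :
    HasFDerivAt (fun z : ℂ × ℂ => z.1) (ContinuousLinearMap.fst ℝ ℂ ℂ) z := hasFDerivAt_fst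

theorem hasFDerivAt_snd_frame (z : ℂ × ℂ) :
    HasFDerivAt (fun z : ℂ × ℂ => z.2) (ContinuousLinearMap.snd ℝ ℂ ℂ) z := hasFDerivAt_snd

theorem frameDeriv_fst (κ : ℂ) (z : ℂ × ℂ) :
    frameDeriv κ (fun z => z.1) z = -(1 / 2) * (1 + κ * Complex.I) * starRingEnd ℂ z.2 := by
  simp only [frameDeriv, (hasFDerivAt_fst_frame z).fderiv, ContinuousLinearMap.coe_fst', frameDir,
    Prod.smul_fst, smul_eq_mul]
  ring

theorem frameDeriv_snd (κ : ℂ) (z : ℂ × ℂ) :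
    frameDeriv κ (fun z => z.2) z = (1 / 2) * (1 + κ * Complex.I) * starRingEnd ℂ z.1 := by
  simp only [frameDeriv, (hasFDerivAt_snd_frame z).fderiv, ContinuousLinearMap.coe_snd', frameDir,
    Prod.smul_snd, smul_eq_mul]
  ring

theorem frameDeriv_conj_fst (κ : ℂ) (z : ℂ × ℂ) :
    frameDeriv κ (fun z => starRingEnd ℂ z.1) z = -(1 / 2) * (1 - κ * Complex.I) * z.2 := by
  rw [frameDeriv_conj (hasFDerivAt_fst_frame z).differentiableAt, frameDeriv_fst]
  simp [map_ofNat, sub_eq_add_neg]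

theorem frameDeriv_conj_snd (κ : ℂ) (z : ℂ × ℂ) :
    frameDeriv κ (fun z => starRingEnd ℂ z.2) z = (1 / 2) * (1 - κ * Complex.I) * z.1 := by
  rw [frameDeriv_conj (hasFDerivAt_snd_frame z).differentiableAt, frameDeriv_snd]
  simp [map_ofNat, sub_eq_add_neg]

theorem contDiff_conj_fst : ContDiff ℝ ∞ (fun z : ℂ × ℂ => starRingEnd ℂ z.1) :=
  Complex.conjCLE.contDiff.comp contDiff_fst

theorem contDiff_conj_snd : ContDiff ℝ ∞ (fun z : ℂ × ℂ => starRingEnd ℂ z.2) :=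
  Complex.conjCLE.contDiff.comp contDiff_snd

theorem frameForm_hasPolyFrameDeriv (κ : ℂ) :
    HasPolyFrameDeriv κ frameForm
      (fun z => Polynomial.C ((1 / 2) * (1 + κ * Complex.I)) * frameFormBar z) := by
  constructor
  · intro k
    simp only [frameForm, coeff_linear]
    split_ifs
    exacts [contDiff_snd, contDiff_fst, contDiff_const]
  · intro k z
    simp only [frameForm, frameFormBar, Polynomial.coeff_C_mul, coeff_linear]
    split_ifs
    · rw [frameDeriv_snd]
    · rw [frameDeriv_fst]; ring
    · rw [frameDeriv_const]; ring

theorem frameFormBar_hasPolyFrameDeriv (κ : ℂ) :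
    HasPolyFrameDeriv κ frameFormBar
      (fun z => Polynomial.C (-(1 / 2) * (1 - κ * Complex.I)) * frameForm z) := by
  constructor
  · intro k
    simp only [frameFormBar, coeff_linear]
    split_ifs
    exacts [contDiff_conj_fst, contDiff_conj_snd.neg, contDiff_const]
  · intro k z
    simp only [frameForm, frameFormBar, Polynomial.coeff_C_mul, coeff_linear]
    split_ifs
    · rw [frameDeriv_conj_fst]
    · have : (fun z : ℂ × ℂ => -(starRingEnd ℂ z.2)) = fun z => (-1 : ℂ) * starRingEnd ℂ z.2 := by
        funext z; ring
      rw [this, frameDeriv_const_mul _ (contDiff_conj_snd.differentiable (by simp) z),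
        frameDeriv_conj_snd]
      ring
    · rw [frameDeriv_const]; ring

/-- The normalisation factor of `ₛYₗₘ` in terms of the exponents `i = l + s` and `j = l - s`. -/
def spinNorm (l : ℕ) (m : ℤ) (i j : ℕ) : ℝ :=
  Real.sqrt ((2 * l + 1) / (4 * Real.pi) *
      (((l + m).toNat.factorial * (l - m).toNat.factorial : ℕ) : ℝ) /
      ((i.factorial * j.factorial : ℕ) : ℝ))

theorem spinY_eq (s : ℤ) (l : ℕ) (m : ℤ) (z : ℂ × ℂ) :
    spinY s l m z = (spinNorm l m (l + s).toNat (l - s).toNat : ℂ) *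
      (frameForm z ^ (l + s).toNat * frameFormBar z ^ (l - s).toNat).coeff (l + m).toNat := rfl

/-- Each linear form differentiates to a multiple of the other. At κ = i the first term vanishes, at
κ = -i the second, so a single term is left in each case. The truncated exponents are harmless,
being multiplied by i = 0 or j = 0. -/
theorem spinForm_hasPolyFrameDeriv (κ : ℂ) (i j : ℕ) :
    HasPolyFrameDeriv κ (fun z => frameForm z ^ i * frameFormBar z ^ j)
      (fun z => Polynomial.C ((i : ℂ) * ((1 / 2) * (1 + κ * Complex.I))) *
          (frameForm z ^ (i - 1) * frameFormBar z ^ (j + 1)) -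
        Polynomial.C ((j : ℂ) * ((1 / 2) * (1 - κ * Complex.I))) *
          (frameForm z ^ (i + 1) * frameFormBar z ^ (j - 1))) := by
  convert ((frameForm_hasPolyFrameDeriv κ).pow i).mul ((frameFormBar_hasPolyFrameDeriv κ).pow j)
    using 2 with z
  simp only [map_mul, map_natCast, map_neg, neg_mul]
  ring

theorem contDiff_spinY (s : ℤ) (l : ℕ) (m : ℤ) : ContDiff ℝ ∞ (spinY s l m) :=
  contDiff_const.mul ((spinForm_hasPolyFrameDeriv 0 (l + s).toNat (l - s).toNat).1 (l + m).toNat)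

/-- Under a unit phase c the two forms scale by c and c⁻¹; with exponents l + s and l - s the total
is c^{2s}. -/
theorem phaseWeight_spinY {s : ℤ} {l : ℕ} (m : ℤ) (hs : |s| ≤ l) :
    PhaseWeight s (spinY s l m) := by
  intro c z hc _
  have h0 : c ≠ 0 := by
    rintro rfl
    simp at hc
  have e1 : frameForm (c • z) = Polynomial.C c * frameForm z := by
    simp [frameForm, mul_add, mul_assoc]
  have e2 : frameFormBar (c • z) = Polynomial.C c⁻¹ * frameFormBar z := by
    simp only [frameFormBar, Prod.smul_fst, Prod.smul_snd, smul_eq_mul, map_mul,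
      conj_eq_inv_of_norm_one hc, map_neg]
    ring
  have hs' := abs_le.1 hs
  obtain ⟨i, hi⟩ := Int.eq_ofNat_of_zero_le (show (0 : ℤ) ≤ l + s by omega)
  obtain ⟨j, hj⟩ := Int.eq_ofNat_of_zero_le (show (0 : ℤ) ≤ l - s by omega)
  have e3 : c ^ (2 * s) = c ^ i * c⁻¹ ^ j := by
    rw [inv_pow, ← zpow_natCast, ← zpow_natCast, ← zpow_neg, ← zpow_add₀ h0]
    congr 1; omega
  rw [spinY_eq, spinY_eq, hi, hj, Int.toNat_natCast, Int.toNat_natCast, e1, e2, mul_pow, mul_pow,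
    e3, mul_mul_mul_comm, ← Polynomial.C_pow, ← Polynomial.C_pow, ← Polynomial.C_mul,
    Polynomial.coeff_C_mul]
  ring

/-- The factor `√((l - s)(l + s + 1))`. -/
def ethFactor (l : ℕ) (s : ℤ) : ℝ := Real.sqrt (((l : ℝ) - s) * (l + s + 1))

/-- This and `spinNorm_succ_right` turn the integer exponent produced by differentiation into the
square root of the ladder relations. -/
theorem spinNorm_succ_left (l : ℕ) (m : ℤ) (i j : ℕ) :
    spinNorm l m (i + 1) j * (i + 1) =
      Real.sqrt (((j : ℝ) + 1) * (i + 1)) * spinNorm l m i (j + 1) := by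
  have e : ((i : ℝ) + 1) = Real.sqrt (((i : ℝ) + 1) ^ 2) := (Real.sqrt_sq (by positivity)).symm
  rw [spinNorm, spinNorm]
  conv_lhs => rw [e]
  rw [← Real.sqrt_mul (by positivity), ← Real.sqrt_mul (by positivity)]
  congr 1
  simp only [Nat.factorial_succ]
  push_cast
  field_simp

theorem spinNorm_succ_right (l : ℕ) (m : ℤ) (i j : ℕ) :
    spinNorm l m i (j + 1) * (j + 1) =
      Real.sqrt (((j : ℝ) + 1) * (i + 1)) * spinNorm l m (i + 1) j := by
  have e : ((j : ℝ) + 1) = Real.sqrt (((j : ℝ) + 1) ^ 2) := (Real.sqrt_sq (by positivity)).symm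
  rw [spinNorm, spinNorm]
  conv_lhs => rw [e]
  rw [← Real.sqrt_mul (by positivity), ← Real.sqrt_mul (by positivity)]
  congr 1
  simp only [Nat.factorial_succ]
  push_cast
  field_simp

theorem frameDeriv_spinY (κ : ℂ) (s : ℤ) (l : ℕ) (m : ℤ) (z : ℂ × ℂ) (i j : ℕ)
    (hi : (l : ℤ) + s = i) (hj : (l : ℤ) - s = j) :
    frameDeriv κ (spinY s l m) z = (spinNorm l m i j : ℂ) *
      ((i : ℂ) * ((1 / 2) * (1 + κ * Complex.I)) *
          (frameForm z ^ (i - 1) * frameFormBar z ^ (j + 1)).coeff (l + m).toNat -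
        (j : ℂ) * ((1 / 2) * (1 - κ * Complex.I)) *
          (frameForm z ^ (i + 1) * frameFormBar z ^ (j - 1)).coeff (l + m).toNat) := by
  have h := spinForm_hasPolyFrameDeriv κ i j
  have e : spinY s l m = fun z => (spinNorm l m i j : ℂ) *
      (frameForm z ^ i * frameFormBar z ^ j).coeff (l + m).toNat := by
    funext z
    rw [spinY_eq, hi, hj, Int.toNat_natCast, Int.toNat_natCast]
  rw [e, frameDeriv_const_mul _ ((h.1 _).differentiable (by simp) z), h.2, Polynomial.coeff_sub,
    Polynomial.coeff_C_mul, Polynomial.coeff_C_mul]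

theorem eth_spinY {s : ℤ} {l : ℕ} (m : ℤ) (h1 : -(l : ℤ) ≤ s) (h2 : s < l) (z : ℂ × ℂ) :
    eth (spinY s l m) z = -(ethFactor l s : ℂ) * spinY (s + 1) l m z := by
  obtain ⟨i, hi⟩ := Int.eq_ofNat_of_zero_le (show (0 : ℤ) ≤ l + s by omega)
  obtain ⟨j, hj⟩ := Int.eq_ofNat_of_zero_le (show (0 : ℤ) ≤ l - s - 1 by omega)
  have hi' : (l : ℤ) + (s + 1) = ((i + 1 : ℕ) : ℤ) := by push_cast; omega
  have hj' : (l : ℤ) - (s + 1) = (j : ℤ) := by omega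
  have hl : ethFactor l s = Real.sqrt (((j : ℝ) + 1) * (i + 1)) := by
    have a1 : (l : ℝ) + s = i := by exact_mod_cast hi
    have a2 : (l : ℝ) - s - 1 = j := by exact_mod_cast hj
    rw [ethFactor, ← a1, ← a2]; congr 1; ring
  rw [eth_eq_frameDeriv, frameDeriv_spinY _ s l m z i (j + 1) hi (by push_cast; omega), spinY_eq,
    hi', hj', Int.toNat_natCast, Int.toNat_natCast, hl]
  have hn : (spinNorm l m i (j + 1) : ℂ) * (j + 1) =
      (Real.sqrt (((j : ℝ) + 1) * (i + 1)) : ℝ) * (spinNorm l m (i + 1) j : ℂ) := by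
    exact_mod_cast spinNorm_succ_right l m i j
  rw [Nat.add_sub_cancel, Complex.I_mul_I]
  push_cast
  linear_combination (-(frameForm z ^ (i + 1) * frameFormBar z ^ j).coeff (l + m).toNat) * hn

theorem ethBar_spinY {s : ℤ} {l : ℕ} (m : ℤ) (h1 : -(l : ℤ) ≤ s) (h2 : s < l) (z : ℂ × ℂ) :
    ethBar (spinY (s + 1) l m) z = (ethFactor l s : ℂ) * spinY s l m z := by
  obtain ⟨i, hi⟩ := Int.eq_ofNat_of_zero_le (show (0 : ℤ) ≤ l + s by omega)
  obtain ⟨j, hj⟩ := Int.eq_ofNat_of_zero_le (show (0 : ℤ) ≤ l - s - 1 by omega)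
  have hi' : (l : ℤ) + (s + 1) = ((i + 1 : ℕ) : ℤ) := by push_cast; omega
  have hj' : (l : ℤ) - s = ((j + 1 : ℕ) : ℤ) := by push_cast; omega
  have hl : ethFactor l s = Real.sqrt (((j : ℝ) + 1) * (i + 1)) := by
    have a1 : (l : ℝ) + s = i := by exact_mod_cast hi
    have a2 : (l : ℝ) - s - 1 = j := by exact_mod_cast hj
    rw [ethFactor, ← a1, ← a2]; congr 1; ring
  rw [ethBar_eq_frameDeriv, frameDeriv_spinY _ (s + 1) l m z (i + 1) j hi' (by omega), spinY_eq,
    hi, hj', Int.toNat_natCast, Int.toNat_natCast, hl]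
  have hn : (spinNorm l m (i + 1) j : ℂ) * (i + 1) =
      (Real.sqrt (((j : ℝ) + 1) * (i + 1)) : ℝ) * (spinNorm l m i (j + 1) : ℂ) := by
    exact_mod_cast spinNorm_succ_left l m i j
  rw [Nat.add_sub_cancel, neg_mul, Complex.I_mul_I]
  push_cast
  linear_combination ((frameForm z ^ i * frameFormBar z ^ (j + 1)).coeff (l + m).toNat) * hn

theorem eth_spinY_top (l : ℕ) (m : ℤ) (z : ℂ × ℂ) : eth (spinY l l m) z = 0 := by
  rw [eth_eq_frameDeriv, frameDeriv_spinY _ l l m z (l + l) 0 (by push_cast; rfl) (by simp),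
    Complex.I_mul_I]
  simp

theorem ethBar_spinY_bot (l : ℕ) (m : ℤ) (z : ℂ × ℂ) : ethBar (spinY (-(l : ℤ)) l m) z = 0 := by
  rw [ethBar_eq_frameDeriv, frameDeriv_spinY _ (-(l : ℤ)) l m z 0 (l + l) (by simp)
    (by push_cast; ring), neg_mul, Complex.I_mul_I]
  simp

/-! ### Mode coefficients -/

/-- The coefficient of `ₛYₗₘ`, set to zero if there is no such harmonic. -/
def modeCoeff (l : ℕ) (m : ℤ) (s : ℤ) (f : ℂ × ℂ → ℂ) : ℂ :=
  if |s| ≤ l then harmonicCoeff s l m f else 0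

theorem harmonicCoeff_eq (s : ℤ) (l : ℕ) (m : ℤ) (f : ℂ × ℂ → ℂ) :
    harmonicCoeff s l m f = sphereInt (fun z => f z * starRingEnd ℂ (spinY s l m z)) := rfl

theorem ContinuousOn.comp_sphereFrame {F : ℂ × ℂ → ℂ} (hF : ContinuousOn F {0}ᶜ) :
    Continuous (fun p : ℝ × ℝ => F (sphereFrame p.1 p.2)) :=
  hF.comp_continuous continuous_sphereFrame fun p => sphereFrame_ne_zero p.1 p.2

theorem sphereInt_add {F G : ℂ × ℂ → ℂ} (hF : ContinuousOn F {0}ᶜ) (hG : ContinuousOn G {0}ᶜ) :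
    sphereInt (fun z => F z + G z) = sphereInt F + sphereInt G := by
  have hF' := hF.comp_sphereFrame
  have hG' := hG.comp_sphereFrame
  have key : ∀ {H : ℂ × ℂ → ℂ}, Continuous (fun p : ℝ × ℝ => H (sphereFrame p.1 p.2)) →
      Continuous (fun p : ℝ × ℝ => H (sphereFrame p.1 p.2) * (Real.sin p.1 : ℂ)) := fun h =>
    h.mul (by fun_prop)
  rw [sphereInt, sphereInt, sphereInt, ← intervalIntegral.integral_add]
  · refine intervalIntegral.integral_congr fun θ _ => ?_
    simp only [add_mul]
    refine intervalIntegral.integral_add ?_ ?_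
    · exact ((key hF').comp (Continuous.prodMk_right θ)).intervalIntegrable _ _
    · exact ((key hG').comp (Continuous.prodMk_right θ)).intervalIntegrable _ _
  · exact (intervalIntegral.continuous_parametric_intervalIntegral_of_continuous' (key hF') _ _).intervalIntegrable _ _
  · exact (intervalIntegral.continuous_parametric_intervalIntegral_of_continuous' (key hG') _ _).intervalIntegrable _ _

theorem sphereInt_const_mul (c : ℂ) (F : ℂ × ℂ → ℂ) :
    sphereInt (fun z => c * F z) = c * sphereInt F := by
  simp only [sphereInt, mul_assoc, intervalIntegral.integral_const_mul]

theorem sphereInt_congr {F G : ℂ × ℂ → ℂ} (h : ∀ z ∈ unitFrames, F z = G z) :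
    sphereInt F = sphereInt G := by
  simp only [sphereInt, h _ (sphereFrame_mem _ _)]

theorem norm_sphereInt_le {F : ℂ × ℂ → ℂ} {M : ℝ} (h : ∀ z ∈ unitFrames, ‖F z‖ ≤ M) :
    ‖sphereInt F‖ ≤ M * (2 * Real.pi) * Real.pi := by
  have hM : 0 ≤ M := (norm_nonneg _).trans (h _ (sphereFrame_mem 0 0))
  have hpi := Real.pi_pos
  have h1 : ∀ θ : ℝ, ‖∫ φ in (0 : ℝ)..(2 * Real.pi), F (sphereFrame θ φ) * (Real.sin θ : ℂ)‖
      ≤ M * (2 * Real.pi) := by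
    intro θ
    have := intervalIntegral.norm_integral_le_of_norm_le_const (a := 0) (b := 2 * Real.pi)
      (f := fun φ => F (sphereFrame θ φ) * (Real.sin θ : ℂ)) (C := M) (fun φ _ => by
        rw [norm_mul, Complex.norm_real, Real.norm_eq_abs]
        calc _ ≤ M * 1 := mul_le_mul (h _ (sphereFrame_mem _ _)) (Real.abs_sin_le_one θ)
              (abs_nonneg _) hM
          _ = M := mul_one M)
    rwa [sub_zero, abs_of_pos (by positivity)] at this
  have := intervalIntegral.norm_integral_le_of_norm_le_const (a := 0) (b := Real.pi)
    (fun θ _ => h1 θ)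
  rwa [sub_zero, abs_of_pos hpi] at this

/-- Taking a mode is a bounded functional for the supremum norm over unit frames. All later limits
and derivatives of modes follow from uniform estimates on this compact set. -/
theorem exists_norm_modeCoeff_le (l : ℕ) (m s : ℤ) :
    ∃ K : ℝ, 0 < K ∧ ∀ (f : ℂ × ℂ → ℂ) (M : ℝ), (∀ z ∈ unitFrames, ‖f z‖ ≤ M) →
      ‖modeCoeff l m s f‖ ≤ K * M := by
  obtain ⟨B, hB⟩ := isCompact_unitFrames.exists_bound_of_continuousOn
    (contDiff_spinY s l m).continuous.continuousOn
  have hB0 : 0 ≤ B := (norm_nonneg _).trans (hB _ (sphereFrame_mem 0 0))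
  have hpi := Real.pi_pos
  refine ⟨(B + 1) * (2 * Real.pi) * Real.pi, by positivity, fun f M hM => ?_⟩
  have hM0 : 0 ≤ M := (norm_nonneg _).trans (hM _ (sphereFrame_mem 0 0))
  rw [modeCoeff]
  split_ifs
  · rw [harmonicCoeff_eq]
    refine (norm_sphereInt_le (M := M * (B + 1)) fun z hz => ?_).trans (le_of_eq (by ring))
    rw [norm_mul, RCLike.norm_conj]
    exact mul_le_mul (hM z hz) ((hB z hz).trans (by linarith)) (norm_nonneg _) hM0
  · rw [norm_zero]; positivity

theorem continuousOn_mul_conj_spinY {f : ℂ × ℂ → ℂ} (hf : ContinuousOn f {0}ᶜ) (s : ℤ) (l : ℕ)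
    (m : ℤ) : ContinuousOn (fun z => f z * starRingEnd ℂ (spinY s l m z)) {0}ᶜ :=
  hf.mul (Complex.continuous_conj.comp (contDiff_spinY s l m).continuous).continuousOn

theorem modeCoeff_add {l : ℕ} {m s : ℤ} {f g : ℂ × ℂ → ℂ} (hf : ContinuousOn f {0}ᶜ)
    (hg : ContinuousOn g {0}ᶜ) :
    modeCoeff l m s (fun z => f z + g z) = modeCoeff l m s f + modeCoeff l m s g := by
  simp only [modeCoeff]
  split_ifs
  · simp only [harmonicCoeff_eq, add_mul]
    exact sphereInt_add (continuousOn_mul_conj_spinY hf s l m)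
      (continuousOn_mul_conj_spinY hg s l m)
  · simp

theorem modeCoeff_const_mul (l : ℕ) (m s : ℤ) (c : ℂ) (f : ℂ × ℂ → ℂ) :
    modeCoeff l m s (fun z => c * f z) = c * modeCoeff l m s f := by
  simp only [modeCoeff]
  split_ifs
  · simp only [harmonicCoeff_eq, mul_assoc, sphereInt_const_mul]
  · simp

theorem modeCoeff_congr {l : ℕ} {m s : ℤ} {f g : ℂ × ℂ → ℂ} (h : ∀ z ∈ unitFrames, f z = g z) :
    modeCoeff l m s f = modeCoeff l m s g := by
  simp only [modeCoeff, harmonicCoeff_eq]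
  split_ifs
  · exact sphereInt_congr fun z hz => by rw [h z hz]
  · rfl

theorem modeCoeff_sub {l : ℕ} {m s : ℤ} {f g : ℂ × ℂ → ℂ} (hf : ContinuousOn f {0}ᶜ)
    (hg : ContinuousOn g {0}ᶜ) :
    modeCoeff l m s (fun z => f z - g z) = modeCoeff l m s f - modeCoeff l m s g := by
  have e : (fun z => f z - g z) = fun z => f z + (-1) * g z := by funext z; ring
  rw [e, modeCoeff_add hf (continuousOn_const.fun_mul hg), modeCoeff_const_mul]
  ring

/-- By the product rule, the vanishing total derivative `h0` makes -`frameDeriv (conj κ)` the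
adjoint of `frameDeriv κ`: up to sign, `ð` and `ð̄` are adjoint. -/
theorem sphereInt_frameDeriv_mul_conj {κ : ℂ} {f g : ℂ × ℂ → ℂ}
    (hf : ContDiffOn ℝ 1 f {0}ᶜ) (hg : ContDiff ℝ ∞ g)
    (h0 : sphereInt (frameDeriv κ (fun z => f z * starRingEnd ℂ (g z))) = 0) :
    sphereInt (fun z => frameDeriv κ f z * starRingEnd ℂ (g z)) =
      -sphereInt (fun z => f z * starRingEnd ℂ (frameDeriv (starRingEnd ℂ κ) g z)) := by
  have hopen : IsOpen ({0}ᶜ : Set (ℂ × ℂ)) := isOpen_compl_singleton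
  have hgd : Differentiable ℝ g := hg.differentiable (by simp)
  have hgd' : Differentiable ℝ (fun z => starRingEnd ℂ (g z)) := fun z =>
    Complex.conjCLE.differentiableAt.comp z (hgd z)
  have hcd : ∀ {κ : ℂ} {f : ℂ × ℂ → ℂ}, ContDiffOn ℝ 1 f {0}ᶜ →
      ContinuousOn (frameDeriv κ f) {0}ᶜ := by
    intro κ f hf
    have h1 := hf.continuousOn_fderiv_of_isOpen hopen (by norm_num)
    have h2 := contDiff_frameDir.continuous.continuousOn (s := {0}ᶜ)
    exact continuousOn_const.mul ((h1.clm_apply h2).add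
      (continuousOn_const.mul (h1.clm_apply (h2.fun_const_smul _))))
  have c1 : ContinuousOn (fun z => frameDeriv κ f z * starRingEnd ℂ (g z)) {0}ᶜ :=
    (hcd hf).mul hgd'.continuous.continuousOn
  have c2 : ContinuousOn (fun z => f z * starRingEnd ℂ (frameDeriv (starRingEnd ℂ κ) g z)) {0}ᶜ :=
    hf.continuousOn.mul (Complex.continuous_conj.comp_continuousOn
      (hcd (hg.contDiffOn.of_le (by exact_mod_cast le_top))))
  rw [eq_neg_iff_add_eq_zero, ← sphereInt_add c1 c2, ← h0]
  refine sphereInt_congr fun z hz => ?_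
  have hz0 := unitFrames_ne_zero hz
  rw [frameDeriv_mul ((hf.differentiableOn (by norm_num)).differentiableAt (hopen.mem_nhds hz0))
    (hgd' z), frameDeriv_conj (hgd z)]

theorem contDiffOn_mul_conj_spinY {f : ℂ × ℂ → ℂ} (hf : ContDiffOn ℝ 1 f {0}ᶜ) (s : ℤ) (l : ℕ)
    (m : ℤ) : ContDiffOn ℝ 1 (fun z => f z * starRingEnd ℂ (spinY s l m z)) {0}ᶜ :=
  hf.mul (Complex.conjCLE.contDiff.comp
    ((contDiff_spinY s l m).of_le (by exact_mod_cast le_top))).contDiffOn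

theorem ethFactor_bot (l : ℕ) : ethFactor l (-(l : ℤ) - 1) = 0 := by
  rw [ethFactor]
  push_cast
  rw [show (l : ℝ) + (-l - 1) + 1 = 0 by ring, mul_zero, Real.sqrt_zero]

theorem ethFactor_top (l : ℕ) : ethFactor l l = 0 := by
  simp [ethFactor]

/-- Integrate by parts and apply `ð̄` to the harmonic. The convention of zero modes for |s| > l
makes the rule hold for every weight: at s = l and s = -l - 1, where only one of the two harmonics
exists, the factor vanishes. -/
theorem modeCoeff_eth {l : ℕ} {m s : ℤ} {f : ℂ × ℂ → ℂ} (hf : ContDiffOn ℝ 1 f {0}ᶜ)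
    (hw : PhaseWeight s f) :
    modeCoeff l m (s + 1) (eth f) = -(ethFactor l s : ℂ) * modeCoeff l m s f := by
  by_cases h1 : |s + 1| ≤ (l : ℤ)
  · have h1' := abs_le.1 h1
    have hY := phaseWeight_spinY (l := l) m h1
    have hF : PhaseWeight (-1) (fun z => f z * starRingEnd ℂ (spinY (s + 1) l m z)) := by
      have := hw.mul hY.conj
      rwa [show s + -(s + 1) = -1 by ring] at this
    have key := sphereInt_frameDeriv_mul_conj (κ := Complex.I) hf (contDiff_spinY (s + 1) l m)
      (sphereInt_eth (contDiffOn_mul_conj_spinY hf (s + 1) l m) hF)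
    rw [modeCoeff, if_pos h1, harmonicCoeff_eq, eth_eq_frameDeriv, key, Complex.conj_I,
      ← ethBar_eq_frameDeriv]
    rcases eq_or_lt_of_le h1'.1 with h2 | h2
    · have hs : s = -(l : ℤ) - 1 := by omega
      subst hs
      rw [ethFactor_bot]
      simp only [sub_add_cancel, ethBar_spinY_bot]
      simp [sphereInt]
    · rw [modeCoeff, if_pos (abs_le.2 ⟨by omega, by omega⟩), harmonicCoeff_eq, neg_mul,
        ← sphereInt_const_mul]
      congr 2
      funext z
      rw [ethBar_spinY m (by omega) (by omega), map_mul, Complex.conj_ofReal]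
      ring
  · rw [modeCoeff, if_neg h1, modeCoeff]
    split_ifs with h2
    · have h2' := abs_le.1 h2
      have hs : s = l := by
        by_contra h3
        exact h1 (abs_le.2 ⟨by omega, by omega⟩)
      rw [hs, ethFactor_top]
      simp
    · simp

theorem modeCoeff_ethBar {l : ℕ} {m s : ℤ} {f : ℂ × ℂ → ℂ} (hf : ContDiffOn ℝ 1 f {0}ᶜ)
    (hw : PhaseWeight s f) :
    modeCoeff l m (s - 1) (ethBar f) = (ethFactor l (s - 1) : ℂ) * modeCoeff l m s f := by
  by_cases h1 : |s - 1| ≤ (l : ℤ)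
  · have h1' := abs_le.1 h1
    have hY := phaseWeight_spinY (l := l) m h1
    have hF : PhaseWeight 1 (fun z => f z * starRingEnd ℂ (spinY (s - 1) l m z)) := by
      have := hw.mul hY.conj
      rwa [show s + -(s - 1) = 1 by ring] at this
    have h0 := sphereInt_ethBar (contDiffOn_mul_conj_spinY hf (s - 1) l m) hF
    rw [ethBar_eq_frameDeriv] at h0
    have key := sphereInt_frameDeriv_mul_conj (κ := -Complex.I) hf (contDiff_spinY (s - 1) l m) h0
    rw [modeCoeff, if_pos h1, harmonicCoeff_eq, ethBar_eq_frameDeriv, key, map_neg, Complex.conj_I,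
      neg_neg, ← eth_eq_frameDeriv]
    rcases eq_or_lt_of_le h1'.2 with h2 | h2
    · rw [h2, ethFactor_top]
      simp only [eth_spinY_top]
      simp [sphereInt]
    · rw [modeCoeff, if_pos (abs_le.2 ⟨by omega, by omega⟩), harmonicCoeff_eq,
        ← sphereInt_const_mul, ← neg_one_mul, ← sphereInt_const_mul]
      congr 1
      funext z
      rw [eth_spinY m (by omega) h2, map_mul, map_neg, Complex.conj_ofReal, sub_add_cancel]
      ring
  · rw [modeCoeff, if_neg h1, modeCoeff]
    split_ifs with h2
    · have h2' := abs_le.1 h2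
      have hs : s = -(l : ℤ) := by
        by_contra h3
        exact h1 (abs_le.2 ⟨by omega, by omega⟩)
      rw [hs, ethFactor_bot]
      simp
    · simp

/-! ### Dependence of mode coefficients on parameters -/

/-- Joint continuity and compactness of the unit frames give convergence uniform in z, to which the
bound on modes applies. -/
theorem continuousOn_modeCoeff {P : Type*} [TopologicalSpace P] {l : ℕ} {m s : ℤ}
    {f : P → ℂ × ℂ → ℂ} {U : Set P} (hU : IsOpen U)
    (hf : ContinuousOn (fun q : P × (ℂ × ℂ) => f q.1 q.2) (U ×ˢ {0}ᶜ)) :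
    ContinuousOn (fun p => modeCoeff l m s (f p)) U := by
  obtain ⟨K, hK, hb⟩ := exists_norm_modeCoeff_le l m s
  have hfc : ∀ p ∈ U, ContinuousOn (f p) {0}ᶜ := fun p hp =>
    hf.comp (f := fun z => (p, z)) (by fun_prop) fun z hz => ⟨hp, hz⟩
  intro p hp
  refine ContinuousAt.continuousWithinAt ?_
  rw [Metric.continuousAt_iff']
  intro ε hε
  have hopen : IsOpen (U ×ˢ ({0}ᶜ : Set (ℂ × ℂ))) := hU.prod isOpen_compl_singleton
  have h1 : ∀ᶠ p' in nhds p, ∀ z ∈ unitFrames, ‖f p' z - f p z‖ < ε / (2 * K) := by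
    refine isCompact_unitFrames.eventually_forall_of_forall_eventually fun z hz => ?_
    have hz0 := unitFrames_ne_zero hz
    have c1 : ContinuousAt (fun q : P × (ℂ × ℂ) => f q.1 q.2) (p, z) :=
      hf.continuousAt (hopen.mem_nhds ⟨hp, hz0⟩)
    have c2 : ContinuousAt (fun q : P × (ℂ × ℂ) => f p q.2) (p, z) :=
      ((hfc p hp).continuousAt (isOpen_compl_singleton.mem_nhds hz0)).comp
        (f := fun q : P × (ℂ × ℂ) => q.2) continuousAt_snd
    have c3 := (c1.sub c2).norm
    have : ‖f p z - f p z‖ < ε / (2 * K) := by simpa using by positivity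
    exact c3.eventually_lt continuousAt_const this
  filter_upwards [h1, hU.mem_nhds hp] with p' hp' hpU
  rw [dist_eq_norm, ← modeCoeff_sub (hfc p' hpU) (hfc p hp)]
  refine (hb _ _ fun z hz => (hp' z hz).le).trans_lt ?_
  rw [mul_div_assoc', div_lt_iff₀ (by positivity)]
  nlinarith

theorem hasDerivAt_modeCoeff {l : ℕ} {m s : ℤ} {f f' : ℝ → ℂ × ℂ → ℂ} {U : Set ℝ}
    (hU : IsOpen U) (hf : ∀ x ∈ U, ContinuousOn (f x) {0}ᶜ)
    (hf' : ContinuousOn (fun q : ℝ × (ℂ × ℂ) => f' q.1 q.2) (U ×ˢ {0}ᶜ))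
    (hd : ∀ x ∈ U, ∀ z ≠ 0, HasDerivAt (fun t => f t z) (f' x z) x) {x : ℝ} (hx : x ∈ U) :
    HasDerivAt (fun t => modeCoeff l m s (f t)) (modeCoeff l m s (f' x)) x := by
  obtain ⟨K, hK, hb⟩ := exists_norm_modeCoeff_le l m s
  have hfc : ∀ p ∈ U, ContinuousOn (f' p) {0}ᶜ := fun p hp =>
    hf'.comp (f := fun z => (p, z)) (by fun_prop) fun z hz => ⟨hp, hz⟩
  have hopen : IsOpen (U ×ˢ ({0}ᶜ : Set (ℂ × ℂ))) := hU.prod isOpen_compl_singleton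
  rw [hasDerivAt_iff_isLittleO, Asymptotics.isLittleO_iff]
  intro ε hε
  have h1 : ∀ᶠ y in nhds x, ∀ z ∈ unitFrames, ‖f' y z - f' x z‖ < ε / K := by
    refine isCompact_unitFrames.eventually_forall_of_forall_eventually fun z hz => ?_
    have hz0 := unitFrames_ne_zero hz
    have c1 : ContinuousAt (fun q : ℝ × (ℂ × ℂ) => f' q.1 q.2) (x, z) :=
      hf'.continuousAt (hopen.mem_nhds ⟨hx, hz0⟩)
    have c2 : ContinuousAt (fun q : ℝ × (ℂ × ℂ) => f' x q.2) (x, z) :=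
      ((hfc x hx).continuousAt (isOpen_compl_singleton.mem_nhds hz0)).comp
        (f := fun q : ℝ × (ℂ × ℂ) => q.2) continuousAt_snd
    have c3 := (c1.sub c2).norm
    have : ‖f' x z - f' x z‖ < ε / K := by simpa using by positivity
    exact c3.eventually_lt continuousAt_const this
  obtain ⟨δ, hδ, hball⟩ := Metric.eventually_nhds_iff_ball.1 (h1.and (hU.mem_nhds hx))
  filter_upwards [Metric.ball_mem_nhds x hδ] with y hy
  have hyU := (hball y hy).2
  have e : modeCoeff l m s (f y) - modeCoeff l m s (f x) - (y - x) • modeCoeff l m s (f' x)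
      = modeCoeff l m s (fun z => f y z - f x z - ((y - x : ℝ) : ℂ) * f' x z) := by
    rw [modeCoeff_sub ((hf y hyU).fun_sub (hf x hx)) (continuousOn_const.fun_mul (hfc x hx)),
      modeCoeff_sub (hf y hyU) (hf x hx), modeCoeff_const_mul, Complex.real_smul]
  rw [e]
  refine (hb _ (ε / K * ‖y - x‖) fun z hz => ?_).trans (le_of_eq (by field_simp))
  have hz0 := unitFrames_ne_zero hz
  -- The mean value inequality for t ↦ f(t, z) - t f'(x, z) gives an error of order ε|y - x| with
  -- the same constant for all frames z.
  have mv := (convex_ball x δ).norm_image_sub_le_of_norm_hasDerivWithin_le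
    (f := fun t => f t z - ((t : ℝ) : ℂ) * f' x z) (f' := fun t => f' t z - f' x z) (C := ε / K)
    (fun t ht => by
      have := (hd t (hball t ht).2 z hz0).sub
        ((Complex.ofRealCLM.hasDerivAt (x := t)).mul_const (f' x z))
      simp only [Complex.ofRealCLM_apply, Complex.ofReal_one, one_mul] at this
      exact this.hasDerivWithinAt)
    (fun t ht => ((hball t ht).1 z hz).le) (Metric.mem_ball_self hδ) hy
  refine le_trans (le_of_eq ?_) mv
  congr 1
  push_cast
  ring

/-! ### Weak limits at `ρ = 0` -/

/-- `f(ρ r)` tends to the constant `L` as `ρ → 0`, tested against smooth functions of `r` with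
compact support in `(1, 2)`. -/
def WeakLim (f : ℝ → ℂ) (L : ℂ) : Prop :=
  ∀ φ : ℝ → ℝ, ContDiff ℝ ∞ φ → tsupport φ ⊆ Set.Ioo 1 2 →
    Filter.Tendsto (fun ρ => ∫ r in (1 : ℝ)..2, (φ r : ℂ) * f (ρ * r)) (nhdsWithin 0 (Set.Ioi 0))
      (nhds ((∫ r in (1 : ℝ)..2, (φ r : ℂ)) * L))

theorem eventually_scaled_mem {ρ₀ : ℝ} (h0 : 0 < ρ₀) :
    ∀ᶠ ρ : ℝ in nhdsWithin 0 (Set.Ioi 0), 0 < ρ ∧ ∀ r ∈ Set.uIcc (1 : ℝ) 2,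
      ρ * r ∈ Set.Ioo 0 ρ₀ := by
  -- Half of ρ₀ suffices because r ≤ 2.
  have h1 : Set.Ioo (0 : ℝ) (ρ₀ / 2) ∈ nhdsWithin (0 : ℝ) (Set.Ioi 0) :=
    Ioo_mem_nhdsGT (by positivity)
  filter_upwards [h1] with ρ hρ
  refine ⟨hρ.1, fun r hr => ?_⟩
  rw [Set.uIcc_of_le (by norm_num)] at hr
  have := hρ.1
  have := hρ.2
  constructor
  · have := hr.1
    positivity
  · nlinarith [hr.1, hr.2]

theorem intervalIntegrable_scaled {ρ₀ ρ : ℝ} {f : ℝ → ℂ} (hf : ContinuousOn f (Set.Ioo 0 ρ₀))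
    {φ : ℝ → ℂ} (hφ : Continuous φ) (hρ : ∀ r ∈ Set.uIcc (1 : ℝ) 2, ρ * r ∈ Set.Ioo 0 ρ₀) :
    IntervalIntegrable (fun r => φ r * f (ρ * r)) MeasureTheory.volume 1 2 :=
  (hφ.continuousOn.mul (hf.comp (by fun_prop) hρ)).intervalIntegrable

theorem WeakLim.of_tendsto {ρ₀ : ℝ} (h0 : 0 < ρ₀) {f : ℝ → ℂ} {L : ℂ}
    (hf : ContinuousOn f (Set.Ioo 0 ρ₀))
    (h : Filter.Tendsto f (nhdsWithin 0 (Set.Ioi 0)) (nhds L)) : WeakLim f L := by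
  intro φ hφ _
  have hφc : Continuous (fun r => (φ r : ℂ)) := Complex.continuous_ofReal.comp hφ.continuous
  obtain ⟨B, hB⟩ := (isCompact_uIcc (a := (1 : ℝ)) (b := 2)).exists_bound_of_continuousOn
    hφc.continuousOn
  have hB0 : 0 ≤ B := (norm_nonneg _).trans (hB 1 (by simp))
  rw [Metric.tendsto_nhds]
  intro ε hε
  rw [Metric.tendsto_nhdsWithin_nhds] at h
  obtain ⟨δ, hδ, hfδ⟩ := h (ε / (2 * (B + 1))) (by positivity)
  filter_upwards [eventually_scaled_mem h0, eventually_scaled_mem hδ] with ρ h1 h2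
  have e : (∫ r in (1 : ℝ)..2, (φ r : ℂ) * f (ρ * r)) - (∫ r in (1 : ℝ)..2, (φ r : ℂ)) * L
      = ∫ r in (1 : ℝ)..2, (φ r : ℂ) * (f (ρ * r) - L) := by
    rw [← intervalIntegral.integral_mul_const, ← intervalIntegral.integral_sub
      (intervalIntegrable_scaled hf hφc h1.2) ((hφc.fun_mul continuous_const).intervalIntegrable _ _)]
    simp only [mul_sub]
  rw [dist_eq_norm, e]
  have := intervalIntegral.norm_integral_le_of_norm_le_const (a := 1) (b := 2)
    (f := fun r => (φ r : ℂ) * (f (ρ * r) - L)) (C := B * (ε / (2 * (B + 1)))) (fun r hr => by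
      have hr' := Set.uIoc_subset_uIcc hr
      rw [norm_mul, ← dist_eq_norm]
      have hm := h2.2 r hr'
      refine mul_le_mul (hB r hr') (hfδ hm.1 ?_).le dist_nonneg hB0
      rw [dist_zero_right, Real.norm_eq_abs, abs_of_pos hm.1]
      exact hm.2)
  refine this.trans_lt ?_
  rw [show |(2 : ℝ) - 1| = 1 by norm_num, mul_one, mul_div_assoc', div_lt_iff₀ (by positivity)]
  nlinarith

theorem WeakLim.add {ρ₀ : ℝ} (h0 : 0 < ρ₀) {f g : ℝ → ℂ} {L M : ℂ}
    (hfc : ContinuousOn f (Set.Ioo 0 ρ₀)) (hgc : ContinuousOn g (Set.Ioo 0 ρ₀))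
    (hf : WeakLim f L) (hg : WeakLim g M) : WeakLim (fun ρ => f ρ + g ρ) (L + M) := by
  intro φ hφ hs
  have hφc : Continuous (fun r => (φ r : ℂ)) := Complex.continuous_ofReal.comp hφ.continuous
  have h := (hf φ hφ hs).add (hg φ hφ hs)
  rw [← mul_add] at h
  refine h.congr' ?_
  filter_upwards [eventually_scaled_mem h0] with ρ hρ
  rw [← intervalIntegral.integral_add (intervalIntegrable_scaled hfc hφc hρ.2)
    (intervalIntegrable_scaled hgc hφc hρ.2)]
  simp only [mul_add]

theorem WeakLim.const_mul {f : ℝ → ℂ} {L : ℂ} (c : ℂ) (hf : WeakLim f L) :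
    WeakLim (fun ρ => c * f ρ) (c * L) := by
  intro φ hφ hs
  have h := (hf φ hφ hs).const_mul c
  rw [mul_left_comm] at h
  refine h.congr fun ρ => ?_
  rw [← intervalIntegral.integral_const_mul]
  simp only [mul_left_comm]

theorem WeakLim.congr {ρ₀ : ℝ} (h0 : 0 < ρ₀) {f g : ℝ → ℂ} {L : ℂ}
    (h : ∀ ρ ∈ Set.Ioo 0 ρ₀, f ρ = g ρ) (hf : WeakLim f L) : WeakLim g L := by
  intro φ hφ hs
  refine (hf φ hφ hs).congr' ?_
  filter_upwards [eventually_scaled_mem h0] with ρ hρ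
  exact intervalIntegral.integral_congr fun r hr => by simp only [h _ (hρ.2 r hr)]

/-- The Euler operator `ρ ∂_ρ` sends weakly convergent functions to weak null functions. -/
theorem WeakLim.euler {ρ₀ : ℝ} (h0 : 0 < ρ₀) {f f' : ℝ → ℂ} {L : ℂ} (hf : WeakLim f L)
    (hd : ∀ ρ ∈ Set.Ioo 0 ρ₀, HasDerivAt f (f' ρ) ρ) (hc : ContinuousOn f' (Set.Ioo 0 ρ₀)) :
    WeakLim (fun ρ => (ρ : ℂ) * f' ρ) 0 := by
  intro φ hφ hs
  have b1 : φ 1 = 0 := by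
    by_contra h
    have := hs (subset_tsupport φ h)
    simp at this
  have b2 : φ 2 = 0 := by
    by_contra h
    have := hs (subset_tsupport φ h)
    simp at this
  -- Since ρr f'(ρr) = r d/dr f(ρr), integration by parts replaces the test function φ by -(rφ)'.
  -- This is again admissible and has integral zero, so the limit L drops out.
  set χ : ℝ → ℝ := fun r => r * φ r with hχ
  have hχc : ContDiff ℝ ∞ χ := contDiff_id.mul hφ
  have hχs : tsupport χ ⊆ Set.Ioo 1 2 := (closure_mono (by
    intro r hr
    simp only [hχ, Function.mem_support, ne_eq, mul_eq_zero, not_or] at hr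
    exact hr.2)).trans hs
  have hχd : ContDiff ℝ ∞ (deriv χ) := by
    exact (contDiff_infty_iff_deriv.1 hχc).2
  have hχds : tsupport (deriv χ) ⊆ Set.Ioo 1 2 :=
    (closure_minimal (support_deriv_subset) isClosed_closure).trans hχs
  have hder : ∀ r, HasDerivAt (fun r => (χ r : ℂ)) ((deriv χ r : ℝ) : ℂ) r := fun r =>
    ((hχc.differentiable (by simp)) r).hasDerivAt.ofReal_comp
  have hint : Continuous (fun r => ((deriv χ r : ℝ) : ℂ)) :=
    Complex.continuous_ofReal.comp hχd.continuous
  have h := (hf _ hχd hχds).neg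
  have e : ∫ r in (1 : ℝ)..2, ((deriv χ r : ℝ) : ℂ) = 0 := by
    rw [intervalIntegral.integral_eq_sub_of_hasDerivAt (fun r _ => hder r)
      (hint.intervalIntegrable _ _)]
    simp [hχ, b1, b2]
  rw [e, zero_mul, neg_zero] at h
  rw [mul_zero]
  refine h.congr' ?_
  filter_upwards [eventually_scaled_mem h0] with ρ hρ
  have hv : ∀ r ∈ Set.uIcc (1 : ℝ) 2,
      HasDerivAt (fun r => f (ρ * r)) ((ρ : ℂ) * f' (ρ * r)) r := by
    intro r hr
    have h1 : HasDerivAt (fun r : ℝ => ρ * r) ρ r := by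
      simpa using (hasDerivAt_id r).const_mul ρ
    exact ((hd _ (hρ.2 r hr)).scomp r h1).congr_deriv (by simp)
  have hv' : IntervalIntegrable (fun r => (ρ : ℂ) * f' (ρ * r)) MeasureTheory.volume 1 2 :=
    intervalIntegrable_scaled hc (φ := fun _ => (ρ : ℂ)) continuous_const hρ.2
  have ibp := intervalIntegral.integral_mul_deriv_eq_deriv_mul (fun r _ => hder r) hv
    (hint.intervalIntegrable _ _) hv'
  simp only [hχ, b1, b2, mul_zero, Complex.ofReal_zero, zero_mul, sub_zero, zero_sub] at ibp
  rw [← ibp]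
  refine intervalIntegral.integral_congr fun r _ => ?_
  push_cast
  ring

/-- It suffices to test against one bump function inside (1, 2) with nonzero integral. -/
theorem WeakLim.unique {f : ℝ → ℂ} {L M : ℂ} (hL : WeakLim f L) (hM : WeakLim f M) : L = M := by
  let φ : ContDiffBump (3 / 2 : ℝ) := ⟨1 / 8, 1 / 4, by norm_num, by norm_num⟩
  have hs : tsupport φ ⊆ Set.Ioo 1 2 := by
    rw [φ.tsupport_eq, Real.closedBall_eq_Icc]
    intro r hr
    have h1 := hr.1
    have h2 := hr.2
    simp only [φ] at h1 h2
    constructor <;> linarith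
  have h := tendsto_nhds_unique (hL φ φ.contDiff hs) (hM φ φ.contDiff hs)
  have hpos : 0 < ∫ r in (1 : ℝ)..2, φ r := by
    refine intervalIntegral.integral_pos (by norm_num) φ.continuous.continuousOn
      (fun r _ => φ.nonneg) ⟨3 / 2, by norm_num, ?_⟩
    exact φ.pos_of_mem_ball (Metric.mem_ball_self φ.rOut_pos)
  refine mul_left_cancel₀ ?_ h
  rw [intervalIntegral.integral_ofReal]
  exact_mod_cast hpos.ne'

/-! ### The Legendre equation -/

/-- `(1 - t²) a' = p` and `p' = -l(l+1) a` on `(-1, 1)`: the Legendre equation as a system. -/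
def LegendreSystem (l : ℕ) (a p : ℝ → ℂ) : Prop :=
  ∀ t ∈ Set.Ioo (-1 : ℝ) 1, HasDerivAt a (p t / (1 - (t : ℂ) ^ 2)) t ∧
    HasDerivAt p (-((l : ℂ) * (l + 1)) * a t) t

theorem one_sub_sq_ne_zero {t : ℝ} (ht : t ∈ Set.Ioo (-1 : ℝ) 1) : (1 : ℂ) - (t : ℂ) ^ 2 ≠ 0 := by
  have : (1 : ℝ) - t ^ 2 ≠ 0 := by nlinarith [ht.1, ht.2]
  exact_mod_cast this

/-- The Legendre polynomial (up to a factor), by Rodrigues' formula. -/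
def legendrePoly (l : ℕ) : Polynomial ℝ :=
  Polynomial.derivative^[l] ((Polynomial.X ^ 2 - 1) ^ l)

-- The polynomial u = (X² - 1)^l satisfies (X² - 1)u' = 2lXu. Leibniz' rule applied to the (l +
-- 1)-st derivative of this relation gives the Legendre equation.
open Polynomial in
theorem legendrePoly_ode (l : ℕ) :
    (1 - X ^ 2) * derivative (derivative (legendrePoly l)) - 2 * X * derivative (legendrePoly l)
      + ((l : ℝ[X]) * ((l : ℝ[X]) + 1)) * legendrePoly l = 0 := by
  set u : ℝ[X] := (X ^ 2 - 1) ^ l with hu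
  have h1 : derivative u * X ^ 2 - derivative u = (2 * l : ℝ[X]) * (u * X) := by
    rcases l with _ | l
    · simp [hu]
    · simp only [hu, derivative_pow, derivative_sub, derivative_one, derivative_X,
        Nat.add_sub_cancel, map_natCast]
      push_cast
      ring
  have h2 := congrArg (fun q => derivative^[l + 1] q) h1
  simp only [iterate_derivative_sub] at h2
  have e1 : (2 * l : ℝ[X]) * (u * X) = ((2 * l : ℕ) : ℝ[X]) * (u * X) := by push_cast; ring
  have e2 : derivative u * X ^ 2 = (derivative u * X) * X := by ring
  rw [e1, iterate_derivative_natCast_mul, iterate_derivative_mul_X, e2, iterate_derivative_mul_X,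
    iterate_derivative_mul_X, Nat.add_sub_cancel, iterate_derivative_mul_X] at h2
  have d1 : derivative^[l + 1] (derivative u) = derivative (derivative (legendrePoly l)) := by
    rw [legendrePoly, ← Function.iterate_succ_apply, Function.iterate_succ_apply',
      Function.iterate_succ_apply']
  have d2 : derivative^[l] (derivative u) = derivative (legendrePoly l) := by
    rw [legendrePoly, ← Function.iterate_succ_apply, Function.iterate_succ_apply']
  have d4 : derivative^[l + 1] u = derivative (legendrePoly l) := by
    rw [legendrePoly, Function.iterate_succ_apply']
  have d3 : (l : ℝ[X]) * derivative^[l - 1] (derivative u) = (l : ℝ[X]) * legendrePoly l := by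
    rcases l with _ | l
    · simp
    · rw [legendrePoly, Nat.add_sub_cancel, ← Function.iterate_succ_apply]
  have d5 : derivative^[l] u = legendrePoly l := rfl
  rw [d1, d2, d4, d5] at h2
  simp only [nsmul_eq_mul] at h2
  rw [d3] at h2
  push_cast at h2
  linear_combination -h2

-- The point 1 is a root of (X² - 1)^l of multiplicity exactly l, so the l-th derivative there is l!
-- times a nonzero cofactor.
open Polynomial in
theorem legendrePoly_eval_one_ne_zero (l : ℕ) : (legendrePoly l).eval 1 ≠ 0 := by
  have hne : ((X : ℝ[X]) ^ 2 - 1) ^ l = (X - C 1) ^ l * (X + C 1) ^ l := by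
    rw [← mul_pow]; congr 1; simp; ring
  have hq : ((X : ℝ[X]) + C 1) ^ l ≠ 0 := pow_ne_zero _ (X_add_C_ne_zero 1)
  have hp : ((X : ℝ[X]) - C 1) ^ l ≠ 0 := pow_ne_zero _ (X_sub_C_ne_zero 1)
  have hr : rootMultiplicity 1 (((X : ℝ[X]) ^ 2 - 1) ^ l) = l := by
    rw [hne, rootMultiplicity_mul (mul_ne_zero hp hq), rootMultiplicity_X_sub_C_pow,
      rootMultiplicity_eq_zero, add_zero]
    simp only [IsRoot.def, eval_pow, eval_add, eval_X, eval_C]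
    positivity
  have h := eval_iterate_derivative_rootMultiplicity (p := ((X : ℝ[X]) ^ 2 - 1) ^ l) (t := 1)
  rw [hr] at h
  rw [legendrePoly, h, nsmul_eq_mul]
  refine mul_ne_zero (by positivity) ?_
  have h3 := eval_divByMonic_pow_rootMultiplicity_ne_zero (p := ((X : ℝ[X]) ^ 2 - 1) ^ l) 1
    (by rw [hne]; exact mul_ne_zero hp hq)
  rwa [hr] at h3

open Polynomial in
theorem iterate_derivative_comp_neg_X (p : ℝ[X]) (k : ℕ) :
    (derivative^[k] p).comp (-X) = (-1) ^ k * derivative^[k] (p.comp (-X)) := by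
  induction k with
  | zero => simp
  | succ k ih =>
    have h := congrArg derivative ih
    rw [derivative_comp] at h
    simp only [derivative_mul, derivative_neg, derivative_X] at h
    have h0 : derivative ((-1 : ℝ[X]) ^ k) = 0 := by
      rw [derivative_pow]; simp
    rw [h0] at h
    rw [Function.iterate_succ_apply', Function.iterate_succ_apply', pow_succ]
    linear_combination -h

open Polynomial in
theorem legendrePoly_comp_neg (l : ℕ) :
    (legendrePoly l).comp (-X) = (-1) ^ l * legendrePoly l := by
  rw [legendrePoly, iterate_derivative_comp_neg_X]
  simp

open Polynomial in
theorem legendrePoly_odd_eval_zero {l : ℕ} (h : Odd l) : (legendrePoly l).eval 0 = 0 := by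
  have := congrArg (eval 0) (legendrePoly_comp_neg l)
  rw [h.neg_one_pow] at this
  simp [eval_comp] at this
  linarith

open Polynomial in
theorem legendrePoly_even_eval_zero {l : ℕ} (h : Even l) :
    (derivative (legendrePoly l)).eval 0 = 0 := by
  have := congrArg (fun p => eval 0 (derivative p)) (legendrePoly_comp_neg l)
  simp only [h.neg_one_pow, derivative_comp, one_mul] at this
  simp [eval_comp] at this
  linarith

theorem legendreSystem_poly (l : ℕ) :
    LegendreSystem l (fun t => (((legendrePoly l).eval t : ℝ) : ℂ))
      (fun t => (((1 - t ^ 2) * (Polynomial.derivative (legendrePoly l)).eval t : ℝ) : ℂ)) := by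
  intro t ht
  constructor
  · have h := ((legendrePoly l).hasDerivAt t).ofReal_comp
    refine h.congr_deriv ?_
    have := one_sub_sq_ne_zero ht
    push_cast
    field_simp
  · have h1 : HasDerivAt (fun t : ℝ => 1 - t ^ 2) (-(2 * t)) t := by
      simpa using (hasDerivAt_pow 2 t).const_sub 1
    have h := (h1.mul ((Polynomial.derivative (legendrePoly l)).hasDerivAt t)).ofReal_comp
    refine h.congr_deriv ?_
    have h2 := congrArg (Polynomial.eval t) (legendrePoly_ode l)
    simp only [Polynomial.eval_add, Polynomial.eval_sub, Polynomial.eval_mul, Polynomial.eval_pow,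
      Polynomial.eval_X, Polynomial.eval_one, Polynomial.eval_ofNat, Polynomial.eval_natCast,
      Polynomial.eval_zero] at h2
    have h3 : -(2 * t) * Polynomial.eval t (Polynomial.derivative (legendrePoly l)) +
        (1 - t ^ 2) * Polynomial.eval t (Polynomial.derivative (Polynomial.derivative (legendrePoly l)))
        = -((l : ℝ) * (l + 1)) * (legendrePoly l).eval t := by linarith
    rw [h3]
    push_cast
    ring

theorem LegendreSystem.linear_comb {l : ℕ} {a p b q : ℝ → ℂ} (h : LegendreSystem l a p)
    (h' : LegendreSystem l b q) (c : ℂ) :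
    LegendreSystem l (fun t => a t - c * b t) (fun t => p t - c * q t) := by
  intro t ht
  refine ⟨((h t ht).1.fun_sub ((h' t ht).1.const_mul c)).congr_deriv (by ring),
    ((h t ht).2.fun_sub ((h' t ht).2.const_mul c)).congr_deriv (by ring)⟩

theorem LegendreSystem.reflect {l : ℕ} {a p : ℝ → ℂ} (h : LegendreSystem l a p) :
    LegendreSystem l (fun t => a (-t)) (fun t => -p (-t)) := by
  intro t ht
  have ht' : -t ∈ Set.Ioo (-1 : ℝ) 1 := ⟨by linarith [ht.2], by linarith [ht.1]⟩
  have hn : HasDerivAt (fun t : ℝ => -t) (-1) t := hasDerivAt_neg t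
  refine ⟨((h _ ht').1.scomp t hn).congr_deriv ?_, ((h _ ht').2.scomp t hn).neg.congr_deriv ?_⟩
  · simp [neg_div]
  · simp

/-- The quantity conserved by two solutions of the Legendre equation. -/
theorem LegendreSystem.wronskian {l : ℕ} {a p b q : ℝ → ℂ} (h : LegendreSystem l a p)
    (h' : LegendreSystem l b q) {t : ℝ} (ht : t ∈ Set.Ioo (-1 : ℝ) 1) :
    b t * p t - a t * q t = b 0 * p 0 - a 0 * q 0 := by
  have hd : ∀ t ∈ Set.Ioo (-1 : ℝ) 1, HasDerivAt (fun t => b t * p t - a t * q t) 0 t := by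
    intro t ht
    refine (((h' t ht).1.fun_mul (h t ht).2).fun_sub
      ((h t ht).1.fun_mul (h' t ht).2)).congr_deriv ?_
    have := one_sub_sq_ne_zero ht
    field_simp
    ring
  exact isOpen_Ioo.is_const_of_deriv_eq_zero (convex_Ioo _ _).isPreconnected
    (fun x hx => (hd x hx).differentiableAt.differentiableWithinAt)
    (fun x hx => (hd x hx).deriv) ht (by norm_num)

/-- Uniqueness for a linear system, applied on a compactly contained interval (-r, r) because the
coefficient 1/(1 - t²) is unbounded on (-1, 1). -/
theorem LegendreSystem.eq_zero {l : ℕ} {a p : ℝ → ℂ} (h : LegendreSystem l a p) (ha : a 0 = 0)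
    (hp : p 0 = 0) {t : ℝ} (ht : t ∈ Set.Ioo (-1 : ℝ) 1) : a t = 0 := by
  obtain ⟨r, hr1, hr2⟩ : ∃ r, |t| < r ∧ r < 1 := exists_between (abs_lt.2 ht)
  have hr0 : 0 < r := (abs_nonneg t).trans_lt hr1
  let v : ℝ → ℂ × ℂ → ℂ × ℂ := fun t x =>
    (x.2 / (1 - (t : ℂ) ^ 2), -((l : ℂ) * (l + 1)) * x.1)
  -- The Lipschitz constant on (-r, r): the sum of bounds for the two off-diagonal coefficients of
  -- the system.
  set K : ℝ := 1 / (1 - r ^ 2) + l * (l + 1) with hK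
  have hr3 : 0 < 1 - r ^ 2 := by nlinarith
  have hK0 : 0 ≤ K := by positivity
  have hsub : ∀ s ∈ Set.Ioo (-r) r, s ∈ Set.Ioo (-1 : ℝ) 1 := fun s hs =>
    ⟨by linarith [hs.1], by linarith [hs.2]⟩
  have hv : ∀ s ∈ Set.Ioo (-r) r, LipschitzOnWith ⟨K, hK0⟩ (v s) Set.univ := by
    intro s hs
    refine LipschitzOnWith.of_dist_le_mul fun x _ y _ => ?_
    rw [dist_eq_norm, dist_eq_norm]
    change _ ≤ K * _
    have hs2 : 1 - r ^ 2 ≤ 1 - s ^ 2 := by nlinarith [hs.1, hs.2]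
    have e1 : ‖(x.2 / (1 - (s : ℂ) ^ 2)) - (y.2 / (1 - (s : ℂ) ^ 2))‖ ≤ 1 / (1 - r ^ 2) * ‖x - y‖ := by
      rw [← sub_div, norm_div]
      have : ‖(1 : ℂ) - (s : ℂ) ^ 2‖ = 1 - s ^ 2 := by
        rw [show (1 : ℂ) - (s : ℂ) ^ 2 = ((1 - s ^ 2 : ℝ) : ℂ) by push_cast; ring,
          Complex.norm_real, Real.norm_eq_abs, abs_of_pos (by linarith)]
      rw [this, div_eq_mul_one_div, mul_comm]
      exact mul_le_mul (one_div_le_one_div_of_le hr3 hs2) (norm_snd_le (x - y)) (norm_nonneg _)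
        (by positivity)
    have e2 : ‖-((l : ℂ) * (l + 1)) * x.1 - -((l : ℂ) * (l + 1)) * y.1‖
        ≤ (l * (l + 1)) * ‖x - y‖ := by
      rw [← mul_sub, norm_mul, norm_neg]
      have : ‖(l : ℂ) * (l + 1)‖ = (l : ℝ) * (l + 1) := by
        rw [show (l : ℂ) * (l + 1) = (((l : ℝ) * (l + 1) : ℝ) : ℂ) by push_cast; ring,
          Complex.norm_real, Real.norm_eq_abs, abs_of_nonneg (by positivity)]
      rw [this]
      exact mul_le_mul_of_nonneg_left (norm_fst_le (x - y)) (by positivity)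
    have hn := norm_nonneg (x - y)
    rw [Prod.norm_def]
    refine max_le (e1.trans ?_) (e2.trans ?_)
    · refine mul_le_mul_of_nonneg_right ?_ hn
      rw [hK]
      linarith [show (0 : ℝ) ≤ l * (l + 1) by positivity]
    · refine mul_le_mul_of_nonneg_right ?_ hn
      rw [hK]
      linarith [show (0 : ℝ) ≤ 1 / (1 - r ^ 2) by positivity]
  have huniq := ODE_solution_unique_of_mem_Ioo (v := v) (s := fun _ => Set.univ)
    (f := fun t => (a t, p t)) (g := fun _ => 0) (t₀ := 0) hv ⟨by linarith, hr0⟩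
    (fun s hs => ⟨((h s (hsub s hs)).1.prodMk (h s (hsub s hs)).2), Set.mem_univ _⟩)
    (fun s _ => ⟨by
      have : v s 0 = 0 := by simp [v]
      rw [this]
      exact hasDerivAt_const s 0, Set.mem_univ _⟩)
    (by simp [ha, hp])
  have := huniq (abs_lt.1 hr1)
  exact congrArg Prod.fst this

/-- Vanishing data at 0 would make the polynomial vanish on (-1, 1), and by continuity at 1. -/
theorem legendrePoly_initial_ne_zero (l : ℕ) :
    (legendrePoly l).eval 0 ≠ 0 ∨ (Polynomial.derivative (legendrePoly l)).eval 0 ≠ 0 := by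
  by_contra! hcon
  have h := legendreSystem_poly l
  have hz : ∀ t ∈ Set.Ioo (-1 : ℝ) 1, (legendrePoly l).eval t = 0 := fun t ht => by
    have := h.eq_zero (by simp [hcon.1]) (by simp [hcon.2]) ht
    exact_mod_cast this
  have hc : Filter.Tendsto (fun t => (legendrePoly l).eval t) (nhdsWithin 1 (Set.Iio 1))
      (nhds ((legendrePoly l).eval 1)) :=
    ((legendrePoly l).continuous.tendsto 1).mono_left nhdsWithin_le_nhds
  refine legendrePoly_eval_one_ne_zero l (tendsto_nhds_unique hc ?_)
  refine tendsto_const_nhds.congr' ?_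
  filter_upwards [Ioo_mem_nhdsLT (show (0 : ℝ) < 1 by norm_num)] with t ht
  exact (hz t ⟨by linarith [ht.1], ht.2⟩).symm

/-- Reduction of order: with P the Legendre polynomial and w the conserved Wronskian, (a/P)' = w/((1
- t²)P²). As P(1) ≠ 0, this has a nonintegrable singularity at 1, so a/P grows at least
logarithmically and P stays away from zero. -/
theorem LegendreSystem.tendsto_atTop {l : ℕ} {a p : ℝ → ℂ} (h : LegendreSystem l a p)
    (hw : (((legendrePoly l).eval 0 : ℝ) : ℂ) * p 0
      - a 0 * ((Polynomial.derivative (legendrePoly l)).eval 0 : ℝ) ≠ 0) :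
    Filter.Tendsto (fun t => ‖a t‖) (nhdsWithin 1 (Set.Iio 1)) Filter.atTop := by
  set P := legendrePoly l with hP
  set w : ℂ := ((P.eval 0 : ℝ) : ℂ) * p 0 - a 0 * ((Polynomial.derivative P).eval 0 : ℝ) with hwdef
  have hP1 : P.eval 1 ≠ 0 := legendrePoly_eval_one_ne_zero l
  have hwr : ∀ t ∈ Set.Ioo (-1 : ℝ) 1, ((P.eval t : ℝ) : ℂ) * p t -
      a t * (((1 - t ^ 2) * (Polynomial.derivative P).eval t : ℝ) : ℂ) = w := by
    intro t ht
    have := h.wronskian (legendreSystem_poly l) ht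
    simpa using this
  set e := |P.eval 1| with he
  have he0 : 0 < e := abs_pos.2 hP1
  have hev : ∀ᶠ t in nhds (1 : ℝ), e / 2 < |P.eval t| ∧ |P.eval t| < 2 * e := by
    have hc : Filter.Tendsto (fun t => |P.eval t|) (nhds 1) (nhds e) :=
      (P.continuous.abs).tendsto 1
    exact (hc.eventually_const_lt (by linarith)).and (hc.eventually_lt_const (by linarith))
  obtain ⟨δ, hδ, hball⟩ := Metric.eventually_nhds_iff_ball.1 hev
  set t₀ : ℝ := max (1 - δ / 2) 0 with ht₀
  have ht₀1 : t₀ < 1 := max_lt (by linarith) one_pos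
  have ht₀0 : 0 ≤ t₀ := le_max_right _ _
  have hb : ∀ t ∈ Set.Ico t₀ 1, e / 2 < |P.eval t| ∧ |P.eval t| < 2 * e := by
    intro t ht
    refine hball t ?_
    rw [Metric.mem_ball, Real.dist_eq, abs_lt]
    have := (le_max_left (1 - δ / 2) 0).trans ht.1
    exact ⟨by linarith, by linarith [ht.2]⟩
  have hin : ∀ t ∈ Set.Ico t₀ 1, t ∈ Set.Ioo (-1 : ℝ) 1 := fun t ht =>
    ⟨by linarith [ht.1], ht.2⟩
  have hne : ∀ t ∈ Set.Ico t₀ 1, ((P.eval t : ℝ) : ℂ) ≠ 0 := fun t ht h0 => by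
    have h1 := (hb t ht).1
    have h2 : P.eval t = 0 := by exact_mod_cast h0
    rw [h2, abs_zero] at h1
    linarith
  -- The bounds 1 + t ≤ 2 and |P| ≤ 2e give 1/((1 - t²)P²) ≥ c/(1 - t).
  set c : ℝ := 1 / (2 * (2 * e) ^ 2) with hc
  have hc0 : 0 < c := by positivity
  -- Dividing by w as well makes the derivative of g real and positive, so the real part of g alone
  -- shows the growth.
  set g : ℝ → ℂ := fun t => a t / P.eval t / w with hg
  have hgd : ∀ t ∈ Set.Ico t₀ 1,
      HasDerivAt g (((1 / ((1 - t ^ 2) * (P.eval t) ^ 2) : ℝ) : ℂ)) t := by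
    intro t ht
    have h1 := (((h t (hin t ht)).1.fun_div ((P.hasDerivAt t).ofReal_comp) (hne t ht)).div_const w)
    refine h1.congr_deriv ?_
    have n1 := one_sub_sq_ne_zero (hin t ht)
    have n2 := hne t ht
    have hww := hwr t (hin t ht)
    push_cast at hww ⊢
    rw [div_eq_iff hw]
    rw [← hww]
    field_simp
  have hre : ∀ t ∈ Set.Ico t₀ 1, HasDerivAt (fun t => (g t).re)
      (1 / ((1 - t ^ 2) * (P.eval t) ^ 2)) t := by
    intro t ht
    have := Complex.reCLM.hasFDerivAt.comp_hasDerivAt t (hgd t ht)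
    exact this
  have hlog : ∀ t ∈ Set.Ico t₀ 1, HasDerivAt (fun t => (g t).re + c * Real.log (1 - t))
      (1 / ((1 - t ^ 2) * (P.eval t) ^ 2) - c / (1 - t)) t := by
    intro t ht
    have h1 : HasDerivAt (fun t : ℝ => 1 - t) (-1) t := by
      simpa using (hasDerivAt_id t).const_sub 1
    refine ((hre t ht).fun_add ((h1.log (by linarith [ht.2])).const_mul c)).congr_deriv ?_
    ring
  -- Monotonicity bounds Re g from below by a constant minus c log(1 - t), which tends to infinity.
  have hmono : MonotoneOn (fun t => (g t).re + c * Real.log (1 - t)) (Set.Ico t₀ 1) := by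
    refine monotoneOn_of_deriv_nonneg (convex_Ico _ _)
      (fun t ht => (hlog t ht).continuousAt.continuousWithinAt)
      (fun t ht => (hlog t (interior_subset ht)).differentiableAt.differentiableWithinAt) ?_
    intro t ht
    have ht' := interior_subset ht
    rw [(hlog t ht').deriv, sub_nonneg, hc, div_div]
    have b := hb t ht'
    have b1 : 0 < 1 - t := by linarith [ht'.2]
    have b2 : 0 < 1 + t := by linarith [ht'.1]
    have b3 : 0 < (P.eval t) ^ 2 := by
      rw [← sq_abs]; have : 0 < |P.eval t| := by linarith [b.1]
      positivity
    have b4 : (P.eval t) ^ 2 ≤ (2 * e) ^ 2 := by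
      rw [← sq_abs]; exact pow_le_pow_left₀ (abs_nonneg _) b.2.le 2
    have b5 : 1 - t ^ 2 = (1 - t) * (1 + t) := by ring
    rw [b5]
    refine one_div_le_one_div_of_le (by positivity) ?_
    have b6 : (1 + t) * (P.eval t) ^ 2 ≤ 2 * (2 * e) ^ 2 :=
      mul_le_mul (by linarith [ht'.2]) b4 b3.le (by norm_num)
    nlinarith
  have hgtop : Filter.Tendsto (fun t => (g t).re) (nhdsWithin 1 (Set.Iio 1)) Filter.atTop := by
    have hl : Filter.Tendsto (fun t : ℝ => Real.log (1 - t)) (nhdsWithin 1 (Set.Iio 1))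
        Filter.atBot := by
      refine Real.tendsto_log_nhdsGT_zero.comp ?_
      refine tendsto_nhdsWithin_iff.2 ⟨?_, ?_⟩
      · have : Filter.Tendsto (fun t : ℝ => 1 - t) (nhds 1) (nhds (1 - 1)) :=
          (continuous_const.sub continuous_id).tendsto 1
        rw [sub_self] at this
        exact this.mono_left nhdsWithin_le_nhds
      · filter_upwards [self_mem_nhdsWithin] with t ht
        exact sub_pos.2 (Set.mem_Iio.1 ht)
    have hl2 : Filter.Tendsto (fun t : ℝ => ((g t₀).re + c * Real.log (1 - t₀)) +
        (-c) * Real.log (1 - t)) (nhdsWithin 1 (Set.Iio 1)) Filter.atTop :=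
      Filter.tendsto_atTop_add_const_left _ _ (hl.const_mul_atBot_of_neg (by linarith))
    refine Filter.tendsto_atTop_mono' _ ?_ hl2
    filter_upwards [Ioo_mem_nhdsLT ht₀1] with t ht
    have := hmono (Set.left_mem_Ico.2 ht₀1) ⟨ht.1.le, ht.2⟩ ht.1.le
    simp only at this
    linarith
  have hk : 0 < e / 2 * ‖w‖ := mul_pos (by linarith) (norm_pos_iff.2 hw)
  refine Filter.tendsto_atTop_mono' _ ?_ (hgtop.const_mul_atTop hk)
  filter_upwards [Ioo_mem_nhdsLT ht₀1] with t ht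
  have ht' : t ∈ Set.Ico t₀ 1 := ⟨ht.1.le, ht.2⟩
  have ea : a t = ((P.eval t : ℝ) : ℂ) * w * g t := by
    have := hne t ht'
    simp only [hg]
    field_simp
  rw [ea, norm_mul, norm_mul, Complex.norm_real, Real.norm_eq_abs]
  calc e / 2 * ‖w‖ * (g t).re ≤ e / 2 * ‖w‖ * ‖g t‖ :=
        mul_le_mul_of_nonneg_left (Complex.re_le_norm _) hk.le
    _ ≤ |P.eval t| * ‖w‖ * ‖g t‖ := by
        gcongr
        exact (hb t ht').1.le

theorem LegendreSystem.diverges {l : ℕ} {a p : ℝ → ℂ} (h : LegendreSystem l a p)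
    (hw : (((legendrePoly l).eval 0 : ℝ) : ℂ) * p 0
      - a 0 * ((Polynomial.derivative (legendrePoly l)).eval 0 : ℝ) ≠ 0) :
    DivergesAtCriticalSets a := by
  refine ⟨h.tendsto_atTop hw, ?_⟩
  have h1 : Filter.Tendsto (fun t => ‖a (-t)‖) (nhdsWithin 1 (Set.Iio 1)) Filter.atTop := by
    refine h.reflect.tendsto_atTop ?_
    -- Reflection changes the sign of p(0) only. By parity one of P(0), P'(0) vanishes, so the
    -- Wronskian changes at most by a sign and remains nonzero.
    simp only [neg_zero]
    rcases Nat.even_or_odd l with he | ho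
    · rw [legendrePoly_even_eval_zero he] at hw ⊢
      simpa using hw
    · rw [legendrePoly_odd_eval_zero ho] at hw ⊢
      simpa using hw
  have h2 : Filter.Tendsto (fun t : ℝ => -t) (nhdsWithin (-1) (Set.Ioi (-1)))
      (nhdsWithin 1 (Set.Iio 1)) := by
    refine tendsto_nhdsWithin_iff.2 ⟨?_, ?_⟩
    · have : Filter.Tendsto (fun t : ℝ => -t) (nhds (-1)) (nhds (- -1)) :=
        continuous_neg.tendsto (-1)
      rw [neg_neg] at this
      exact this.mono_left nhdsWithin_le_nhds
    · filter_upwards [self_mem_nhdsWithin] with t ht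
      exact neg_lt.1 (Set.mem_Ioi.1 ht)
  simpa [Function.comp_def] using h1.comp h2

theorem RegularAtCriticalSets.not_diverges {a : ℝ → ℂ} (h : RegularAtCriticalSets a) :
    ¬ DivergesAtCriticalSets a := by
  rintro ⟨hd, -⟩
  obtain ⟨f, hf, he⟩ := h
  have hc : Filter.Tendsto (fun t => ‖f t‖) (nhdsWithin 1 (Set.Iio 1)) (nhds ‖f 1‖) :=
    (hf.continuous.norm.tendsto 1).mono_left nhdsWithin_le_nhds
  refine not_tendsto_nhds_of_tendsto_atTop hd ‖f 1‖ (hc.congr' ?_)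
  filter_upwards [Ioo_mem_nhdsLT (show (-1 : ℝ) < 1 by norm_num)] with t ht
  rw [he t ht]

/-- Zero Wronskian means that the data at 0 are proportional to those of the Legendre polynomial;
uniqueness makes the solution the same multiple of it. -/
theorem LegendreSystem.regular {l : ℕ} {a p : ℝ → ℂ} (h : LegendreSystem l a p)
    (hw : (((legendrePoly l).eval 0 : ℝ) : ℂ) * p 0
      - a 0 * ((Polynomial.derivative (legendrePoly l)).eval 0 : ℝ) = 0) :
    RegularAtCriticalSets a := by
  obtain ⟨c, hca, hcp⟩ : ∃ c : ℂ, a 0 = c * (((legendrePoly l).eval 0 : ℝ) : ℂ) ∧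
      p 0 = c * ((Polynomial.derivative (legendrePoly l)).eval 0 : ℝ) := by
    rcases legendrePoly_initial_ne_zero l with h0 | h0
    · have h0' : (((legendrePoly l).eval 0 : ℝ) : ℂ) ≠ 0 := by exact_mod_cast h0
      refine ⟨a 0 / (legendrePoly l).eval 0, by field_simp, ?_⟩
      field_simp
      linear_combination hw
    · have h0' : (((Polynomial.derivative (legendrePoly l)).eval 0 : ℝ) : ℂ) ≠ 0 := by
        exact_mod_cast h0
      refine ⟨p 0 / ((Polynomial.derivative (legendrePoly l)).eval 0 : ℝ), ?_, by field_simp⟩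
      field_simp
      linear_combination -hw
  refine ⟨fun t => c * (((legendrePoly l).eval t : ℝ) : ℂ), ?_, fun t ht => ?_⟩
  · exact contDiff_const.mul (Complex.ofRealCLM.contDiff.comp (by
      simpa [Polynomial.coe_aeval_eq_eval] using (legendrePoly l).contDiff_aeval (𝕜 := ℝ) ∞))
  · have := (h.linear_comb (legendreSystem_poly l) c).eq_zero (by simp [hca]) (by simp [hcp]) ht
    exact sub_eq_zero.1 this

/-- A solution of the Legendre equation is regular at both endpoints or diverges at both, according
to its initial data. -/
theorem LegendreSystem.regular_iff {l : ℕ} {a p : ℝ → ℂ} (h : LegendreSystem l a p) :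
    (RegularAtCriticalSets a ↔ (Even l → p 0 = 0) ∧ (Odd l → a 0 = 0)) ∧
      (¬ RegularAtCriticalSets a → DivergesAtCriticalSets a) := by
  have key : RegularAtCriticalSets a ↔ (((legendrePoly l).eval 0 : ℝ) : ℂ) * p 0
      - a 0 * ((Polynomial.derivative (legendrePoly l)).eval 0 : ℝ) = 0 :=
    ⟨fun hr => by_contra fun hw => hr.not_diverges (h.diverges hw), h.regular⟩
  refine ⟨key.trans ?_, fun hr => h.diverges fun hw => hr (h.regular hw)⟩
  rcases Nat.even_or_odd l with he | ho
  · have h1 := legendrePoly_even_eval_zero he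
    have h2 : (legendrePoly l).eval 0 ≠ 0 := (legendrePoly_initial_ne_zero l).resolve_right
      (by simp [h1])
    simp [h1, h2, he, Nat.not_odd_iff_even.2 he]
  · have h1 := legendrePoly_odd_eval_zero ho
    have h2 : (Polynomial.derivative (legendrePoly l)).eval 0 ≠ 0 :=
      (legendrePoly_initial_ne_zero l).resolve_left (by simp [h1])
    simp [h1, h2, ho, Nat.not_even_iff_odd.2 ho]

/-! ### Smoothness and weights of derivatives of fields on the slice -/

theorem fderiv_param_eq {P : Type*} [NormedAddCommGroup P] [NormedSpace ℝ P]
    {f : P → ℂ × ℂ → ℂ} {p : P} {z : ℂ × ℂ}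
    (hf : DifferentiableAt ℝ (fun q : P × (ℂ × ℂ) => f q.1 q.2) (p, z)) (v : ℂ × ℂ) :
    fderiv ℝ (f p) z v = fderiv ℝ (fun q : P × (ℂ × ℂ) => f q.1 q.2) (p, z) (0, v) := by
  have h1 : HasFDerivAt (fun z : ℂ × ℂ => (p, z)) (ContinuousLinearMap.inr ℝ P (ℂ × ℂ)) z :=
    hasFDerivAt_prodMk_right p z
  have h2 : HasFDerivAt (f p) _ z :=
    hf.hasFDerivAt.comp (f := fun z : ℂ × ℂ => (p, z)) z h1
  rw [h2.fderiv]
  simp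

/-- The derivative within a slice is the joint derivative along (0, v), so joint regularity drops by
one order. -/
theorem contDiffOn_frameDeriv {P : Type*} [NormedAddCommGroup P] [NormedSpace ℝ P] {κ : ℂ}
    {k : ℕ} {U : Set P} (hU : IsOpen U) {f : P → ℂ × ℂ → ℂ}
    (hf : ContDiffOn ℝ (k + 1 : ℕ) (fun q : P × (ℂ × ℂ) => f q.1 q.2) (U ×ˢ {0}ᶜ)) :
    ContDiffOn ℝ k (fun q : P × (ℂ × ℂ) => frameDeriv κ (f q.1) q.2) (U ×ˢ {0}ᶜ) := by
  have hopen : IsOpen (U ×ˢ ({0}ᶜ : Set (ℂ × ℂ))) := hU.prod isOpen_compl_singleton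
  have h1 := hf.fderiv_of_isOpen hopen (m := k) (by norm_cast)
  have hw : ContDiff ℝ k (fun q : P × (ℂ × ℂ) => frameDir q.2) :=
    (contDiff_frameDir.of_le (by exact_mod_cast le_top)).comp contDiff_snd
  have h2 : ContDiffOn ℝ k (fun q : P × (ℂ × ℂ) => ((0 : P), frameDir q.2)) (U ×ˢ {0}ᶜ) :=
    (contDiff_const.prodMk hw).contDiffOn
  have h3 : ContDiffOn ℝ k (fun q : P × (ℂ × ℂ) => ((0 : P), Complex.I • frameDir q.2))
      (U ×ˢ {0}ᶜ) := (contDiff_const.prodMk (hw.const_smul Complex.I)).contDiffOn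
  refine ((contDiffOn_const (c := (1 / 2 : ℂ))).mul ((h1.clm_apply h2).add
    ((contDiffOn_const (c := κ)).mul (h1.clm_apply h3)))).congr fun q hq => ?_
  have hd := (hf.differentiableOn (by norm_cast)).differentiableAt (hopen.mem_nhds hq)
  rw [frameDeriv, fderiv_param_eq hd, fderiv_param_eq hd]

theorem hasDerivAt_param {f : ℝ → ℂ × ℂ → ℂ} {U : Set ℝ} (hU : IsOpen U)
    (hf : ContDiffOn ℝ 1 (fun q : ℝ × (ℂ × ℂ) => f q.1 q.2) (U ×ˢ {0}ᶜ)) {x : ℝ} (hx : x ∈ U)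
    {z : ℂ × ℂ} (hz : z ≠ 0) :
    HasDerivAt (fun t => f t z)
      (fderiv ℝ (fun q : ℝ × (ℂ × ℂ) => f q.1 q.2) (x, z) (1, 0)) x := by
  have hopen : IsOpen (U ×ˢ ({0}ᶜ : Set (ℂ × ℂ))) := hU.prod isOpen_compl_singleton
  have hm : (x, z) ∈ U ×ˢ ({0}ᶜ : Set (ℂ × ℂ)) := ⟨hx, hz⟩
  have hd := (hf.differentiableOn (by norm_num)).differentiableAt (hopen.mem_nhds hm)
  exact hd.hasFDerivAt.comp_hasDerivAt (f := fun t : ℝ => (t, z)) x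
    ((hasDerivAt_id x).prodMk (hasDerivAt_const x z))

theorem contDiffOn_deriv_param {k : ℕ} {U : Set ℝ} (hU : IsOpen U) {f : ℝ → ℂ × ℂ → ℂ}
    (hf : ContDiffOn ℝ (k + 1 : ℕ) (fun q : ℝ × (ℂ × ℂ) => f q.1 q.2) (U ×ˢ {0}ᶜ)) :
    ContDiffOn ℝ k (fun q : ℝ × (ℂ × ℂ) => deriv (fun t => f t q.2) q.1) (U ×ˢ {0}ᶜ) := by
  have hopen : IsOpen (U ×ˢ ({0}ᶜ : Set (ℂ × ℂ))) := hU.prod isOpen_compl_singleton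
  have h1 := hf.fderiv_of_isOpen hopen (m := k) (by norm_cast)
  refine (h1.clm_apply contDiffOn_const (g := fun _ => ((1 : ℝ), (0 : ℂ × ℂ)))).congr
    fun q hq => ?_
  exact (hasDerivAt_param hU (hf.of_le (by norm_cast; omega)) hq.1 hq.2).deriv

/-- `f` is of class `C^k` for `0 < ρ < ρ₀` and of spin weight `s`. -/
structure SliceRegular (ρ₀ : ℝ) (k : ℕ) (s : ℤ) (f : SliceField) : Prop where
  contDiffOn : ContDiffOn ℝ k (fun q : ℝ × (ℂ × ℂ) => f q.1 q.2) (Set.Ioo 0 ρ₀ ×ˢ {0}ᶜ)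
  phaseWeight : ∀ ρ ∈ Set.Ioo 0 ρ₀, PhaseWeight s (f ρ)

namespace SliceRegular

variable {ρ₀ : ℝ} {k : ℕ} {s : ℤ} {f g : SliceField}

theorem add (hf : SliceRegular ρ₀ k s f) (hg : SliceRegular ρ₀ k s g) :
    SliceRegular ρ₀ k s (fun ρ z => f ρ z + g ρ z) :=
  ⟨hf.contDiffOn.add hg.contDiffOn, fun ρ hρ c z hc hz => by
    simp only [hf.phaseWeight ρ hρ c z hc hz, hg.phaseWeight ρ hρ c z hc hz]; ring⟩

theorem const_mul (hf : SliceRegular ρ₀ k s f) (a : ℂ) :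
    SliceRegular ρ₀ k s (fun ρ z => a * f ρ z) :=
  ⟨contDiffOn_const.mul hf.contDiffOn, fun ρ hρ c z hc hz => by
    simp only [hf.phaseWeight ρ hρ c z hc hz]; ring⟩

theorem slice (hf : SliceRegular ρ₀ k s f) {ρ : ℝ} (hρ : ρ ∈ Set.Ioo 0 ρ₀) :
    ContDiffOn ℝ k (f ρ) {0}ᶜ :=
  hf.contDiffOn.comp (f := fun z : ℂ × ℂ => (ρ, z))
    (contDiff_const.prodMk contDiff_id).contDiffOn fun _ hz => ⟨hρ, hz⟩

theorem differentiableAt (hf : SliceRegular ρ₀ (k + 1) s f) {ρ : ℝ} (hρ : ρ ∈ Set.Ioo 0 ρ₀)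
    {z : ℂ × ℂ} (hz : z ≠ 0) : DifferentiableAt ℝ (f ρ) z :=
  ((hf.slice hρ).differentiableOn (by norm_cast)).differentiableAt
    (isOpen_compl_singleton.mem_nhds hz)

theorem eth (hf : SliceRegular ρ₀ (k + 1) s f) :
    SliceRegular ρ₀ k (s + 1) (fun ρ => eth (f ρ)) :=
  ⟨contDiffOn_frameDeriv isOpen_Ioo hf.contDiffOn, fun ρ hρ =>
    (hf.phaseWeight ρ hρ).eth fun _ hz => hf.differentiableAt hρ hz⟩

theorem ethBar (hf : SliceRegular ρ₀ (k + 1) s f) :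
    SliceRegular ρ₀ k (s - 1) (fun ρ => ethBar (f ρ)) :=
  ⟨by
    rw [ethBar_eq_frameDeriv]
    exact contDiffOn_frameDeriv isOpen_Ioo hf.contDiffOn, fun ρ hρ =>
    (hf.phaseWeight ρ hρ).ethBar fun _ hz => hf.differentiableAt hρ hz⟩

theorem hasDerivAt (hf : SliceRegular ρ₀ (k + 1) s f) {ρ : ℝ} (hρ : ρ ∈ Set.Ioo 0 ρ₀)
    {z : ℂ × ℂ} (hz : z ≠ 0) :
    HasDerivAt (fun r => f r z) (deriv (fun r => f r z) ρ) ρ :=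
  (hasDerivAt_param isOpen_Ioo (hf.contDiffOn.of_le (by norm_cast; omega)) hρ
    hz).differentiableAt.hasDerivAt

theorem deriv (hf : SliceRegular ρ₀ (k + 1) s f) :
    SliceRegular ρ₀ k s (fun ρ z => deriv (fun r => f r z) ρ) := by
  refine ⟨contDiffOn_deriv_param isOpen_Ioo hf.contDiffOn, fun ρ hρ c z hc hz => ?_⟩
  have h := (hf.hasDerivAt hρ hz).const_mul (c ^ (2 * s))
  refine (h.congr_of_eventuallyEq ?_).deriv
  filter_upwards [isOpen_Ioo.mem_nhds hρ] with r hr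
  exact hf.phaseWeight r hr c z hc hz

theorem euler (hf : SliceRegular ρ₀ (k + 1) s f) :
    SliceRegular ρ₀ k s (fun ρ z => (ρ : ℂ) * _root_.deriv (fun r => f r z) ρ) :=
  ⟨((Complex.ofRealCLM.contDiff.comp contDiff_fst).contDiffOn).mul hf.deriv.contDiffOn,
    fun ρ hρ c z hc hz => by
      simp only [hf.deriv.phaseWeight ρ hρ c z hc hz]; ring⟩

theorem continuousOn_modeCoeff (hf : SliceRegular ρ₀ k s f) (l : ℕ) (m t : ℤ) :
    ContinuousOn (fun ρ => modeCoeff l m t (f ρ)) (Set.Ioo 0 ρ₀) :=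
  _root_.continuousOn_modeCoeff isOpen_Ioo hf.contDiffOn.continuousOn

end SliceRegular

/-! ### Calculus of weak limits of modes under the operators D_{AB}. -/

/-- `f` is regular of spin weight `s` and its `(l, m)`-mode has weak limit `L` as `ρ → 0`. -/
structure ModeLim (ρ₀ : ℝ) (l : ℕ) (m : ℤ) (k : ℕ) (s : ℤ) (f : SliceField) (L : ℂ) : Prop where
  regular : SliceRegular ρ₀ k s f
  weakLim : WeakLim (fun ρ => modeCoeff l m s (f ρ)) L

/-- The action of `D_{AB}` on limits of modes of spin weight `s`. -/
def limitD (l : ℕ) (A B : Fin 2) (s : ℤ) : ℂ :=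
  if A = 0 ∧ B = 0 then (ethFactor l s : ℂ) * (Real.sqrt 2 : ℂ)⁻¹
  else if A = 1 ∧ B = 1 then (ethFactor l (s - 1) : ℂ) * (Real.sqrt 2 : ℂ)⁻¹
  else 0

namespace ModeLim

variable {ρ₀ : ℝ} {l : ℕ} {m : ℤ} {k : ℕ} {s : ℤ} {f g : SliceField} {L M : ℂ}

theorem add (h0 : 0 < ρ₀) (hf : ModeLim ρ₀ l m k s f L) (hg : ModeLim ρ₀ l m k s g M) :
    ModeLim ρ₀ l m k s (fun ρ z => f ρ z + g ρ z) (L + M) := by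
  refine ⟨hf.regular.add hg.regular, WeakLim.congr h0 (fun ρ hρ => ?_)
    (hf.weakLim.add h0 (hf.regular.continuousOn_modeCoeff l m s)
      (hg.regular.continuousOn_modeCoeff l m s) hg.weakLim)⟩
  rw [modeCoeff_add (hf.regular.slice hρ).continuousOn (hg.regular.slice hρ).continuousOn]

theorem const_mul (hf : ModeLim ρ₀ l m k s f L) (a : ℂ) :
    ModeLim ρ₀ l m k s (fun ρ z => a * f ρ z) (a * L) := by
  refine ⟨hf.regular.const_mul a, ?_⟩
  simp only [modeCoeff_const_mul]
  exact hf.weakLim.const_mul a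

theorem cast {s' : ℤ} {L' : ℂ} (hf : ModeLim ρ₀ l m k s f L) (hs : s = s') (hL : L = L') :
    ModeLim ρ₀ l m k s' f L' := by
  subst hs hL
  exact hf

theorem spatialD_zero_zero (h0 : 0 < ρ₀) (hf : ModeLim ρ₀ l m (k + 1) s f L) :
    ModeLim ρ₀ l m k (s + 1) (spatialD 0 0 f) (limitD l 0 0 s * L) := by
  have e : spatialD 0 0 f = fun ρ z => (-(Real.sqrt 2 : ℂ)⁻¹) * eth (f ρ) z := by
    funext ρ z
    simp [spatialD, div_eq_mul_inv, mul_comm]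
  rw [e]
  refine ⟨hf.regular.eth.const_mul _, WeakLim.congr h0 (fun ρ hρ => ?_)
    (hf.weakLim.const_mul (limitD l 0 0 s))⟩
  rw [modeCoeff_const_mul, modeCoeff_eth ((hf.regular.slice hρ).of_le (by norm_cast; omega))
    (hf.regular.phaseWeight ρ hρ)]
  simp only [limitD, and_self, if_true]
  ring

theorem spatialD_one_one (h0 : 0 < ρ₀) (hf : ModeLim ρ₀ l m (k + 1) s f L) :
    ModeLim ρ₀ l m k (s - 1) (spatialD 1 1 f) (limitD l 1 1 s * L) := by
  have e : spatialD 1 1 f = fun ρ z => (Real.sqrt 2 : ℂ)⁻¹ * ethBar (f ρ) z := by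
    funext ρ z
    simp [spatialD, div_eq_mul_inv, mul_comm]
  rw [e]
  refine ⟨hf.regular.ethBar.const_mul _, WeakLim.congr h0 (fun ρ hρ => ?_)
    (hf.weakLim.const_mul (limitD l 1 1 s))⟩
  rw [modeCoeff_const_mul, modeCoeff_ethBar ((hf.regular.slice hρ).of_le (by norm_cast; omega))
    (hf.regular.phaseWeight ρ hρ)]
  simp only [limitD, and_self, if_true, one_ne_zero, if_false]
  ring

/-- Modes commute with ∂_ρ by differentiation under the integral, so `WeakLim.euler` applies. This
is how D₀₁ disappears at ρ = 0. -/
theorem euler (h0 : 0 < ρ₀) (hf : ModeLim ρ₀ l m (k + 1) s f L) :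
    ModeLim ρ₀ l m k s (fun ρ z => (ρ : ℂ) * deriv (fun r => f r z) ρ) 0 := by
  refine ⟨hf.regular.euler, WeakLim.congr h0 (fun ρ hρ => ?_)
    (hf.weakLim.euler h0 (f' := fun ρ => modeCoeff l m s (fun z => deriv (fun r => f r z) ρ))
      (fun ρ hρ => ?_) (hf.regular.deriv.continuousOn_modeCoeff l m s))⟩
  · rw [modeCoeff_const_mul]
  · exact hasDerivAt_modeCoeff (f := f) (f' := fun ρ z => deriv (fun r => f r z) ρ) isOpen_Ioo
      (fun x hx => (hf.regular.slice hx).continuousOn)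
      hf.regular.deriv.contDiffOn.continuousOn (fun x hx z hz => hf.regular.hasDerivAt hx hz) hρ

theorem spatialD_mixed (h0 : 0 < ρ₀) (hf : ModeLim ρ₀ l m (k + 1) s f L) {A B : Fin 2}
    (hAB : A ≠ B) : ModeLim ρ₀ l m k s (spatialD A B f) (limitD l A B s * L) := by
  have h1 : ¬ (A = 0 ∧ B = 0) := fun h => hAB (h.1.trans h.2.symm)
  have h2 : ¬ (A = 1 ∧ B = 1) := fun h => hAB (h.1.trans h.2.symm)
  have e : spatialD A B f =
      fun (ρ : ℝ) z => (Real.sqrt 2 : ℂ)⁻¹ * ((ρ : ℂ) * deriv (fun r => f r z) ρ) := by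
    funext ρ z
    simp only [spatialD, if_neg h1, if_neg h2, div_eq_mul_inv]
    ring
  rw [e]
  exact ((hf.euler h0).const_mul _).cast rfl (by simp [limitD, h1, h2])

/-- The uniform weight count for all index pairs: D_{AB} shifts the spin weight by 1 - A - B, and
costs one order of differentiability. -/
theorem spatialD (h0 : 0 < ρ₀) (hf : ModeLim ρ₀ l m (k + 1) s f L) (A B : Fin 2) :
    ModeLim ρ₀ l m k (s + 1 - (A.val : ℤ) - (B.val : ℤ)) (spatialD A B f)
      (limitD l A B s * L) := by
  fin_cases A <;> fin_cases B
  · exact (hf.spatialD_zero_zero h0).cast (by simp) rfl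
  · exact (hf.spatialD_mixed h0 (by simp)).cast (by simp) rfl
  · exact (hf.spatialD_mixed h0 (by simp)).cast (by simp) rfl
  · exact (hf.spatialD_one_one h0).cast (by simp) rfl

end ModeLim

/-! ### Limits of the modes of spinor fields -/

/-- The modes of the components of `Φ` converge weakly to the entries of `c`. -/
def Spinor4Lim (ρ₀ : ℝ) (l : ℕ) (m : ℤ) (k : ℕ) (Φ : Spinor4)
    (c : Fin 2 → Fin 2 → Fin 2 → Fin 2 → ℂ) : Prop :=
  ∀ A B C D : Fin 2, ModeLim ρ₀ l m k
    (2 - (A.val : ℤ) - (B.val : ℤ) - (C.val : ℤ) - (D.val : ℤ)) (Φ A B C D) (c A B C D)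

def Spinor2Lim (ρ₀ : ℝ) (l : ℕ) (m : ℤ) (k : ℕ) (χ : Spinor2) (c : Fin 2 → Fin 2 → ℂ) : Prop :=
  ∀ A B : Fin 2, ModeLim ρ₀ l m k (1 - (A.val : ℤ) - (B.val : ℤ)) (χ A B) (c A B)

/-- The algebraic shadows of the spinor operators at ρ = 0: each derivative becomes its multiplier
`limitD`, taken at the weight of the component on which it acts. -/
def limitRot (l : ℕ) (c : Fin 2 → Fin 2 → Fin 2 → Fin 2 → ℂ) (A B C D : Fin 2) : ℂ :=
  limitD l A 1 (2 - (B.val : ℤ) - (C.val : ℤ) - (D.val : ℤ)) * c B C D 0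
    - limitD l A 0 (1 - (B.val : ℤ) - (C.val : ℤ) - (D.val : ℤ)) * c B C D 1

def limitCurl (l : ℕ) (c : Fin 2 → Fin 2 → Fin 2 → Fin 2 → ℂ) (A B C D : Fin 2) : ℂ :=
  (1 / 4 : ℂ) * (limitRot l c A B C D + limitRot l c B A C D + limitRot l c C A B D +
    limitRot l c D A B C)

def limitDiv (l : ℕ) (c : Fin 2 → Fin 2 → Fin 2 → Fin 2 → ℂ) (C D : Fin 2) : ℂ :=
  limitD l 1 1 (2 - (C.val : ℤ) - (D.val : ℤ)) * c 0 0 C D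
    + limitD l 0 0 (-(C.val : ℤ) - (D.val : ℤ)) * c 1 1 C D

def limitTwist (l : ℕ) (c : Fin 2 → Fin 2 → ℂ) (A B C D : Fin 2) : ℂ :=
  (1 / 6 : ℂ) * (limitD l A B (1 - (C.val : ℤ) - (D.val : ℤ)) * c C D +
    limitD l A C (1 - (B.val : ℤ) - (D.val : ℤ)) * c B D +
    limitD l A D (1 - (B.val : ℤ) - (C.val : ℤ)) * c B C +
    limitD l B C (1 - (A.val : ℤ) - (D.val : ℤ)) * c A D +
    limitD l B D (1 - (A.val : ℤ) - (C.val : ℤ)) * c A C +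
    limitD l C D (1 - (A.val : ℤ) - (B.val : ℤ)) * c A B)

theorem Spinor4Lim.rot {ρ₀ : ℝ} (h0 : 0 < ρ₀) {l : ℕ} {m : ℤ} {k : ℕ} {Φ : Spinor4}
    {c : Fin 2 → Fin 2 → Fin 2 → Fin 2 → ℂ} (h : Spinor4Lim ρ₀ l m (k + 1) Φ c) :
    Spinor4Lim ρ₀ l m k (spinorRot Φ) (limitRot l c) := by
  intro A B C D
  have e : spinorRot Φ A B C D = fun ρ z => spatialD A 1 (Φ B C D 0) ρ z
      + (-1) * spatialD A 0 (Φ B C D 1) ρ z := by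
    funext ρ z
    simp [spinorRot, Fin.sum_univ_two, epsUp]
  rw [e]
  refine ModeLim.cast (ModeLim.add h0 (((h B C D 0).spatialD h0 A 1).cast
    (s' := 2 - (A.val : ℤ) - (B.val : ℤ) - (C.val : ℤ) - (D.val : ℤ)) ?_ rfl)
    ((((h B C D 1).spatialD h0 A 0).const_mul (-1)).cast ?_ rfl)) rfl ?_
  · simp only [Fin.val_zero, Fin.val_one]; push_cast; ring
  · simp only [Fin.val_zero, Fin.val_one]; push_cast; ring
  · have e1 : (2 : ℤ) - (B.val : ℤ) - (C.val : ℤ) - (D.val : ℤ) - ((1 : Fin 2).val : ℤ)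
        = 1 - (B.val : ℤ) - (C.val : ℤ) - (D.val : ℤ) := by
      simp only [Fin.val_one]; push_cast; ring
    rw [limitRot, e1]
    simp only [Fin.val_zero, Nat.cast_zero, sub_zero]
    ring

theorem Spinor4Lim.curl {ρ₀ : ℝ} (h0 : 0 < ρ₀) {l : ℕ} {m : ℤ} {k : ℕ} {Φ : Spinor4}
    {c : Fin 2 → Fin 2 → Fin 2 → Fin 2 → ℂ} (h : Spinor4Lim ρ₀ l m (k + 1) Φ c) :
    Spinor4Lim ρ₀ l m k (spinorCurl Φ) (limitCurl l c) := by
  intro A B C D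
  have hr := h.rot h0
  exact ((((hr A B C D).add h0 ((hr B A C D).cast (by ring) rfl)).add h0
    ((hr C A B D).cast (by ring) rfl)).add h0 ((hr D A B C).cast (by ring) rfl)).const_mul _

theorem Spinor4Lim.div {ρ₀ : ℝ} (h0 : 0 < ρ₀) {l : ℕ} {m : ℤ} {k : ℕ} {Φ : Spinor4}
    {c : Fin 2 → Fin 2 → Fin 2 → Fin 2 → ℂ} (h : Spinor4Lim ρ₀ l m (k + 1) Φ c) :
    Spinor2Lim ρ₀ l m k (spinorDiv Φ) (limitDiv l c) := by
  intro C D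
  have e : spinorDiv Φ C D = fun ρ z => ((spatialD 1 1 (Φ 0 0 C D) ρ z
      + spatialD 0 0 (Φ 1 1 C D) ρ z) + (-1) * spatialD 1 0 (Φ 0 1 C D) ρ z)
      + (-1) * spatialD 0 1 (Φ 1 0 C D) ρ z := by
    funext ρ z
    simp [spinorDiv, Fin.sum_univ_two, epsUp]
    ring
  rw [e]
  refine ModeLim.cast (ModeLim.add h0 (ModeLim.add h0 (ModeLim.add h0
    (((h 0 0 C D).spatialD h0 1 1).cast (s' := 1 - (C.val : ℤ) - (D.val : ℤ)) ?_ rfl)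
    (((h 1 1 C D).spatialD h0 0 0).cast ?_ rfl))
    ((((h 0 1 C D).spatialD h0 1 0).const_mul (-1)).cast ?_ rfl))
    ((((h 1 0 C D).spatialD h0 0 1).const_mul (-1)).cast ?_ rfl)) rfl ?_
  · simp only [Fin.val_zero, Fin.val_one]; push_cast; ring
  · simp only [Fin.val_zero, Fin.val_one]; push_cast; ring
  · simp only [Fin.val_zero, Fin.val_one]; push_cast; ring
  · simp only [Fin.val_zero, Fin.val_one]; push_cast; ring
  · have e1 : (2 : ℤ) - ((1 : Fin 2).val : ℤ) - ((1 : Fin 2).val : ℤ) - (C.val : ℤ) - (D.val : ℤ)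
        = -(C.val : ℤ) - (D.val : ℤ) := by
      simp only [Fin.val_one]; push_cast; ring
    have e2 : ∀ s, limitD l 0 1 s = 0 := fun s => by simp [limitD]
    have e3 : ∀ s, limitD l 1 0 s = 0 := fun s => by simp [limitD]
    rw [limitDiv, e1, e2, e3]
    simp only [Fin.val_zero, Nat.cast_zero, sub_zero]
    ring

theorem Spinor2Lim.twist {ρ₀ : ℝ} (h0 : 0 < ρ₀) {l : ℕ} {m : ℤ} {k : ℕ} {χ : Spinor2}
    {c : Fin 2 → Fin 2 → ℂ} (h : Spinor2Lim ρ₀ l m (k + 1) χ c) :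
    Spinor4Lim ρ₀ l m k (spinorTwist χ) (limitTwist l c) := by
  intro A B C D
  have w : ∀ A B C D : Fin 2, (1 : ℤ) - (C.val : ℤ) - (D.val : ℤ) + 1 - (A.val : ℤ) - (B.val : ℤ)
      = 2 - (A.val : ℤ) - (B.val : ℤ) - (C.val : ℤ) - (D.val : ℤ) := by
    intro A B C D; ring
  exact (((((((h C D).spatialD h0 A B).cast (w A B C D) rfl).add h0
    (((h B D).spatialD h0 A C).cast (by ring) rfl)).add h0
    (((h B C).spatialD h0 A D).cast (by ring) rfl)).add h0
    (((h A D).spatialD h0 B C).cast (by ring) rfl)).add h0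
    (((h A C).spatialD h0 B D).cast (by ring) rfl)).add h0
    (((h A B).spatialD h0 C D).cast (by ring) rfl) |>.const_mul _

def limitHertz (l : ℕ) (c : Fin 2 → Fin 2 → Fin 2 → Fin 2 → ℂ) (A B C D : Fin 2) : ℂ :=
  2 * limitTwist l (limitDiv l (limitCurl l c)) A B C D +
    8 * limitCurl l (limitCurl l (limitCurl l c)) A B C D

/-- Both terms of 𝒢₄ are compositions of three first-order operators, which use up exactly the class
C³ of the potential. -/
theorem Spinor4Lim.hertz {ρ₀ : ℝ} (h0 : 0 < ρ₀) {l : ℕ} {m : ℤ} {Φ : Spinor4}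
    {c : Fin 2 → Fin 2 → Fin 2 → Fin 2 → ℂ} (h : Spinor4Lim ρ₀ l m 3 Φ c) :
    Spinor4Lim ρ₀ l m 0 (hertzG Φ) (limitHertz l c) := by
  intro A B C D
  have h1 : Spinor4Lim ρ₀ l m 2 (spinorCurl Φ) (limitCurl l c) := h.curl h0
  have h2 : Spinor4Lim ρ₀ l m 1 (spinorCurl (spinorCurl Φ)) (limitCurl l (limitCurl l c)) :=
    h1.curl h0
  have h3 : Spinor2Lim ρ₀ l m 1 (spinorDiv (spinorCurl Φ)) (limitDiv l (limitCurl l c)) :=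
    h1.div h0
  exact ((h3.twist h0 A B C D).const_mul 2).add h0 ((h2.curl h0 A B C D).const_mul 8)

/-! ### Closed form of 𝒢₄ on the limits of modes. -/

def limitOfComponents (b : Fin 5 → ℂ) (A B C D : Fin 2) : ℂ :=
  b ⟨A.val + B.val + C.val + D.val, by omega⟩

theorem limitD_zero_zero (l : ℕ) (s : ℤ) :
    limitD l 0 0 s = (ethFactor l s : ℂ) * (Real.sqrt 2 : ℂ)⁻¹ := by simp [limitD]

theorem limitD_one_one (l : ℕ) (s : ℤ) :
    limitD l 1 1 s = (ethFactor l (s - 1) : ℂ) * (Real.sqrt 2 : ℂ)⁻¹ := by simp [limitD]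

theorem limitD_zero_one (l : ℕ) (s : ℤ) : limitD l 0 1 s = 0 := by simp [limitD]

theorem limitD_one_zero (l : ℕ) (s : ℤ) : limitD l 1 0 s = 0 := by simp [limitD]

theorem ethFactor_neg (l : ℕ) (s : ℤ) : ethFactor l (-s - 1) = ethFactor l s := by
  simp only [ethFactor]
  congr 1
  push_cast
  ring

/-- With D₀₁ gone, every surviving derivative changes the spin weight by ±1. Three of them reverse
its parity, so the middle component sees only b₁ and b₃. -/
theorem limitHertz_middle (l : ℕ) (b : Fin 5 → ℂ) :
    limitHertz l (limitOfComponents b) 0 0 1 1 =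
      -(4 / 3) * (Real.sqrt 2 : ℂ)⁻¹ ^ 3 * (ethFactor l 0 : ℂ) *
        (2 * (ethFactor l 0 : ℂ) ^ 2 + (ethFactor l 1 : ℂ) ^ 2) * (b 1 - b 3) := by
  -- The symmetry s ↦ -s - 1 leaves only the two factors at s = 0 and s = 1.
  have n1 : ethFactor l (-1) = ethFactor l 0 := by simpa using ethFactor_neg l 0
  have n2 : ethFactor l (-2) = ethFactor l 1 := by
    have := ethFactor_neg l 1
    norm_num at this
    exact this
  have i2 : ∀ h, (⟨2, h⟩ : Fin 5) = 2 := fun _ => rfl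
  have i3 : ∀ h, (⟨3, h⟩ : Fin 5) = 3 := fun _ => rfl
  have i4 : ∀ h, (⟨4, h⟩ : Fin 5) = 4 := fun _ => rfl
  simp only [limitHertz, limitTwist, limitDiv, limitCurl, limitRot, limitD_zero_zero,
    limitD_one_one, limitD_zero_one, limitD_one_zero, Fin.val_zero, Fin.val_one, Nat.cast_zero,
    Nat.cast_one, limitOfComponents]
  norm_num [n1, n2, i2, i3, i4]
  ring

/-- By the same parity only b₀, b₂, b₄ enter. This difference is what determines the initial
velocity of the middle mode. -/
theorem limitHertz_sub (l : ℕ) (b : Fin 5 → ℂ) :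
    limitHertz l (limitOfComponents b) 0 0 0 1 - limitHertz l (limitOfComponents b) 0 1 1 1 =
      -(1 / 2) * (Real.sqrt 2 : ℂ)⁻¹ ^ 3 * (3 * (ethFactor l 0 : ℂ) ^ 2 + (ethFactor l 1 : ℂ) ^ 2) *
        ((ethFactor l 1 : ℂ) * (b 0 + b 4) - 6 * (ethFactor l 0 : ℂ) * b 2) := by
  have n1 : ethFactor l (-1) = ethFactor l 0 := by simpa using ethFactor_neg l 0
  have n2 : ethFactor l (-2) = ethFactor l 1 := by
    have := ethFactor_neg l 1
    norm_num at this
    exact this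
  have i2 : ∀ h, (⟨2, h⟩ : Fin 5) = 2 := fun _ => rfl
  have i3 : ∀ h, (⟨3, h⟩ : Fin 5) = 3 := fun _ => rfl
  have i4 : ∀ h, (⟨4, h⟩ : Fin 5) = 4 := fun _ => rfl
  simp only [limitHertz, limitTwist, limitDiv, limitCurl, limitRot, limitD_zero_zero,
    limitD_one_one, limitD_zero_one, limitD_one_zero, Fin.val_zero, Fin.val_one, Nat.cast_zero,
    Nat.cast_one, limitOfComponents]
  norm_num [n1, n2, i2, i3, i4]
  ring

/-! ### Modes of fields near the cylinder at spatial infinity -/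

/-- The domain `|τ| < 1`, `0 < ρ < ρ₀`. -/
def cylDomain (ρ₀ : ℝ) : Set (ℝ × ℝ × (ℂ × ℂ)) :=
  Set.Ioo (-1 : ℝ) 1 ×ˢ Set.Ioo 0 ρ₀ ×ˢ {0}ᶜ

/-- `f` is of class `C^k` for `|τ| < 1`, `0 < ρ < ρ₀`. -/
def CylSmooth (ρ₀ : ℝ) (k : ℕ) (f : SpacetimeField) : Prop :=
  ContDiffOn ℝ k (fun p : ℝ × ℝ × (ℂ × ℂ) => f p.1 p.2.1 p.2.2) (cylDomain ρ₀)

theorem isOpen_cylDomain (ρ₀ : ℝ) : IsOpen (cylDomain ρ₀) :=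
  isOpen_Ioo.prod (isOpen_Ioo.prod isOpen_compl_singleton)

namespace CylSmooth

variable {ρ₀ : ℝ} {k : ℕ} {f : SpacetimeField} {τ ρ : ℝ} {z : ℂ × ℂ}

theorem differentiableAt (hf : CylSmooth ρ₀ (k + 1) f) {p : ℝ × ℝ × (ℂ × ℂ)}
    (hp : p ∈ cylDomain ρ₀) :
    DifferentiableAt ℝ (fun p : ℝ × ℝ × (ℂ × ℂ) => f p.1 p.2.1 p.2.2) p :=
  (ContDiffOn.differentiableOn hf (by norm_cast)).differentiableAt
    ((isOpen_cylDomain ρ₀).mem_nhds hp)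

theorem hasDerivAt_tau' (hf : CylSmooth ρ₀ (k + 1) f) (hp : (τ, ρ, z) ∈ cylDomain ρ₀) :
    HasDerivAt (fun t => f t ρ z)
      (fderiv ℝ (fun p : ℝ × ℝ × (ℂ × ℂ) => f p.1 p.2.1 p.2.2) (τ, ρ, z) (1, 0, 0)) τ :=
  (hf.differentiableAt hp).hasFDerivAt.comp_hasDerivAt (f := fun t : ℝ => (t, ρ, z)) τ
    ((hasDerivAt_id τ).prodMk (hasDerivAt_const τ (ρ, z)))

theorem hasDerivAt_rho' (hf : CylSmooth ρ₀ (k + 1) f) (hp : (τ, ρ, z) ∈ cylDomain ρ₀) :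
    HasDerivAt (fun r => f τ r z)
      (fderiv ℝ (fun p : ℝ × ℝ × (ℂ × ℂ) => f p.1 p.2.1 p.2.2) (τ, ρ, z) (0, 1, 0)) ρ :=
  (hf.differentiableAt hp).hasFDerivAt.comp_hasDerivAt (f := fun r : ℝ => (τ, r, z)) ρ
    ((hasDerivAt_const ρ τ).prodMk ((hasDerivAt_id ρ).prodMk (hasDerivAt_const ρ z)))

theorem hasDerivAt_tau (hf : CylSmooth ρ₀ (k + 1) f) (hp : (τ, ρ, z) ∈ cylDomain ρ₀) :
    HasDerivAt (fun t => f t ρ z) (dTau f τ ρ z) τ :=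
  (hf.hasDerivAt_tau' hp).differentiableAt.hasDerivAt

theorem hasDerivAt_rho (hf : CylSmooth ρ₀ (k + 1) f) (hp : (τ, ρ, z) ∈ cylDomain ρ₀) :
    HasDerivAt (fun r => f τ r z) (dRho f τ ρ z) ρ :=
  (hf.hasDerivAt_rho' hp).differentiableAt.hasDerivAt

theorem dTau (hf : CylSmooth ρ₀ (k + 1) f) : CylSmooth ρ₀ k (dTau f) := by
  have h1 := ContDiffOn.fderiv_of_isOpen hf (isOpen_cylDomain ρ₀) (m := k) (by norm_cast)
  refine (h1.clm_apply contDiffOn_const (g := fun _ => ((1 : ℝ), (0 : ℝ), (0 : ℂ × ℂ)))).congr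
    fun p hp => ?_
  exact (hf.hasDerivAt_tau' hp).deriv

theorem dRho (hf : CylSmooth ρ₀ (k + 1) f) : CylSmooth ρ₀ k (dRho f) := by
  have h1 := ContDiffOn.fderiv_of_isOpen hf (isOpen_cylDomain ρ₀) (m := k) (by norm_cast)
  refine (h1.clm_apply contDiffOn_const (g := fun _ => ((0 : ℝ), (1 : ℝ), (0 : ℂ × ℂ)))).congr
    fun p hp => ?_
  exact (hf.hasDerivAt_rho' hp).deriv

theorem slice (hf : CylSmooth ρ₀ k f) (hτ : τ ∈ Set.Ioo (-1 : ℝ) 1) :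
    ContDiffOn ℝ k (fun q : ℝ × (ℂ × ℂ) => f τ q.1 q.2) (Set.Ioo 0 ρ₀ ×ˢ {0}ᶜ) :=
  ContDiffOn.comp (f := fun q : ℝ × (ℂ × ℂ) => (τ, q)) hf
    (contDiff_const.prodMk contDiff_id).contDiffOn fun _ hq => ⟨hτ, hq⟩

theorem sphere (hf : CylSmooth ρ₀ k f) (hτ : τ ∈ Set.Ioo (-1 : ℝ) 1) (hρ : ρ ∈ Set.Ioo 0 ρ₀) :
    ContDiffOn ℝ k (f τ ρ) {0}ᶜ :=
  ContDiffOn.comp (f := fun z : ℂ × ℂ => (τ, ρ, z)) hf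
    (contDiff_const.prodMk (contDiff_const.prodMk contDiff_id)).contDiffOn
    fun _ hz => ⟨hτ, hρ, hz⟩

theorem contDiffOn_eth (hf : CylSmooth ρ₀ (k + 1) f) (hτ : τ ∈ Set.Ioo (-1 : ℝ) 1)
    (hρ : ρ ∈ Set.Ioo 0 ρ₀) : ContDiffOn ℝ k (eth (f τ ρ)) {0}ᶜ :=
  (contDiffOn_frameDeriv (κ := Complex.I) isOpen_Ioo (hf.slice hτ)).comp
    (f := fun z : ℂ × ℂ => (ρ, z)) (contDiff_const.prodMk contDiff_id).contDiffOn
    fun _ hz => ⟨hρ, hz⟩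

theorem contDiffOn_ethBar (hf : CylSmooth ρ₀ (k + 1) f) (hτ : τ ∈ Set.Ioo (-1 : ℝ) 1)
    (hρ : ρ ∈ Set.Ioo 0 ρ₀) : ContDiffOn ℝ k (ethBar (f τ ρ)) {0}ᶜ := by
  rw [ethBar_eq_frameDeriv]
  exact (contDiffOn_frameDeriv (κ := -Complex.I) isOpen_Ioo (hf.slice hτ)).comp
    (f := fun z : ℂ × ℂ => (ρ, z)) (contDiff_const.prodMk contDiff_id).contDiffOn
    fun _ hz => ⟨hρ, hz⟩

theorem continuousOn_modeCoeff (hf : CylSmooth ρ₀ k f) (l : ℕ) (m s : ℤ) :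
    ContinuousOn (fun p : ℝ × ℝ => modeCoeff l m s (f p.1 p.2))
      (Set.Ioo (-1 : ℝ) 1 ×ˢ Set.Ioo 0 ρ₀) := by
  refine _root_.continuousOn_modeCoeff (f := fun p : ℝ × ℝ => f p.1 p.2)
    (isOpen_Ioo.prod isOpen_Ioo) ?_
  exact ContinuousOn.comp (f := fun q : (ℝ × ℝ) × (ℂ × ℂ) => (q.1.1, q.1.2, q.2))
    (ContDiffOn.continuousOn hf) (by fun_prop) fun q hq => ⟨hq.1.1, hq.1.2, hq.2⟩

theorem hasDerivAt_modeCoeff_tau (hf : CylSmooth ρ₀ (k + 1) f) (l : ℕ) (m s : ℤ)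
    (hτ : τ ∈ Set.Ioo (-1 : ℝ) 1) (hρ : ρ ∈ Set.Ioo 0 ρ₀) :
    HasDerivAt (fun t => modeCoeff l m s (f t ρ)) (modeCoeff l m s (_root_.dTau f τ ρ)) τ := by
  refine hasDerivAt_modeCoeff (f := fun t => f t ρ) (f' := fun t => _root_.dTau f t ρ) isOpen_Ioo
    (fun x hx => (hf.sphere hx hρ).continuousOn) ?_
    (fun x hx z hz => hf.hasDerivAt_tau ⟨hx, hρ, hz⟩) hτ
  exact ContinuousOn.comp (f := fun q : ℝ × (ℂ × ℂ) => (q.1, ρ, q.2))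
    (ContDiffOn.continuousOn hf.dTau) (by fun_prop) fun q hq => ⟨hq.1, hρ, hq.2⟩

theorem hasDerivAt_modeCoeff_rho (hf : CylSmooth ρ₀ (k + 1) f) (l : ℕ) (m s : ℤ)
    (hτ : τ ∈ Set.Ioo (-1 : ℝ) 1) (hρ : ρ ∈ Set.Ioo 0 ρ₀) :
    HasDerivAt (fun r => modeCoeff l m s (f τ r)) (modeCoeff l m s (_root_.dRho f τ ρ)) ρ :=
  hasDerivAt_modeCoeff (f := fun r => f τ r) (f' := fun r => _root_.dRho f τ r) isOpen_Ioo
    (fun _ hx => (hf.sphere hτ hx).continuousOn) (hf.dRho.slice hτ).continuousOn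
    (fun _ hx _ hz => hf.hasDerivAt_rho ⟨hτ, hx, hz⟩) hρ

end CylSmooth

/-! ### Projecting linear equations on modes -/

/-- Projects a pointwise linear equation on a mode once it is presented as a list of coefficients
constant on the sphere and a list of continuous terms. -/
theorem modeCoeff_sum_eq_zero {n : ℕ} {l : ℕ} {m s : ℤ} (c : Fin n → ℂ)
    (f : Fin n → ℂ × ℂ → ℂ) (hf : ∀ i, ContinuousOn (f i) {0}ᶜ)
    (h : ∀ z ≠ 0, ∑ i, c i * f i z = 0) : ∑ i, c i * modeCoeff l m s (f i) = 0 := by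
  have key : ∀ S : Finset (Fin n), modeCoeff l m s (fun z => ∑ i ∈ S, c i * f i z)
      = ∑ i ∈ S, c i * modeCoeff l m s (f i) := by
    intro S
    induction S using Finset.induction_on with
    | empty =>
      simp only [Finset.sum_empty]
      have := modeCoeff_const_mul l m s 0 (fun _ => 0)
      simpa using this
    | insert i S hi ih =>
      simp only [Finset.sum_insert hi]
      rw [modeCoeff_add ((hf i).const_mul _)
        (continuousOn_finsetSum _ fun j _ => (hf j).const_mul _), ih, modeCoeff_const_mul]
  rw [← key Finset.univ, modeCoeff_congr (g := fun _ => 0 * 0)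
    (fun z hz => by rw [h z (unitFrames_ne_zero hz), zero_mul]),
    modeCoeff_const_mul l m s 0 (fun _ => 0), zero_mul]

/-! ### Leading terms -/

namespace FieldExpansion

variable {ρ₀ : ℝ} {ψ : Fin 5 → SpacetimeField} {ψ0 : Fin 5 → ℝ → ℂ × ℂ → ℂ}

theorem cylSmooth (h : FieldExpansion ρ₀ ψ ψ0) (n : Fin 5) : CylSmooth ρ₀ 2 (ψ n) :=
  h.contDiffOn n

theorem phaseWeight (h : FieldExpansion ρ₀ ψ ψ0) (n : Fin 5) {τ ρ : ℝ}
    (hτ : τ ∈ Set.Ioo (-1 : ℝ) 1) (hρ : ρ ∈ Set.Ioo 0 ρ₀) : PhaseWeight (weight n) (ψ n τ ρ) :=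
  (h.spinWeight n τ hτ ρ hρ).phaseWeight

theorem modeCoeff_ethBar (h : FieldExpansion ρ₀ ψ ψ0) (n : Fin 5) {τ ρ : ℝ}
    (hτ : τ ∈ Set.Ioo (-1 : ℝ) 1) (hρ : ρ ∈ Set.Ioo 0 ρ₀) (l : ℕ) (m s : ℤ)
    (hs : weight n = s + 1) :
    modeCoeff l m s (ethBar (ψ n τ ρ)) =
      (ethFactor l s : ℂ) * modeCoeff l m (weight n) (ψ n τ ρ) := by
  have := _root_.modeCoeff_ethBar (l := l) (m := m)
    (((h.cylSmooth n).sphere hτ hρ).of_le (by norm_num)) (h.phaseWeight n hτ hρ)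
  rwa [show weight n - 1 = s by omega] at this

theorem modeCoeff_eth (h : FieldExpansion ρ₀ ψ ψ0) (n : Fin 5) {τ ρ : ℝ}
    (hτ : τ ∈ Set.Ioo (-1 : ℝ) 1) (hρ : ρ ∈ Set.Ioo 0 ρ₀) (l : ℕ) (m s : ℤ)
    (hs : weight n = s - 1) :
    modeCoeff l m s (eth (ψ n τ ρ)) =
      -(ethFactor l (s - 1) : ℂ) * modeCoeff l m (weight n) (ψ n τ ρ) := by
  have := _root_.modeCoeff_eth (l := l) (m := m)
    (((h.cylSmooth n).sphere hτ hρ).of_le (by norm_num)) (h.phaseWeight n hτ hρ)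
  rw [hs] at this ⊢
  rwa [sub_add_cancel] at this

theorem hasDerivAt_lead (h : FieldExpansion ρ₀ ψ ψ0) (n : Fin 5) {τ : ℝ}
    (hτ : τ ∈ Set.Ioo (-1 : ℝ) 1) {z : ℂ × ℂ} (hz : z ≠ 0) :
    HasDerivAt (fun t => ψ0 n t z) (deriv (fun t => ψ0 n t z) τ) τ :=
  (hasDerivAt_param isOpen_Ioo (h.contDiffOn_lead n) hτ hz).differentiableAt.hasDerivAt

theorem continuousOn_lead (h : FieldExpansion ρ₀ ψ ψ0) (n : Fin 5) {τ : ℝ}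
    (hτ : τ ∈ Set.Ioo (-1 : ℝ) 1) : ContinuousOn (ψ0 n τ) {0}ᶜ :=
  (h.contDiffOn_lead n).continuousOn.comp (f := fun z : ℂ × ℂ => (τ, z)) (by fun_prop)
    fun _ hz => ⟨hτ, hz⟩

theorem continuousOn_deriv_lead (h : FieldExpansion ρ₀ ψ ψ0) (n : Fin 5) :
    ContinuousOn (fun q : ℝ × (ℂ × ℂ) => deriv (fun t => ψ0 n t q.2) q.1)
      (Set.Ioo (-1 : ℝ) 1 ×ˢ {0}ᶜ) :=
  (contDiffOn_deriv_param (k := 0) isOpen_Ioo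
    ((h.contDiffOn_lead n).of_le (by norm_num))).continuousOn

theorem continuousOn_deriv_lead_sphere (h : FieldExpansion ρ₀ ψ ψ0) (n : Fin 5) {τ : ℝ}
    (hτ : τ ∈ Set.Ioo (-1 : ℝ) 1) :
    ContinuousOn (fun z : ℂ × ℂ => deriv (fun t => ψ0 n t z) τ) {0}ᶜ :=
  (h.continuousOn_deriv_lead n).comp (f := fun z : ℂ × ℂ => (τ, z)) (by fun_prop)
    fun _ hz => ⟨hτ, hz⟩

/-- The mode of the `τ`-derivative of the leading term. -/
theorem hasDerivAt_modeCoeff_lead (h : FieldExpansion ρ₀ ψ ψ0) (n : Fin 5) (l : ℕ) (m s : ℤ)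
    {τ : ℝ} (hτ : τ ∈ Set.Ioo (-1 : ℝ) 1) :
    HasDerivAt (fun t => modeCoeff l m s (ψ0 n t))
      (modeCoeff l m s (fun z => deriv (fun t => ψ0 n t z) τ)) τ :=
  hasDerivAt_modeCoeff (f := fun t => ψ0 n t) (f' := fun x z => deriv (fun t => ψ0 n t z) x)
    isOpen_Ioo (fun _ hx => h.continuousOn_lead n hx) (h.continuousOn_deriv_lead n)
    (fun _ hx _ hz => h.hasDerivAt_lead n hx hz) hτ

/-- Modes and their first derivatives converge as `ρ → 0`, locally uniformly in `τ`. -/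
theorem modeCoeff_uniform (h : FieldExpansion ρ₀ ψ ψ0) (h0 : 0 < ρ₀) (n : Fin 5) (l : ℕ)
    (m s : ℤ) {T : ℝ} (hT : T < 1) {ε : ℝ} (hε : 0 < ε) :
    ∀ᶠ ρ in nhdsWithin (0 : ℝ) (Set.Ioi 0), ∀ τ : ℝ, |τ| ≤ T →
      ‖modeCoeff l m s (ψ n τ ρ) - modeCoeff l m s (ψ0 n τ)‖ ≤ ε ∧
      ‖modeCoeff l m s (dTau (ψ n) τ ρ)
        - modeCoeff l m s (fun z => deriv (fun t => ψ0 n t z) τ)‖ ≤ ε ∧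
      ‖modeCoeff l m s (dRho (ψ n) τ ρ)‖ ≤ ε := by
  obtain ⟨K, hK, hb⟩ := exists_norm_modeCoeff_le l m s
  obtain ⟨δ, hδ, hR⟩ := h.remainder n T hT (ε / K) (by positivity)
  -- The bound ρ < 1 turns the estimate ερ of the remainder into ε.
  have hmem : Set.Ioo (0 : ℝ) (min (min δ ρ₀) 1) ∈ nhdsWithin (0 : ℝ) (Set.Ioi 0) :=
    Ioo_mem_nhdsGT (lt_min (lt_min hδ h0) one_pos)
  filter_upwards [hmem] with ρ hρ τ hτ
  have hρδ : ρ < δ := hρ.2.trans_le ((min_le_left _ _).trans (min_le_left _ _))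
  have hρ₀ : ρ < ρ₀ := hρ.2.trans_le ((min_le_left _ _).trans (min_le_right _ _))
  have hρ1 : ρ < 1 := hρ.2.trans_le (min_le_right _ _)
  have hρm : ρ ∈ Set.Ioo 0 ρ₀ := ⟨hρ.1, hρ₀⟩
  have hτm : τ ∈ Set.Ioo (-1 : ℝ) 1 := abs_lt.1 (hτ.trans_lt hT)
  have hsm := h.cylSmooth n
  have hfin : ∀ {x : ℂ}, ‖x‖ ≤ K * (ε / K) → ‖x‖ ≤ ε := fun hx =>
    hx.trans (le_of_eq (by field_simp))
  refine ⟨hfin ?_, hfin ?_, hfin ?_⟩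
  · rw [← modeCoeff_sub (hsm.sphere hτm hρm).continuousOn (h.continuousOn_lead n hτm)]
    refine hb _ _ fun z hz => ?_
    refine (hR τ ρ z hτ hρ.1 hρδ hρ₀ (unitFrames_ne_zero hz)).1.trans ?_
    exact mul_le_of_le_one_right (by positivity) hρ1.le
  · rw [← modeCoeff_sub (hsm.dTau.sphere hτm hρm).continuousOn
      (h.continuousOn_deriv_lead_sphere n hτm)]
    refine hb _ _ fun z hz => ?_
    have hz0 := unitFrames_ne_zero hz
    have h1 := (hR τ ρ z hτ hρ.1 hρδ hρ₀ hz0).2.1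
    have h2 : dTau (fun τ ρ z => ψ n τ ρ z - ψ0 n τ z) τ ρ z =
        dTau (ψ n) τ ρ z - deriv (fun t => ψ0 n t z) τ :=
      ((hsm.hasDerivAt_tau ⟨hτm, hρm, hz0⟩).fun_sub (h.hasDerivAt_lead n hτm hz0)).deriv
    rwa [h2] at h1
  · refine hb _ _ fun z hz => ?_
    have hz0 := unitFrames_ne_zero hz
    have h1 := (hR τ ρ z hτ hρ.1 hρδ hρ₀ hz0).2.2.1
    have h2 : dRho (fun τ ρ z => ψ n τ ρ z - ψ0 n τ z) τ ρ z = dRho (ψ n) τ ρ z :=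
      ((hsm.hasDerivAt_rho ⟨hτm, hρm, hz0⟩).sub_const _).deriv
    rwa [h2] at h1

theorem tendsto_modeCoeff (h : FieldExpansion ρ₀ ψ ψ0) (h0 : 0 < ρ₀) (n : Fin 5) (l : ℕ)
    (m s : ℤ) {τ : ℝ} (hτ : τ ∈ Set.Ioo (-1 : ℝ) 1) :
    Filter.Tendsto (fun ρ => modeCoeff l m s (ψ n τ ρ)) (nhdsWithin 0 (Set.Ioi 0))
      (nhds (modeCoeff l m s (ψ0 n τ))) := by
  rw [Metric.tendsto_nhds]
  intro ε hε
  filter_upwards [h.modeCoeff_uniform h0 n l m s (abs_lt.2 hτ) (half_pos hε)] with ρ hρ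
  rw [dist_eq_norm]
  exact (hρ τ le_rfl).1.trans_lt (half_lt_self hε)

theorem tendsto_modeCoeff_dTau (h : FieldExpansion ρ₀ ψ ψ0) (h0 : 0 < ρ₀) (n : Fin 5) (l : ℕ)
    (m s : ℤ) {τ : ℝ} (hτ : τ ∈ Set.Ioo (-1 : ℝ) 1) :
    Filter.Tendsto (fun ρ => modeCoeff l m s (dTau (ψ n) τ ρ)) (nhdsWithin 0 (Set.Ioi 0))
      (nhds (modeCoeff l m s (fun z => deriv (fun t => ψ0 n t z) τ))) := by
  rw [Metric.tendsto_nhds]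
  intro ε hε
  filter_upwards [h.modeCoeff_uniform h0 n l m s (abs_lt.2 hτ) (half_pos hε)] with ρ hρ
  rw [dist_eq_norm]
  exact (hρ τ le_rfl).2.1.trans_lt (half_lt_self hε)

theorem tendsto_modeCoeff_dRho (h : FieldExpansion ρ₀ ψ ψ0) (h0 : 0 < ρ₀) (n : Fin 5) (l : ℕ)
    (m s : ℤ) {τ : ℝ} (hτ : τ ∈ Set.Ioo (-1 : ℝ) 1) :
    Filter.Tendsto (fun ρ => modeCoeff l m s (dRho (ψ n) τ ρ)) (nhdsWithin 0 (Set.Ioi 0))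
      (nhds 0) := by
  rw [Metric.tendsto_nhds]
  intro ε hε
  filter_upwards [h.modeCoeff_uniform h0 n l m s (abs_lt.2 hτ) (half_pos hε)] with ρ hρ
  rw [dist_zero_right]
  exact (hρ τ le_rfl).2.2.trans_lt (half_lt_self hε)

end FieldExpansion

theorem tendsto_ofReal_nhdsGT_zero :
    Filter.Tendsto (fun ρ : ℝ => (ρ : ℂ)) (nhdsWithin 0 (Set.Ioi 0)) (nhds 0) := by
  have := (Complex.continuous_ofReal.tendsto 0).mono_left
    (nhdsWithin_le_nhds (s := Set.Ioi (0 : ℝ)))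
  simpa using this

theorem eq_zero_of_tendsto_of_eq_zero {ρ₀ : ℝ} (h0 : 0 < ρ₀) {X : ℝ → ℂ} {L : ℂ}
    (hX : Filter.Tendsto X (nhdsWithin 0 (Set.Ioi 0)) (nhds L))
    (h : ∀ ρ ∈ Set.Ioo 0 ρ₀, X ρ = 0) : L = 0 := by
  refine tendsto_nhds_unique hX (tendsto_const_nhds.congr' ?_)
  filter_upwards [Ioo_mem_nhdsGT h0] with ρ hρ
  exact (h ρ hρ).symm

theorem ethFactor_zero_sq (l : ℕ) : (ethFactor l 0 : ℂ) ^ 2 = (l : ℂ) * (l + 1) := by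
  have : ethFactor l 0 ^ 2 = (l : ℝ) * (l + 1) := by
    rw [ethFactor, Real.sq_sqrt] <;> push_cast
    · ring
    · have : (0 : ℝ) ≤ l := Nat.cast_nonneg l
      nlinarith
  exact_mod_cast this

theorem ethFactor_neg_one (l : ℕ) : ethFactor l (-1) = ethFactor l 0 := by
  simpa using ethFactor_neg l 0

namespace FieldExpansion

variable {ρ₀ : ℝ} {ψ : Fin 5 → SpacetimeField} {ψ0 : Fin 5 → ℝ → ℂ × ℂ → ℂ}

/-- The initial velocity of the middle component, from the evolution equations on the slice. -/
theorem deriv_middle_initial (h : FieldExpansion ρ₀ ψ ψ0) (h0 : 0 < ρ₀)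
    (hev : EvolutionOnSlice ρ₀ ψ) (l : ℕ) (m : ℤ) :
    modeCoeff l m 0 (fun z => deriv (fun t => ψ0 2 t z) 0) =
      (1 / 2) * (ethFactor l 0 : ℂ) *
        (modeCoeff l m 1 (ψ0 1 0) - modeCoeff l m (-1) (ψ0 3 0)) := by
  have hτ : (0 : ℝ) ∈ Set.Ioo (-1 : ℝ) 1 := by norm_num
  have w1 : weight 1 = 1 := rfl
  have w3 : weight 3 = -1 := rfl
  have hX := ((h.tendsto_modeCoeff_dTau h0 2 l m 0 hτ).sub
    ((h.tendsto_modeCoeff h0 1 l m 1 hτ).const_mul ((1 / 2) * (ethFactor l 0 : ℂ)))).add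
    ((h.tendsto_modeCoeff h0 3 l m (-1) hτ).const_mul ((1 / 2) * (ethFactor l 0 : ℂ)))
  have := eq_zero_of_tendsto_of_eq_zero h0 hX fun ρ hρ => ?_
  · linear_combination this
  · have e1 := h.modeCoeff_ethBar 1 hτ hρ l m 0 rfl
    have e3 := h.modeCoeff_eth 3 hτ hρ l m 0 rfl
    rw [w1] at e1
    rw [w3, zero_sub, ethFactor_neg_one] at e3
    have hs := modeCoeff_sum_eq_zero (l := l) (m := m) (s := 0)
      ![1, -(1 / 2), -(1 / 2)] ![dTau (ψ 2) 0 ρ, ethBar (ψ 1 0 ρ), eth (ψ 3 0 ρ)] (by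
        have d2 := ((h.cylSmooth 2).dTau.sphere hτ hρ).continuousOn
        have d1 := ((h.cylSmooth 1).contDiffOn_ethBar hτ hρ).continuousOn
        have d3 := ((h.cylSmooth 3).contDiffOn_eth hτ hρ).continuousOn
        intro i
        fin_cases i
        exacts [d2, d1, d3])
      (fun z hz => by
        have := (hev ρ hρ z hz).2.2.1
        simp only [ethBarF, ethF] at this
        simp only [Fin.sum_univ_three, Matrix.cons_val]
        linear_combination this)
    simp only [Fin.sum_univ_three, Matrix.cons_val] at hs
    rw [e1, e3] at hs
    linear_combination hs

end FieldExpansion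

/-! ### The Legendre equation for the modes of the middle component -/

/-- Differentiation under the integral sign over a compact interval. -/
theorem hasDerivAt_intervalIntegral_param {V U : Set ℝ} (hU : IsOpen U)
    {F F' : ℝ → ℝ → ℂ} {t : ℝ} (ht : Set.uIcc 0 t ⊆ V)
    (hF : ContinuousOn (fun p : ℝ × ℝ => F p.1 p.2) (V ×ˢ U))
    (hF' : ContinuousOn (fun p : ℝ × ℝ => F' p.1 p.2) (V ×ˢ U))
    (hd : ∀ τ ∈ V, ∀ ρ ∈ U, HasDerivAt (fun r => F τ r) (F' τ ρ) ρ) {ρ : ℝ} (hρ : ρ ∈ U) :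
    HasDerivAt (fun r => ∫ τ in (0 : ℝ)..t, F τ r) (∫ τ in (0 : ℝ)..t, F' τ ρ) ρ := by
  -- A closed ball makes the product with the interval compact, so the derivative has a constant
  -- dominating bound.
  obtain ⟨δ, hδ, hball⟩ := Metric.nhds_basis_closedBall.mem_iff.1 (hU.mem_nhds hρ)
  have hcpt : IsCompact (Set.uIcc 0 t ×ˢ Metric.closedBall ρ δ) :=
    isCompact_uIcc.prod (isCompact_closedBall ρ δ)
  obtain ⟨B, hB⟩ := hcpt.exists_bound_of_continuousOn (hF'.mono (Set.prod_mono ht hball))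
  have hsl : ∀ {G : ℝ → ℝ → ℂ}, ContinuousOn (fun p : ℝ × ℝ => G p.1 p.2) (V ×ˢ U) →
      ∀ r ∈ U, ContinuousOn (fun τ => G τ r) (Set.uIcc 0 t) := fun hG r hr =>
    hG.comp (f := fun τ : ℝ => (τ, r)) (by fun_prop) fun τ hτ => ⟨ht hτ, hr⟩
  refine (intervalIntegral.hasDerivAt_integral_of_dominated_loc_of_deriv_le
    (F := fun r τ => F τ r) (F' := fun r τ => F' τ r) (bound := fun _ => B)
    (Metric.closedBall_mem_nhds ρ hδ) ?_ (hsl hF ρ hρ).intervalIntegrable ?_ ?_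
    intervalIntegrable_const ?_).2
  · filter_upwards [hU.mem_nhds hρ] with r hr
    exact ((hsl hF r hr).mono Set.uIoc_subset_uIcc).aestronglyMeasurable measurableSet_uIoc
  · exact ((hsl hF' ρ hρ).mono Set.uIoc_subset_uIcc).aestronglyMeasurable measurableSet_uIoc
  · exact Filter.Eventually.of_forall fun τ hτ r hr =>
      hB (τ, r) ⟨Set.uIoc_subset_uIcc hτ, hr⟩
  · exact Filter.Eventually.of_forall fun τ hτ r hr =>
      hd τ (ht (Set.uIoc_subset_uIcc hτ)) r (hball hr)

/-- Convergence of integrals over a compact interval under uniform convergence. -/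
theorem tendsto_intervalIntegral_of_uniform {F : ℝ → ℝ → ℂ} {G : ℝ → ℂ} {t : ℝ} {𝓕 : Filter ℝ}
    (hF : ∀ᶠ ρ in 𝓕, ContinuousOn (fun τ => F τ ρ) (Set.uIcc 0 t))
    (hG : ContinuousOn G (Set.uIcc 0 t))
    (h : ∀ ε > 0, ∀ᶠ ρ in 𝓕, ∀ τ ∈ Set.uIcc 0 t, ‖F τ ρ - G τ‖ ≤ ε) :
    Filter.Tendsto (fun ρ => ∫ τ in (0 : ℝ)..t, F τ ρ) 𝓕 (nhds (∫ τ in (0 : ℝ)..t, G τ)) := by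
  rw [Metric.tendsto_nhds]
  intro ε hε
  filter_upwards [hF, h (ε / (2 * (|t| + 1))) (by positivity)] with ρ h1 h2
  rw [dist_eq_norm, ← intervalIntegral.integral_sub h1.intervalIntegrable hG.intervalIntegrable]
  refine (intervalIntegral.norm_integral_le_of_norm_le_const fun τ hτ =>
    h2 τ (Set.uIoc_subset_uIcc hτ)).trans_lt ?_
  rw [sub_zero, div_mul_eq_mul_div, div_lt_iff₀ (by positivity)]
  nlinarith [abs_nonneg t]

namespace FieldExpansion

variable {ρ₀ : ℝ} {ψ : Fin 5 → SpacetimeField} {ψ0 : Fin 5 → ℝ → ℂ × ℂ → ℂ}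

/-- Suitable combinations of evolution and constraint equations eliminate ψ₀ and ψ₃. In the limit
the modes of ψ₁ and ψ₂ then form a closed first-order system. -/
theorem legendre_of_spin2Field (h : FieldExpansion ρ₀ ψ ψ0) (h0 : 0 < ρ₀)
    (hψ : IsSpin2Field ρ₀ ψ) (l : ℕ) (m : ℤ) :
    ∃ p, LegendreSystem l (fun τ => modeCoeff l m 0 (ψ0 2 τ)) p := by
  set e : ℂ := (ethFactor l 0 : ℂ) with he
  have w1 : weight 1 = 1 := rfl
  have w2 : weight 2 = 0 := rfl
  -- The evolution equation of ψ₂ minus its constraint cancels `ð`ψ₃; the term ρ∂_ρψ₂ vanishes in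
  -- the limit.
  have first : ∀ τ ∈ Set.Ioo (-1 : ℝ) 1,
      (1 - (τ : ℂ)) * modeCoeff l m 0 (fun z => deriv (fun t => ψ0 2 t z) τ)
        = e * modeCoeff l m 1 (ψ0 1 τ) := by
    intro τ hτ
    have hX := (((h.tendsto_modeCoeff_dTau h0 2 l m 0 hτ).const_mul (1 - (τ : ℂ))).add
      (tendsto_ofReal_nhdsGT_zero.mul (h.tendsto_modeCoeff_dRho h0 2 l m 0 hτ))).sub
      ((h.tendsto_modeCoeff h0 1 l m 1 hτ).const_mul e)
    have := eq_zero_of_tendsto_of_eq_zero h0 hX fun ρ hρ => ?_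
    · linear_combination this
    · have e1 := h.modeCoeff_ethBar 1 hτ hρ l m 0 rfl
      rw [w1] at e1
      have hs := modeCoeff_sum_eq_zero (l := l) (m := m) (s := 0)
        ![1 - (τ : ℂ), (ρ : ℂ), -1] ![dTau (ψ 2) τ ρ, dRho (ψ 2) τ ρ, ethBar (ψ 1 τ ρ)] (by
          have d1 := ((h.cylSmooth 2).dTau.sphere hτ hρ).continuousOn
          have d2 := ((h.cylSmooth 2).dRho.sphere hτ hρ).continuousOn
          have d3 := ((h.cylSmooth 1).contDiffOn_ethBar hτ hρ).continuousOn
          intro i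
          fin_cases i
          exacts [d1, d2, d3])
        (fun z hz => by
          obtain ⟨⟨-, -, ev, -, -⟩, -, con, -⟩ := hψ τ hτ ρ hρ z hz
          simp only [ethBarF, ethF] at ev con
          simp only [Fin.sum_univ_three, Matrix.cons_val]
          linear_combination ev - con)
      simp only [Fin.sum_univ_three, Matrix.cons_val] at hs
      rw [e1] at hs
      linear_combination hs
  -- The evolution equation of ψ₁ plus half its constraint cancels `ð̄`ψ₀ and makes the coefficient
  -- of the τ-derivative 1 + τ.
  have second : ∀ τ ∈ Set.Ioo (-1 : ℝ) 1,
      (1 + (τ : ℂ)) * modeCoeff l m 1 (fun z => deriv (fun t => ψ0 1 t z) τ)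
        + e * modeCoeff l m 0 (ψ0 2 τ) + modeCoeff l m 1 (ψ0 1 τ) = 0 := by
    intro τ hτ
    have hX := ((((h.tendsto_modeCoeff_dTau h0 1 l m 1 hτ).const_mul (1 + (τ : ℂ))).sub
      (tendsto_ofReal_nhdsGT_zero.mul (h.tendsto_modeCoeff_dRho h0 1 l m 1 hτ))).add
      ((h.tendsto_modeCoeff h0 2 l m 0 hτ).const_mul e)).add (h.tendsto_modeCoeff h0 1 l m 1 hτ)
    have := eq_zero_of_tendsto_of_eq_zero h0 hX fun ρ hρ => ?_
    · linear_combination this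
    · have e1 := h.modeCoeff_eth 2 hτ hρ l m 1 rfl
      rw [w2, sub_self] at e1
      have hs := modeCoeff_sum_eq_zero (l := l) (m := m) (s := 1)
        ![1 + (τ : ℂ), -(ρ : ℂ), -1, 1]
        ![dTau (ψ 1) τ ρ, dRho (ψ 1) τ ρ, eth (ψ 2 τ ρ), ψ 1 τ ρ] (by
          have d1 := ((h.cylSmooth 1).dTau.sphere hτ hρ).continuousOn
          have d2 := ((h.cylSmooth 1).dRho.sphere hτ hρ).continuousOn
          have d3 := ((h.cylSmooth 2).contDiffOn_eth hτ hρ).continuousOn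
          have d4 := ((h.cylSmooth 1).sphere hτ hρ).continuousOn
          intro i
          fin_cases i
          exacts [d1, d2, d3, d4])
        (fun z hz => by
          obtain ⟨⟨-, ev, -, -, -⟩, con, -, -⟩ := hψ τ hτ ρ hρ z hz
          simp only [ethBarF, ethF] at ev con
          simp only [Fin.sum_univ_four, Matrix.cons_val]
          linear_combination ev + con / 2)
      simp only [Fin.sum_univ_four, Matrix.cons_val] at hs
      rw [e1] at hs
      linear_combination hs
  -- By `first`, (1 - τ²)a₂' = e(1 + τ)a₁, which dictates p; by `second`, its derivative is -e²a₂
  -- with e² = l(l + 1).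
  refine ⟨fun τ => e * ((1 + (τ : ℂ)) * modeCoeff l m 1 (ψ0 1 τ)), fun τ hτ => ⟨?_, ?_⟩⟩
  · refine (h.hasDerivAt_modeCoeff_lead 2 l m 0 hτ).congr_deriv ?_
    rw [eq_div_iff (one_sub_sq_ne_zero hτ)]
    linear_combination (1 + (τ : ℂ)) * first τ hτ
  · have h1 : HasDerivAt (fun t : ℝ => 1 + (t : ℂ)) 1 τ :=
      (Complex.ofRealCLM.hasDerivAt (x := τ)).const_add 1
    refine ((h1.fun_mul (h.hasDerivAt_modeCoeff_lead 1 l m 1 hτ)).const_mul e).congr_deriv ?_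
    linear_combination e * second τ hτ - modeCoeff l m 0 (ψ0 2 τ) * ethFactor_zero_sq l

/-- The wave equation projected on a mode of the middle component. -/
theorem wave_mode (h : FieldExpansion ρ₀ ψ ψ0) (hψ : IsSpin2Wave ρ₀ ψ) (l : ℕ) (m : ℤ)
    {τ ρ : ℝ} (hτ : τ ∈ Set.Ioo (-1 : ℝ) 1) (hρ : ρ ∈ Set.Ioo 0 ρ₀) :
    (1 - (τ : ℂ) ^ 2) * modeCoeff l m 0 (dTau (dTau (ψ 2)) τ ρ)
      + 2 * ρ * τ * modeCoeff l m 0 (dRho (dTau (ψ 2)) τ ρ)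
      - (ρ : ℂ) ^ 2 * modeCoeff l m 0 (dRho (dRho (ψ 2)) τ ρ)
      + (l : ℂ) * (l + 1) * modeCoeff l m 0 (ψ 2 τ ρ)
      - 2 * τ * modeCoeff l m 0 (dTau (ψ 2) τ ρ) = 0 := by
  have hsm := h.cylSmooth 2
  have w2 : weight 2 = 0 := rfl
  have hw := h.phaseWeight 2 hτ hρ
  have hd : ∀ z ≠ 0, DifferentiableAt ℝ (ψ 2 τ ρ) z := fun z hz =>
    ((hsm.sphere hτ hρ).differentiableOn (by norm_num)).differentiableAt
      (isOpen_compl_singleton.mem_nhds hz)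
  have b1 := h.modeCoeff_ethBar 2 hτ hρ l m (-1) rfl
  have b2 := h.modeCoeff_eth 2 hτ hρ l m 1 rfl
  rw [w2, ethFactor_neg_one] at b1
  rw [w2, sub_self] at b2
  have c1 := hsm.contDiffOn_ethBar hτ hρ
  have c2 := hsm.contDiffOn_eth hτ hρ
  have k1 : modeCoeff l m 0 (eth (ethBar (ψ 2 τ ρ))) =
      -((l : ℂ) * (l + 1)) * modeCoeff l m 0 (ψ 2 τ ρ) := by
    have h1 := _root_.modeCoeff_eth (l := l) (m := m) c1 (hw.ethBar hd)
    rw [w2, zero_sub, neg_add_cancel, ethFactor_neg_one, b1] at h1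
    rw [h1, ← ethFactor_zero_sq]
    ring
  have k2 : modeCoeff l m 0 (ethBar (eth (ψ 2 τ ρ))) =
      -((l : ℂ) * (l + 1)) * modeCoeff l m 0 (ψ 2 τ ρ) := by
    have h1 := _root_.modeCoeff_ethBar (l := l) (m := m) c2 (hw.eth hd)
    rw [w2, zero_add, sub_self, b2] at h1
    rw [h1, ← ethFactor_zero_sq]
    ring
  have hs := modeCoeff_sum_eq_zero (l := l) (m := m) (s := 0)
    ![1 - (τ : ℂ) ^ 2, 2 * ρ * τ, -(ρ : ℂ) ^ 2, -(1 / 2), -(1 / 2), -(2 * τ)]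
    ![dTau (dTau (ψ 2)) τ ρ, dRho (dTau (ψ 2)) τ ρ, dRho (dRho (ψ 2)) τ ρ,
      eth (ethBar (ψ 2 τ ρ)), ethBar (eth (ψ 2 τ ρ)), dTau (ψ 2) τ ρ] (by
        have d1 := (hsm.dTau.dTau.sphere hτ hρ).continuousOn
        have d2 := (hsm.dTau.dRho.sphere hτ hρ).continuousOn
        have d3 := (hsm.dRho.dRho.sphere hτ hρ).continuousOn
        have hfd : ∀ {κ : ℂ} {g : ℂ × ℂ → ℂ}, ContDiffOn ℝ 1 g {0}ᶜ →
            ContinuousOn (frameDeriv κ g) {0}ᶜ := by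
          intro κ g hg
          have h1 := hg.continuousOn_fderiv_of_isOpen isOpen_compl_singleton (by norm_num)
          have h2 := contDiff_frameDir.continuous.continuousOn (s := {0}ᶜ)
          exact continuousOn_const.mul ((h1.clm_apply h2).add
            (continuousOn_const.mul (h1.clm_apply (h2.fun_const_smul _))))
        have d4 : ContinuousOn (eth (ethBar (ψ 2 τ ρ))) {0}ᶜ := hfd c1
        have d5 : ContinuousOn (ethBar (eth (ψ 2 τ ρ))) {0}ᶜ := by
          rw [ethBar_eq_frameDeriv]
          exact hfd c2
        have d6 := (hsm.dTau.sphere hτ hρ).continuousOn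
        intro i
        fin_cases i
        exacts [d1, d2, d3, d4, d5, d6])
    (fun z hz => by
      have := hψ 2 τ hτ ρ hρ z hz
      simp only [w2, ethF, ethBarF, Int.cast_zero] at this
      simp only [Fin.sum_univ_six, Matrix.cons_val]
      linear_combination this)
  simp only [Fin.sum_univ_six, Matrix.cons_val] at hs
  rw [k1, k2] at hs
  linear_combination hs

/-- The wave equation for a mode, integrated in `τ`. -/
theorem wave_mode_integrated (h : FieldExpansion ρ₀ ψ ψ0) (hψ : IsSpin2Wave ρ₀ ψ) (l : ℕ)
    (m : ℤ) {t ρ : ℝ} (ht : t ∈ Set.Ioo (-1 : ℝ) 1) (hρ : ρ ∈ Set.Ioo 0 ρ₀) :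
    (1 - (t : ℂ) ^ 2) * modeCoeff l m 0 (dTau (ψ 2) t ρ) - modeCoeff l m 0 (dTau (ψ 2) 0 ρ)
      + ρ * (2 * t * modeCoeff l m 0 (dRho (ψ 2) t ρ)
        - 2 * ∫ τ in (0 : ℝ)..t, modeCoeff l m 0 (dRho (ψ 2) τ ρ))
      + (l : ℂ) * (l + 1) * ∫ τ in (0 : ℝ)..t, modeCoeff l m 0 (ψ 2 τ ρ)
      = (ρ : ℂ) ^ 2 * ∫ τ in (0 : ℝ)..t, modeCoeff l m 0 (dRho (dRho (ψ 2)) τ ρ) := by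
  have hsm := h.cylSmooth 2
  have hsub : Set.uIcc 0 t ⊆ Set.Ioo (-1 : ℝ) 1 :=
    Set.OrdConnected.uIcc_subset Set.ordConnected_Ioo (by norm_num) ht
  have hcont : ∀ {k : ℕ} {f : SpacetimeField}, CylSmooth ρ₀ k f → ∀ r ∈ Set.Ioo 0 ρ₀,
      ContinuousOn (fun τ => modeCoeff l m 0 (f τ r)) (Set.uIcc 0 t) := fun hf r hr =>
    (hf.continuousOn_modeCoeff l m 0).comp (f := fun τ : ℝ => (τ, r)) (by fun_prop)
      fun τ hτ => ⟨hsub hτ, hr⟩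
  have cτ : Continuous (fun τ : ℝ => (2 : ℂ) * (τ : ℂ)) := by fun_prop
  have cq : Continuous (fun τ : ℝ => (1 : ℂ) - (τ : ℂ) ^ 2) := by fun_prop
  -- the second time derivative
  have i1 : (∫ τ in (0 : ℝ)..t, ((1 - (τ : ℂ) ^ 2) * modeCoeff l m 0 (dTau (dTau (ψ 2)) τ ρ)
      - 2 * τ * modeCoeff l m 0 (dTau (ψ 2) τ ρ))) =
      (1 - (t : ℂ) ^ 2) * modeCoeff l m 0 (dTau (ψ 2) t ρ)
        - modeCoeff l m 0 (dTau (ψ 2) 0 ρ) := by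
    rw [intervalIntegral.integral_eq_sub_of_hasDerivAt
      (f := fun τ : ℝ => (1 - (τ : ℂ) ^ 2) * modeCoeff l m 0 (dTau (ψ 2) τ ρ))]
    · simp
    · intro τ hτ
      have hq : HasDerivAt (fun t : ℝ => 1 - (t : ℂ) ^ 2) (-(2 * (τ : ℂ))) τ := by
        simpa using ((Complex.ofRealCLM.hasDerivAt (x := τ)).fun_pow 2).const_sub 1
      refine (hq.fun_mul (hsm.dTau.hasDerivAt_modeCoeff_tau l m 0 (hsub hτ) hρ)).congr_deriv ?_
      ring
    · exact ((cq.continuousOn.mul (hcont hsm.dTau.dTau ρ hρ)).sub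
        (cτ.continuousOn.mul (hcont hsm.dTau ρ hρ))).intervalIntegrable
  -- the mixed derivative
  have i2 : (∫ τ in (0 : ℝ)..t, 2 * τ * modeCoeff l m 0 (dRho (dTau (ψ 2)) τ ρ)) =
      2 * t * modeCoeff l m 0 (dRho (ψ 2) t ρ)
        - 2 * ∫ τ in (0 : ℝ)..t, modeCoeff l m 0 (dRho (ψ 2) τ ρ) := by
    have cτ2 : Continuous (fun p : ℝ × ℝ => (2 : ℂ) * (p.1 : ℂ)) := by fun_prop
    -- Pulling ∂_ρ out of the integral before integrating by parts in τ leaves only ∂_ρψ₂, whose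
    -- modes tend to zero locally uniformly in τ.
    have d1 := hasDerivAt_intervalIntegral_param isOpen_Ioo hsub
      (F := fun τ r => 2 * τ * modeCoeff l m 0 (dTau (ψ 2) τ r))
      (F' := fun τ r => 2 * τ * modeCoeff l m 0 (dRho (dTau (ψ 2)) τ r))
      (cτ2.continuousOn.mul (hsm.dTau.continuousOn_modeCoeff l m 0))
      (cτ2.continuousOn.mul (hsm.dTau.dRho.continuousOn_modeCoeff l m 0))
      (fun τ hτ r hr => (hsm.dTau.hasDerivAt_modeCoeff_rho l m 0 hτ hr).const_mul _) hρ
    have d2 := hasDerivAt_intervalIntegral_param isOpen_Ioo hsub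
      (F := fun τ r => modeCoeff l m 0 (ψ 2 τ r))
      (F' := fun τ r => modeCoeff l m 0 (dRho (ψ 2) τ r))
      (hsm.continuousOn_modeCoeff l m 0) (hsm.dRho.continuousOn_modeCoeff l m 0)
      (fun τ hτ r hr => hsm.hasDerivAt_modeCoeff_rho l m 0 hτ hr) hρ
    have d3 := ((hsm.hasDerivAt_modeCoeff_rho l m 0 ht hρ).const_mul (2 * (t : ℂ))).fun_sub
      (d2.const_mul 2)
    refine d1.unique (d3.congr_of_eventuallyEq ?_)
    filter_upwards [isOpen_Ioo.mem_nhds hρ] with r hr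
    have ibp := intervalIntegral.integral_mul_deriv_eq_deriv_mul (a := 0) (b := t)
      (u := fun τ : ℝ => 2 * (τ : ℂ)) (u' := fun _ => 2)
      (v := fun τ => modeCoeff l m 0 (ψ 2 τ r)) (v' := fun τ => modeCoeff l m 0 (dTau (ψ 2) τ r))
      (fun τ _ => by
        simpa using (Complex.ofRealCLM.hasDerivAt (x := τ)).const_mul (2 : ℂ))
      (fun τ hτ => hsm.hasDerivAt_modeCoeff_tau l m 0 (hsub hτ) hr)
      intervalIntegrable_const (hcont hsm.dTau r hr).intervalIntegrable
    rw [ibp, intervalIntegral.integral_const_mul]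
    simp
  -- integrate the wave equation
  have c1 : ContinuousOn (fun τ : ℝ => (1 - (τ : ℂ) ^ 2) * modeCoeff l m 0 (dTau (dTau (ψ 2)) τ ρ)
      - 2 * τ * modeCoeff l m 0 (dTau (ψ 2) τ ρ)) (Set.uIcc 0 t) :=
    (cq.continuousOn.mul (hcont hsm.dTau.dTau ρ hρ)).sub
      (cτ.continuousOn.mul (hcont hsm.dTau ρ hρ))
  have c2 : ContinuousOn (fun τ : ℝ => (ρ : ℂ) * (2 * τ * modeCoeff l m 0 (dRho (dTau (ψ 2)) τ ρ)))
      (Set.uIcc 0 t) := continuousOn_const.mul (cτ.continuousOn.mul (hcont hsm.dTau.dRho ρ hρ))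
  have c3 : ContinuousOn (fun τ : ℝ => (l : ℂ) * (l + 1) * modeCoeff l m 0 (ψ 2 τ ρ))
      (Set.uIcc 0 t) := continuousOn_const.mul (hcont hsm ρ hρ)
  rw [← i1, ← i2, ← intervalIntegral.integral_const_mul, ← intervalIntegral.integral_const_mul,
    ← intervalIntegral.integral_const_mul, ← intervalIntegral.integral_add c1.intervalIntegrable
      c2.intervalIntegrable, ← intervalIntegral.integral_add
      (c1.fun_add c2).intervalIntegrable c3.intervalIntegrable]
  refine intervalIntegral.integral_congr fun τ hτ => ?_
  have := h.wave_mode hψ l m (hsub hτ) hρ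
  linear_combination this

/-- Pass to the limit in the τ-integrated equation. All terms converge pointwise except ρ² times the
integrated second ρ-derivative, which vanishes weakly. The resulting integral equation for a is then
differentiated. -/
theorem legendre_of_spin2Wave (h : FieldExpansion ρ₀ ψ ψ0) (h0 : 0 < ρ₀)
    (hψ : IsSpin2Wave ρ₀ ψ) (l : ℕ) (m : ℤ) :
    ∃ p, LegendreSystem l (fun τ => modeCoeff l m 0 (ψ0 2 τ)) p := by
  have hsm := h.cylSmooth 2
  set a : ℝ → ℂ := fun τ => modeCoeff l m 0 (ψ0 2 τ) with ha
  set a' : ℝ → ℂ := fun τ => modeCoeff l m 0 (fun z => deriv (fun t => ψ0 2 t z) τ) with ha'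
  have hda : ∀ τ ∈ Set.Ioo (-1 : ℝ) 1, HasDerivAt a (a' τ) τ := fun τ hτ =>
    h.hasDerivAt_modeCoeff_lead 2 l m 0 hτ
  have hac : ContinuousOn a (Set.Ioo (-1) 1) := fun τ hτ =>
    (hda τ hτ).continuousAt.continuousWithinAt
  have hz : (0 : ℝ) ∈ Set.Ioo (-1 : ℝ) 1 := by norm_num
  have key : ∀ t ∈ Set.Ioo (-1 : ℝ) 1, (1 - (t : ℂ) ^ 2) * a' t =
      a' 0 - (l : ℂ) * (l + 1) * ∫ τ in (0 : ℝ)..t, a τ := by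
    intro t ht
    have hsub : Set.uIcc 0 t ⊆ Set.Ioo (-1 : ℝ) 1 :=
      Set.OrdConnected.uIcc_subset Set.ordConnected_Ioo hz ht
    have hle : ∀ τ ∈ Set.uIcc 0 t, |τ| ≤ |t| := fun τ hτ => by
      have := Set.abs_sub_left_of_mem_uIcc hτ
      simpa using this
    have hcont : ∀ {k : ℕ} {f : SpacetimeField}, CylSmooth ρ₀ k f → ∀ r ∈ Set.Ioo 0 ρ₀,
        ContinuousOn (fun τ => modeCoeff l m 0 (f τ r)) (Set.uIcc 0 t) := fun hf r hr =>
      (hf.continuousOn_modeCoeff l m 0).comp (f := fun τ : ℝ => (τ, r)) (by fun_prop)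
        fun τ hτ => ⟨hsub hτ, hr⟩
    have hmem : Set.Ioo (0 : ℝ) ρ₀ ∈ nhdsWithin (0 : ℝ) (Set.Ioi 0) := Ioo_mem_nhdsGT h0
    set N : ℝ → ℂ := fun ρ => ∫ τ in (0 : ℝ)..t, modeCoeff l m 0 (ψ 2 τ ρ) with hN
    set J : ℝ → ℂ := fun ρ => ∫ τ in (0 : ℝ)..t, modeCoeff l m 0 (dRho (ψ 2) τ ρ) with hJ
    set J' : ℝ → ℂ := fun ρ => ∫ τ in (0 : ℝ)..t, modeCoeff l m 0 (dRho (dRho (ψ 2)) τ ρ) with hJ'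
    have dN : ∀ ρ ∈ Set.Ioo 0 ρ₀, HasDerivAt N (J ρ) ρ := fun ρ hρ =>
      hasDerivAt_intervalIntegral_param isOpen_Ioo hsub
        (hsm.continuousOn_modeCoeff l m 0) (hsm.dRho.continuousOn_modeCoeff l m 0)
        (fun τ hτ r hr => hsm.hasDerivAt_modeCoeff_rho l m 0 hτ hr) hρ
    have dJ : ∀ ρ ∈ Set.Ioo 0 ρ₀, HasDerivAt J (J' ρ) ρ := fun ρ hρ =>
      hasDerivAt_intervalIntegral_param isOpen_Ioo hsub
        (hsm.dRho.continuousOn_modeCoeff l m 0) (hsm.dRho.dRho.continuousOn_modeCoeff l m 0)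
        (fun τ hτ r hr => hsm.dRho.hasDerivAt_modeCoeff_rho l m 0 hτ hr) hρ
    have cN : ContinuousOn N (Set.Ioo 0 ρ₀) := fun ρ hρ =>
      (dN ρ hρ).continuousAt.continuousWithinAt
    have cJ : ContinuousOn J (Set.Ioo 0 ρ₀) := fun ρ hρ =>
      (dJ ρ hρ).continuousAt.continuousWithinAt
    have tN : Filter.Tendsto N (nhdsWithin 0 (Set.Ioi 0)) (nhds (∫ τ in (0 : ℝ)..t, a τ)) := by
      refine tendsto_intervalIntegral_of_uniform ?_ (hac.mono hsub) fun ε hε => ?_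
      · filter_upwards [hmem] with ρ hρ using hcont hsm ρ hρ
      · filter_upwards [h.modeCoeff_uniform h0 2 l m 0 (abs_lt.2 ht) hε] with ρ hρ τ hτ
        exact (hρ τ (hle τ hτ)).1
    have tJ : Filter.Tendsto J (nhdsWithin 0 (Set.Ioi 0)) (nhds 0) := by
      have : Filter.Tendsto J (nhdsWithin 0 (Set.Ioi 0))
          (nhds (∫ τ in (0 : ℝ)..t, (fun _ => (0 : ℂ)) τ)) := by
        refine tendsto_intervalIntegral_of_uniform ?_ continuousOn_const fun ε hε => ?_
        · filter_upwards [hmem] with ρ hρ using hcont hsm.dRho ρ hρ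
        · filter_upwards [h.modeCoeff_uniform h0 2 l m 0 (abs_lt.2 ht) hε] with ρ hρ τ hτ
          rw [sub_zero]
          exact (hρ τ (hle τ hτ)).2.2
      simpa using this
    set X : ℝ → ℂ := fun ρ => (1 - (t : ℂ) ^ 2) * modeCoeff l m 0 (dTau (ψ 2) t ρ)
      - modeCoeff l m 0 (dTau (ψ 2) 0 ρ)
      + ρ * (2 * t * modeCoeff l m 0 (dRho (ψ 2) t ρ) - 2 * J ρ) + (l : ℂ) * (l + 1) * N ρ with hX
    have hXJ : ∀ ρ ∈ Set.Ioo 0 ρ₀, X ρ = (ρ : ℂ) ^ 2 * J' ρ := fun ρ hρ =>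
      h.wave_mode_integrated hψ l m ht hρ
    have tX : Filter.Tendsto X (nhdsWithin 0 (Set.Ioi 0)) (nhds ((1 - (t : ℂ) ^ 2) * a' t - a' 0
        + 0 * (2 * t * 0 - 2 * 0) + (l : ℂ) * (l + 1) * ∫ τ in (0 : ℝ)..t, a τ)) :=
      ((((h.tendsto_modeCoeff_dTau h0 2 l m 0 ht).const_mul _).sub
        (h.tendsto_modeCoeff_dTau h0 2 l m 0 hz)).add (tendsto_ofReal_nhdsGT_zero.mul
        (((h.tendsto_modeCoeff_dRho h0 2 l m 0 ht).const_mul _).sub (tJ.const_mul 2)))).add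
        (tN.const_mul _)
    have cr : ContinuousOn (fun ρ : ℝ => (ρ : ℂ)) (Set.Ioo 0 ρ₀) :=
      Complex.continuous_ofReal.continuousOn
    have cX : ContinuousOn X (Set.Ioo 0 ρ₀) := by
      have s1 : ∀ {k : ℕ} {f : SpacetimeField}, CylSmooth ρ₀ k f → ∀ t ∈ Set.Ioo (-1 : ℝ) 1,
          ContinuousOn (fun ρ => modeCoeff l m 0 (f t ρ)) (Set.Ioo 0 ρ₀) := fun hf t ht =>
        (hf.continuousOn_modeCoeff l m 0).comp (f := fun ρ : ℝ => (t, ρ)) (by fun_prop)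
          fun ρ hρ => ⟨ht, hρ⟩
      exact (((continuousOn_const.mul (s1 hsm.dTau t ht)).sub (s1 hsm.dTau 0 hz)).add
        (cr.mul ((continuousOn_const.mul (s1 hsm.dRho t ht)).sub
          (continuousOn_const.mul cJ)))).add (continuousOn_const.mul cN)
    -- Continuity of J' is read off the equation itself: J' = X/ρ².
    have cJ' : ContinuousOn J' (Set.Ioo 0 ρ₀) := by
      have hne : ∀ ρ ∈ Set.Ioo 0 ρ₀, (ρ : ℂ) ≠ 0 := fun ρ hρ => by exact_mod_cast hρ.1.ne'
      have hdiv : ContinuousOn (fun ρ : ℝ => X ρ / (ρ : ℂ) ^ 2) (Set.Ioo 0 ρ₀) :=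
        cX.div (cr.pow 2) fun ρ hρ => pow_ne_zero 2 (hne ρ hρ)
      refine hdiv.congr fun ρ hρ => ?_
      have := hne ρ hρ
      simp only [hXJ ρ hρ]
      field_simp
    have wX := WeakLim.of_tendsto h0 cX tX
    have tρJ : Filter.Tendsto (fun ρ : ℝ => (ρ : ℂ) * J ρ) (nhdsWithin 0 (Set.Ioi 0))
        (nhds 0) := by
      simpa using tendsto_ofReal_nhdsGT_zero.mul tJ
    have cρJ : ContinuousOn (fun ρ : ℝ => (ρ : ℂ) * J ρ) (Set.Ioo 0 ρ₀) := cr.mul cJ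
    have wρJ := WeakLim.of_tendsto h0 cρJ tρJ
    have cd : ContinuousOn (fun ρ : ℝ => J ρ + ρ * J' ρ) (Set.Ioo 0 ρ₀) := cJ.add (cr.mul cJ')
    -- The identity ρ²J' = ρ(ρJ)' - ρJ reduces the uncontrolled term to ρJ → 0 and an Euler
    -- derivative of it, both weakly null.
    have wE := wρJ.euler h0 (f' := fun ρ => J ρ + ρ * J' ρ) (fun ρ hρ => by
      refine ((Complex.ofRealCLM.hasDerivAt (x := ρ)).fun_mul (dJ ρ hρ)).congr_deriv ?_
      simp) cd
    have wsum := wE.add h0 (cr.fun_mul cd) (continuousOn_const.fun_mul cρJ) (wρJ.const_mul (-1))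
    have wX' := wsum.congr (g := X) h0 fun ρ hρ => by
      rw [hXJ ρ hρ]
      ring
    linear_combination wX.unique wX'
  refine ⟨fun t => (1 - (t : ℂ) ^ 2) * a' t, fun t ht => ⟨?_, ?_⟩⟩
  · refine (hda t ht).congr_deriv ?_
    have := one_sub_sq_ne_zero ht
    field_simp
  · have hsub : Set.uIcc 0 t ⊆ Set.Ioo (-1 : ℝ) 1 :=
      Set.OrdConnected.uIcc_subset Set.ordConnected_Ioo hz ht
    have hint : HasDerivAt (fun t => ∫ τ in (0 : ℝ)..t, a τ) (a t) t :=
      intervalIntegral.integral_hasDerivAt_right (hac.mono hsub).intervalIntegrable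
        (hac.stronglyMeasurableAtFilter isOpen_Ioo t ht) (hda t ht).continuousAt
    have h1 := (hint.const_mul ((l : ℂ) * (l + 1))).const_sub (a' 0)
    refine (h1.congr_of_eventuallyEq ?_).congr_deriv (by ring)
    filter_upwards [isOpen_Ioo.mem_nhds ht] with s hs
    exact key s hs

end FieldExpansion

/-! ### Initial data from the potential -/

/-- The modes of `𝒢₄ Ψ` at `ρ = 0`, in terms of those of the leading term of `Ψ`. -/
theorem PotentialExpansion.spinor4Lim {ρ₀ : ℝ} {Ψ : Fin 5 → SliceField} {Ψ0 : Fin 5 → ℂ × ℂ → ℂ}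
    (h : PotentialExpansion ρ₀ Ψ Ψ0) (h0 : 0 < ρ₀) (l : ℕ) (m : ℤ) :
    Spinor4Lim ρ₀ l m 3 (ofComponents Ψ)
      (limitOfComponents fun n => modeCoeff l m (weight n) (Ψ0 n)) := by
  have key : ∀ n : Fin 5, ModeLim ρ₀ l m 3 (weight n) (Ψ n)
      (modeCoeff l m (weight n) (Ψ0 n)) := by
    intro n
    have hreg : SliceRegular ρ₀ 3 (weight n) (Ψ n) :=
      ⟨h.contDiffOn n, fun ρ hρ => (h.spinWeight n ρ hρ).phaseWeight⟩
    refine ⟨hreg, WeakLim.of_tendsto h0 (hreg.continuousOn_modeCoeff l m _) ?_⟩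
    obtain ⟨K, hK, hb⟩ := exists_norm_modeCoeff_le l m (weight n)
    rw [Metric.tendsto_nhds]
    intro ε hε
    obtain ⟨δ, hδ, hR⟩ := h.remainder n (ε / (2 * K)) (by positivity)
    have hmem : Set.Ioo (0 : ℝ) (min (min δ ρ₀) 1) ∈ nhdsWithin (0 : ℝ) (Set.Ioi 0) :=
      Ioo_mem_nhdsGT (lt_min (lt_min hδ h0) one_pos)
    filter_upwards [hmem] with ρ hρ
    have hρδ : ρ < δ := hρ.2.trans_le ((min_le_left _ _).trans (min_le_left _ _))
    have hρ₀ : ρ < ρ₀ := hρ.2.trans_le ((min_le_left _ _).trans (min_le_right _ _))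
    have hρ1 : ρ < 1 := hρ.2.trans_le (min_le_right _ _)
    rw [dist_eq_norm, ← modeCoeff_sub (hreg.slice ⟨hρ.1, hρ₀⟩).continuousOn (h.continuousOn_lead n)]
    refine (hb _ (ε / (2 * K)) fun z hz => ?_).trans_lt ?_
    · refine (hR ρ z hρ.1 hρδ hρ₀ (unitFrames_ne_zero hz)).trans ?_
      exact mul_le_of_le_one_right (by positivity) hρ1.le
    · rw [mul_div_assoc', div_lt_iff₀ (by positivity)]
      nlinarith
  intro A B C D
  exact (key ⟨A.val + B.val + C.val + D.val, by omega⟩).cast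
    (by simp only [weight]; push_cast; ring) rfl

/-- On the slice the same function of ρ has a genuine limit from the expansion of ψ and a weak limit
computed from the potential; uniqueness of weak limits identifies them. -/
theorem modeCoeff_initial_eq {ρ₀ : ℝ} {ψ : Fin 5 → SpacetimeField}
    {ψ0 : Fin 5 → ℝ → ℂ × ℂ → ℂ} {Ψ : Fin 5 → SliceField} {Ψ0 : Fin 5 → ℂ × ℂ → ℂ} (h0 : 0 < ρ₀)
    (hψ : FieldExpansion ρ₀ ψ ψ0) (hΨ : PotentialExpansion ρ₀ Ψ Ψ0) (n : Fin 5)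
    {A B C D : Fin 2} {s : ℤ}
    (hs : s = 2 - (A.val : ℤ) - (B.val : ℤ) - (C.val : ℤ) - (D.val : ℤ))
    (heq : ∀ ρ ∈ Set.Ioo 0 ρ₀, ∀ z : ℂ × ℂ, z ≠ 0 →
      ψ n 0 ρ z = hertzG (ofComponents Ψ) A B C D ρ z) (l : ℕ) (m : ℤ) :
    modeCoeff l m s (ψ0 n 0) = limitHertz l
      (limitOfComponents fun n => modeCoeff l m (weight n) (Ψ0 n)) A B C D := by
  have hτ : (0 : ℝ) ∈ Set.Ioo (-1 : ℝ) 1 := by norm_num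
  have w1 := ((hΨ.spinor4Lim h0 l m).hertz h0 A B C D).weakLim
  rw [← hs] at w1
  have c2 : ContinuousOn (fun ρ => modeCoeff l m s (ψ n 0 ρ)) (Set.Ioo 0 ρ₀) :=
    continuousOn_modeCoeff (f := ψ n 0) isOpen_Ioo ((hψ.cylSmooth n).slice hτ).continuousOn
  have w2 := WeakLim.of_tendsto h0 c2 (hψ.tendsto_modeCoeff h0 n l m s hτ)
  refine w2.unique (w1.congr h0 fun ρ hρ => ?_)
  exact modeCoeff_congr fun z hz => (heq ρ hρ z (unitFrames_ne_zero hz)).symm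

/-! ### Nonvanishing of the prefactors and the main theorem. -/

theorem modeCoeff_of_le {l : ℕ} {s : ℤ} (m : ℤ) (hs : |s| ≤ l) (f : ℂ × ℂ → ℂ) :
    modeCoeff l m s f = harmonicCoeff s l m f := if_pos hs

theorem ethFactor_zero_ne_zero {l : ℕ} (hl : 1 ≤ l) : (ethFactor l 0 : ℂ) ≠ 0 := by
  intro h
  have h1 := ethFactor_zero_sq l
  rw [h] at h1
  have h2 : (l : ℂ) ≠ 0 := by exact_mod_cast (by omega : l ≠ 0)
  have h3 : (l : ℂ) + 1 ≠ 0 := by exact_mod_cast (by omega : l + 1 ≠ 0)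
  refine mul_ne_zero h2 h3 ?_
  rw [← h1]
  ring

theorem three_mul_ethFactor_sq_add_ne_zero {l : ℕ} (hl : 1 ≤ l) {x y : ℝ} (hx : 0 < x)
    (hy : 0 < y) :
    (x : ℂ) * (ethFactor l 0 : ℂ) ^ 2 + y * (ethFactor l 1 : ℂ) ^ 2 ≠ 0 := by
  have h : ethFactor l 0 ≠ 0 := by exact_mod_cast ethFactor_zero_ne_zero hl
  have : x * ethFactor l 0 ^ 2 + y * ethFactor l 1 ^ 2 ≠ 0 := by positivity
  exact_mod_cast this

theorem lemma4 :
    ∃ C D : ℕ → ℝ,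
      ∀ (ρ₀ : ℝ) (ψ : Fin 5 → SpacetimeField) (ψ0 : Fin 5 → ℝ → ℂ × ℂ → ℂ)
        (Ψ : Fin 5 → SliceField) (Ψ0 : Fin 5 → ℂ × ℂ → ℂ),
        0 < ρ₀ →
        FieldExpansion ρ₀ ψ ψ0 →
        PotentialExpansion ρ₀ Ψ Ψ0 →
        (IsSpin2Field ρ₀ ψ ∨ (IsSpin2Wave ρ₀ ψ ∧ EvolutionOnSlice ρ₀ ψ)) →
        (∀ n, ∀ ρ ∈ Set.Ioo 0 ρ₀, ∀ z : ℂ × ℂ, z ≠ 0 →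
          ψ n 0 ρ z = components (hertzG (ofComponents Ψ)) n ρ z) →
        ∀ (l : ℕ) (m : ℤ), |m| ≤ (l : ℤ) →
          ∀ (a : Fin 5 → ℝ → ℂ) (b : Fin 5 → ℂ),
            (∀ n τ, a n τ = harmonicCoeff (weight n) l m (ψ0 n τ)) →
            (∀ n, b n = harmonicCoeff (weight n) l m (Ψ0 n)) →
            (RegularAtCriticalSets (a 2) ↔
              (Even l → 1 ≤ l → b 2 = C l * b 4 - D l * b 0) ∧ (Odd l → b 1 = b 3)) ∧
            (¬ RegularAtCriticalSets (a 2) → DivergesAtCriticalSets (a 2)) := by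
  -- Obtained by solving ε₁(b₀ + b₄) = 6ε₀b₂ for b₂. The value at l = 0, a division by zero, is
  -- never used.
  refine ⟨fun l => ethFactor l 1 / (6 * ethFactor l 0),
    fun l => -(ethFactor l 1 / (6 * ethFactor l 0)), ?_⟩
  intro ρ₀ ψ ψ0 Ψ Ψ0 h0 hψ hΨ heqs hG l m _ a b ha hb
  have hev : EvolutionOnSlice ρ₀ ψ := by
    rcases heqs with h | h
    · exact fun ρ hρ z hz => (h 0 (by norm_num) ρ hρ z hz).1
    · exact h.2
  obtain ⟨p, hL⟩ : ∃ p, LegendreSystem l (fun τ => modeCoeff l m 0 (ψ0 2 τ)) p := by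
    rcases heqs with h | h
    · exact hψ.legendre_of_spin2Field h0 h l m
    · exact hψ.legendre_of_spin2Wave h0 h.1 l m
  have hz : (0 : ℝ) ∈ Set.Ioo (-1 : ℝ) 1 := by norm_num
  have ha2 : a 2 = fun τ => modeCoeff l m 0 (ψ0 2 τ) := by
    funext τ
    rw [ha, modeCoeff_of_le m (by simp)]
    rfl
  set c : Fin 5 → ℂ := fun n => modeCoeff l m (weight n) (Ψ0 n) with hc
  have hcb : ∀ n, |weight n| ≤ (l : ℤ) → c n = b n := fun n hn => by
    rw [hb, hc]
    exact modeCoeff_of_le m hn _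
  have hsq : (Real.sqrt 2 : ℂ)⁻¹ ^ 3 ≠ 0 :=
    pow_ne_zero 3 (inv_ne_zero (by exact_mod_cast (Real.sqrt_pos.2 two_pos).ne'))
  have hp : p 0 = (1 / 2) * (ethFactor l 0 : ℂ) * (limitHertz l (limitOfComponents c) 0 0 0 1
      - limitHertz l (limitOfComponents c) 0 1 1 1) := by
    -- At τ = 0 the factor 1 - τ² is 1, so p(0) is the initial velocity of the mode.
    have h1 := (hL 0 hz).1.unique (hψ.hasDerivAt_modeCoeff_lead 2 l m 0 hz)
    rw [hψ.deriv_middle_initial h0 hev,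
      modeCoeff_initial_eq h0 hψ hΨ 1 (A := 0) (B := 0) (C := 0) (D := 1) (by norm_num) (hG 1),
      modeCoeff_initial_eq h0 hψ hΨ 3 (A := 0) (B := 1) (C := 1) (D := 1) (by norm_num) (hG 3)]
      at h1
    simpa using h1
  have hm : modeCoeff l m 0 (ψ0 2 0) = limitHertz l (limitOfComponents c) 0 0 1 1 :=
    modeCoeff_initial_eq h0 hψ hΨ 2 (A := 0) (B := 0) (C := 1) (D := 1) (by norm_num) (hG 2) l m
  obtain ⟨hreg, hdiv⟩ := hL.regular_iff
  rw [ha2]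
  refine ⟨hreg.trans (and_congr (imp_congr_right fun he => ?_) (imp_congr_right fun ho => ?_)),
    hdiv⟩
  · rw [hp, limitHertz_sub]
    rcases Nat.eq_zero_or_pos l with rfl | hl
    -- For l = 0 the factor ε₀ vanishes, so p(0) = 0 and the mode is regular with no condition on b.
    · simp [ethFactor]
    -- A positive even l is at least 2, so the harmonics of all five weights exist and c agrees with
    -- b.
    · have hl2 : (2 : ℤ) ≤ l := by
        obtain ⟨k, hk⟩ := he
        omega
      have hα := ethFactor_zero_ne_zero hl
      have hS := three_mul_ethFactor_sq_add_ne_zero hl three_pos one_pos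
      have hw : ∀ n, |weight n| ≤ (l : ℤ) := fun n =>
        le_trans (by fin_cases n <;> simp [weight]) hl2
      rw [hcb 0 (hw 0), hcb 2 (hw 2), hcb 4 (hw 4)]
      push_cast at hS ⊢
      rw [one_mul] at hS
      have hl1 : 1 ≤ l := hl
      simp only [hl1, true_imp_iff, mul_eq_zero, hα, hsq, hS, or_false]
      norm_num
      rw [sub_eq_zero]
      constructor
      · intro h
        field_simp
        linear_combination -h
      · intro h
        rw [h]
        field_simp
        ring
  · have hl : 1 ≤ l := ho.pos
    have hα := ethFactor_zero_ne_zero hl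
    have hS := three_mul_ethFactor_sq_add_ne_zero hl two_pos one_pos
    have hl' : (1 : ℤ) ≤ l := by exact_mod_cast hl
    rw [hm, limitHertz_middle, hcb 1 (by simpa [weight] using hl'),
      hcb 3 (by simpa [weight] using hl')]
    push_cast at hS
    rw [one_mul] at hS
    simp only [mul_eq_zero, hα, hsq, hS, or_false, sub_eq_zero]
    norm_num

end
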